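/- Let $A$ be a Dedekind domain whose fraction field $K$ has characteristic $0$, and let $\overline K$ be an algebraic closure of $K$. Let $\overline X$ be an integral smooth projective variety over $\overline K$ with $\operatorname{Pic}(\overline X)\cong\mathbb Z^r$, fix a basis of $\operatorname{Pic}(\overline X)$ and divisors $D_1,\dots,D_r$ representing it, and let $$\operatorname{Cox}(\overline X)=\bigoplus_{n\in\mathbb Z^r}H^0\bigl(\overline X,\mathcal O(n_1D_1+\dots+n_rD_r)\bigr).$$ Assume that $\operatorname{Cox}(\overline X)=\overline K[\eta_1,\dots,\eta_N]/I$ with $\eta_1,\dots,\eta_N$ homogeneous for the $\mathbb Z^r$-grading, that $I$ is generated by polynomials $g_1,\dots,g_s\in A[\eta_1,\dots,\eta_N]$, and that $I\cap A[\eta_1,\dots,\eta_N]=(g_1,\dots,g_s)$. Let $\overline Y\subseteq\operatorname{Spec}(\operatorname{Cox}(\overline X))$ be the characteristic space of $\overline X$, that is, the image of the relative spectrum over $\overline X$ of the Cox sheaf $\bigoplus_{n\in\mathbb Z^r}\mathcal O(n_1D_1+\dots+n_rD_r)$, and let $f_1,\dots,f_m\in\overline K[\eta_1,\dots,\eta_N]\smallsetminus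 I$ be monic monomials that define its complement. Put $R:=A[\eta_1,\dots,\eta_N]/(g_1,\dots,g_s)$, with the $\mathbb Z^r$-grading in which each $\eta_j$ has the same degree as in $\operatorname{Cox}(\overline X)$, and let $Y$ be the complement in $\operatorname{Spec}(R)$ of the closed subset defined by $f_1,\dots,f_m$. Assume that for all $i,j\in\{1,\dots,m\}$ the ring $R[f_i^{-1}]$ contains a homogeneous invertible element whose degree is a nonzero integral multiple of $\deg f_j$, that is, equals $n\deg f_j$ for some integer $n\neq0$. Let $R_i$ be the degree-$0$ part of $R[f_i^{-1}]$ and $V_i:=\operatorname{Spec}(R_i)$. Let $X$ be the $A$-scheme obtained by gluing $V_1,\dots,V_m$, where $V_i$ and $V_j$ are glued along the spectrum of the degree-$0$ part of $R[(f_if_j)^{-1}]$, and let $\pi:Y\to X$ be the morphism induced by the inclusions $R_i\to R[f_i^{-1}]$. Assume that $\operatorname{Spec}(R)\to\operatorname{Spec}(A)$ has geometrically integral fibers and that $\pi$ is flat. If for every $\mathfrak p\in\operatorname{Spec}(A)$, with residue field $k(\mathfrak p)$ and algebraic closure $\overline{k(\mathfrak p)}$, and every $\underline a\in Y(\overline{k(\mathfrak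 p)})$ the Jacobian matrix $$\left(\frac{\partial g_i}{\partial\eta_j}(\underline a)\right)_{1\le i\le s,\;1\le j\le N}$$ has rank $N-\dim\overline X-r$, then $X$ is smooth over $A$. -/

import Mathlib

open AlgebraicGeometry CategoryTheory Limits

universe u

namespace CoxModel

noncomputable section

section GradedLocalization

variable {A R M : Type*} [CommRing A] [CommRing R] [Algebra A R] [AddCommGroup M]

/-- For a grading `R = ⨁ 𝒜 m` and `f` homogeneous of degree `d`, the degree-`m` part of
`R[f⁻¹]`: the fractions `a / f ^ n` with `a` homogeneous of degree `m + n • d`. -/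
def awayPart (𝒜 : M → Submodule A R) (f : R) (d m : M) : Set (Localization.Away f) :=
  {x | ∃ (n : ℕ) (a : R), a ∈ 𝒜 (m + n • d) ∧
    x * algebraMap R (Localization.Away f) f ^ n = algebraMap R (Localization.Away f) a}

lemma invSelf_mul (f : R) : IsLocalization.Away.invSelf (S := Localization.Away f) f *
    algebraMap R (Localization.Away f) f = 1 := by
  rw [mul_comm, IsLocalization.Away.mul_invSelf]

variable {𝒜 : M → Submodule A R}

lemma algebraMap_mem_awayPart {f : R} {d m : M} {a : R} (ha : a ∈ 𝒜 m) :
    algebraMap R (Localization.Away f) a ∈ awayPart 𝒜 f d m :=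
  ⟨0, a, by simpa using ha, by simp⟩

variable [SetLike.GradedMonoid 𝒜]

lemma awayPart_mul {f : R} {d m m' : M} {x y : Localization.Away f}
    (hx : x ∈ awayPart 𝒜 f d m) (hy : y ∈ awayPart 𝒜 f d m') :
    x * y ∈ awayPart 𝒜 f d (m + m') := by
  obtain ⟨n, a, ha, hxa⟩ := hx
  obtain ⟨k, b, hb, hyb⟩ := hy
  refine ⟨n + k, a * b, ?_, ?_⟩
  · have := SetLike.GradedMul.mul_mem ha hb
    rwa [show m + n • d + (m' + k • d) = m + m' + (n + k) • d by rw [add_smul]; abel] at this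
  · rw [map_mul, ← hxa, ← hyb, pow_add]; ring

lemma awayPart_add {f : R} {d m : M} (hf : f ∈ 𝒜 d) {x y : Localization.Away f}
    (hx : x ∈ awayPart 𝒜 f d m) (hy : y ∈ awayPart 𝒜 f d m) :
    x + y ∈ awayPart 𝒜 f d m := by
  obtain ⟨n, a, ha, hxa⟩ := hx
  obtain ⟨k, b, hb, hyb⟩ := hy
  refine ⟨n + k, a * f ^ k + b * f ^ n, add_mem ?_ ?_, ?_⟩
  · have := SetLike.GradedMul.mul_mem ha (SetLike.pow_mem_graded k hf)
    rwa [show m + n • d + k • d = m + (n + k) • d by rw [add_smul]; abel] at this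
  · have := SetLike.GradedMul.mul_mem hb (SetLike.pow_mem_graded n hf)
    rwa [show m + k • d + n • d = m + (n + k) • d by rw [add_smul]; abel] at this
  · simp only [map_add, map_mul, map_pow]
    rw [← hxa, ← hyb, pow_add]; ring

lemma awayPart_prod {ι : Type*} {f : R} {d : M} (s : Finset ι) (x : ι → Localization.Away f)
    (m : ι → M) (h : ∀ i ∈ s, x i ∈ awayPart 𝒜 f d (m i)) :
    ∏ i ∈ s, x i ∈ awayPart 𝒜 f d (∑ i ∈ s, m i) := by
  classical
  induction s using Finset.induction_on with
  | empty =>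
    simpa using algebraMap_mem_awayPart (f := f) (d := d) (SetLike.GradedOne.one_mem (A := 𝒜))
  | insert i s hi ih =>
    rw [Finset.prod_insert hi, Finset.sum_insert hi]
    exact awayPart_mul (h i (by simp)) (ih fun j hj => h j (by simp [hj]))

lemma awayPart_pow {f : R} {d m : M} {x : Localization.Away f}
    (hx : x ∈ awayPart 𝒜 f d m) (n : ℕ) : x ^ n ∈ awayPart 𝒜 f d (n • m) := by
  simpa using awayPart_prod (Finset.range n) (fun _ => x) (fun _ => m) fun _ _ => hx

variable (𝒜) in
/-- The degree-`0` part of `R[f⁻¹]`, as an `A`-algebra. -/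
def degreeZeroPart {f : R} {d : M} (hf : f ∈ 𝒜 d) : Subalgebra A (Localization.Away f) where
  carrier := awayPart 𝒜 f d 0
  mul_mem' hx hy := by simpa using awayPart_mul hx hy
  add_mem' hx hy := awayPart_add hf hx hy
  algebraMap_mem' a := by
    rw [IsScalarTower.algebraMap_apply A R]
    refine algebraMap_mem_awayPart ?_
    rw [Algebra.algebraMap_eq_smul_one]
    exact Submodule.smul_mem _ _ SetLike.GradedOne.one_mem

/-- The natural map `R[f⁻¹] → R[f'⁻¹]` for `f ∣ f'`. -/
def awayMap {f f' : R} (h : f ∣ f') : Localization.Away f →+* Localization.Away f' :=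
  IsLocalization.Away.lift f (g := algebraMap R (Localization.Away f'))
    (isUnit_of_dvd_unit (map_dvd _ h) (IsLocalization.Away.algebraMap_isUnit f'))

@[simp]
lemma awayMap_algebraMap {f f' : R} (h : f ∣ f') (a : R) :
    awayMap h (algebraMap R _ a) = algebraMap R _ a :=
  IsLocalization.Away.lift_eq _ _ a

lemma awayMap_comp {f f' f'' : R} (h : f ∣ f') (h' : f' ∣ f'') (x : Localization.Away f) :
    awayMap h' (awayMap h x) = awayMap (h.trans h') x := by
  have : (awayMap h').comp (awayMap h) = awayMap (h.trans h') := by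
    refine IsLocalization.ringHom_ext (Submonoid.powers f) (RingHom.ext fun a => ?_)
    simp
  exact congr($this x)

lemma awayMap_id {f : R} (h : f ∣ f) (x : Localization.Away f) : awayMap h x = x := by
  have : awayMap h = RingHom.id _ := by
    refine IsLocalization.ringHom_ext (Submonoid.powers f) (RingHom.ext fun a => ?_)
    simp
  exact congr($this x)

lemma awayMap_mem {f c f' : R} {d e m : M} (hc : c ∈ 𝒜 e) (h : f * c = f')
    {x : Localization.Away f} (hx : x ∈ awayPart 𝒜 f d m) :
    awayMap (Dvd.intro c h) x ∈ awayPart 𝒜 f' (d + e) m := by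
  subst h
  obtain ⟨n, a, ha, hxa⟩ := hx
  refine ⟨n, a * c ^ n, ?_, ?_⟩
  · have := SetLike.GradedMul.mul_mem ha (SetLike.pow_mem_graded n hc)
    rwa [show m + n • d + n • e = m + n • (d + e) by rw [smul_add]; abel] at this
  · have := congr(awayMap (Dvd.intro c rfl : f ∣ f * c) $hxa)
    simp only [map_mul, map_pow, awayMap_algebraMap] at this ⊢
    rw [← this]; ring

/-- The map on degree-`0` parts induced by `R[f⁻¹] → R[(f c)⁻¹]` for homogeneous `c`. -/
def degreeZeroMap {f c f' : R} {d e d' : M} (hf : f ∈ 𝒜 d) (hc : c ∈ 𝒜 e) (hf' : f' ∈ 𝒜 d')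
    (h : f * c = f') (hd : d + e = d') :
    degreeZeroPart 𝒜 hf →+* degreeZeroPart 𝒜 hf' :=
  ((awayMap (Dvd.intro c h)).comp (degreeZeroPart 𝒜 hf).val.toRingHom).codRestrict _
    fun x => hd ▸ awayMap_mem hc h x.2

/-- If a homogeneous `y ∈ R[f⁻¹]` of degree `- deg c` becomes invertible in `R[(f c)⁻¹]`, then the
degree-`0` part of `R[(f c)⁻¹]` is the localization of that of `R[f⁻¹]` at `y c`. -/
lemma isLocalization_degreeZeroMap {f c f' : R} {d e d' : M} (hf : f ∈ 𝒜 d) (hc : c ∈ 𝒜 e)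
    (hf' : f' ∈ 𝒜 d') (h : f * c = f') (hd : d + e = d')
    {y : Localization.Away f} (E : degreeZeroPart 𝒜 hf)
    (hE : (E : Localization.Away f) = y * algebraMap R _ c)
    (hy : y ∈ awayPart 𝒜 f d (-e))
    {z : Localization.Away f'} (hz : z ∈ awayPart 𝒜 f' d' e)
    (hyz : awayMap (Dvd.intro c h) y * z = 1) :
    @IsLocalization.Away _ _ E (degreeZeroPart 𝒜 hf') _
      (degreeZeroMap hf hc hf' h hd).toAlgebra := by
  let _ := (degreeZeroMap hf hc hf' h hd).toAlgebra
  have key (x) : ((algebraMap (degreeZeroPart 𝒜 hf) (degreeZeroPart 𝒜 hf') x :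
    degreeZeroPart 𝒜 hf') : Localization.Away f') = awayMap (Dvd.intro c h) x := rfl
  subst hd
  subst h
  have hff : algebraMap R (Localization.Away (f * c)) f * algebraMap R _ c *
      IsLocalization.Away.invSelf (f * c) = 1 := by
    rw [← map_mul, IsLocalization.Away.mul_invSelf]
  have hinv : IsLocalization.Away.invSelf (S := Localization.Away (f * c)) (f * c) ∈
      awayPart 𝒜 (f * c) (d + e) (-(d + e)) := by
    refine ⟨1, 1, ?_, ?_⟩
    · simpa using SetLike.GradedOne.one_mem (A := 𝒜)
    · rw [pow_one, invSelf_mul, map_one]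
  refine ⟨?_, ?_, ?_⟩
  · rintro ⟨_, n, rfl⟩
    simp only [map_pow]
    refine IsUnit.pow n (IsUnit.of_mul_eq_one ⟨z * (algebraMap R _ f *
      IsLocalization.Away.invSelf (f * c)), ?_⟩ ?_)
    · have := awayPart_mul hz (awayPart_mul (algebraMap_mem_awayPart (f := f * c) (d := d + e) hf)
        hinv)
      rwa [show e + (d + -(d + e)) = 0 by abel] at this
    · refine Subtype.ext ?_
      change ((algebraMap (degreeZeroPart 𝒜 hf) (degreeZeroPart 𝒜 hf') E :
        degreeZeroPart 𝒜 hf') : Localization.Away (f * c)) * _ = 1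
      rw [key, hE, map_mul, awayMap_algebraMap]
      linear_combination (algebraMap R (Localization.Away (f * c)) f * algebraMap R _ c *
      IsLocalization.Away.invSelf (f * c)) * hyz + hff
  · rintro ⟨x, n, a, ha, hxa⟩
    have hfi : IsLocalization.Away.invSelf (S := Localization.Away f) f ∈ awayPart 𝒜 f d (-d) := by
      refine ⟨1, 1, ?_, ?_⟩
      · simpa using SetLike.GradedOne.one_mem (A := 𝒜)
      · rw [pow_one, invSelf_mul, map_one]
    refine ⟨⟨⟨algebraMap R _ a * y ^ n * IsLocalization.Away.invSelf f ^ n, ?_⟩, ⟨E ^ n, n, rfl⟩⟩,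
      Subtype.ext ?_⟩
    · have := awayPart_mul (awayPart_mul (algebraMap_mem_awayPart (f := f) (d := d) ha)
        (awayPart_pow hy n)) (awayPart_pow hfi n)
      rwa [show 0 + n • (d + e) + n • -e + n • -d = 0 by simp only [smul_add, smul_neg]; abel]
        at this
    · change x * ((algebraMap (degreeZeroPart 𝒜 hf) (degreeZeroPart 𝒜 hf') (E ^ n) :
        degreeZeroPart 𝒜 hf') : Localization.Away (f * c)) = _
      rw [key, key]
      have h1 : awayMap (Dvd.intro c rfl : f ∣ f * c)
          (IsLocalization.Away.invSelf (S := Localization.Away f) f) * algebraMap R _ f = 1 := by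
        rw [← awayMap_algebraMap (Dvd.intro c rfl : f ∣ f * c), ← map_mul, invSelf_mul, map_one]
      simp only [Subalgebra.coe_pow, hE, map_mul, map_pow, awayMap_algebraMap] at hxa ⊢
      have h2 := congr($h1 ^ n)
      rw [mul_pow, one_pow] at h2
      rw [← hxa]
      rw [mul_pow, mul_pow]
      linear_combination (-x * awayMap (Dvd.intro c rfl : f ∣ f * c) y ^ n *
        algebraMap R _ c ^ n) * h2
  · intro x x' hxx
    have hxx : awayMap (Dvd.intro c rfl : f ∣ f * c) (x : Localization.Away f) =
      awayMap (Dvd.intro c rfl : f ∣ f * c) (x' : Localization.Away f) := congr(($hxx).1)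
    obtain ⟨n, a, hna⟩ := IsLocalization.Away.surj f (x : Localization.Away f)
    obtain ⟨k, b, hkb⟩ := IsLocalization.Away.surj f (x' : Localization.Away f)
    have hfu : IsUnit (algebraMap R (Localization.Away f) f) :=
      IsLocalization.Away.algebraMap_isUnit f
    have h1 : algebraMap R (Localization.Away (f * c)) (a * f ^ k) =
        algebraMap R (Localization.Away (f * c)) (b * f ^ n) := by
      have e1 := congr(awayMap (Dvd.intro c rfl : f ∣ f * c) $hna)
      have e2 := congr(awayMap (Dvd.intro c rfl : f ∣ f * c) $hkb)
      simp only [map_mul, map_pow, awayMap_algebraMap] at e1 e2 ⊢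
      rw [← e1, ← e2, hxx]; ring
    obtain ⟨⟨_, l, rfl⟩, hl⟩ := (IsLocalization.eq_iff_exists (Submonoid.powers (f * c)) _).1 h1
    refine ⟨⟨E ^ l, l, rfl⟩, Subtype.ext ?_⟩
    change ((E ^ l : degreeZeroPart 𝒜 hf) : Localization.Away f) * x =
      ((E ^ l : degreeZeroPart 𝒜 hf) : Localization.Away f) * x'
    have h3 := congr(algebraMap R (Localization.Away f) $hl)
    simp only [map_mul, map_pow] at h3
    rw [← hna, ← hkb] at h3
    have hu : IsUnit (algebraMap R (Localization.Away f) f ^ (n + k + l)) := hfu.pow _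
    refine hu.mul_left_cancel ?_
    simp only [Subalgebra.coe_pow, hE]
    simp only [mul_pow, pow_add] at h3 ⊢
    linear_combination y ^ l * h3

end GradedLocalization

section Gluing

set_option linter.unusedSectionVars false

variable {A R : Type u} {M ι : Type} [CommRing A] [CommRing R] [Algebra A R] [AddCommGroup M]
  [DecidableEq ι]

/-- Homogeneous elements `f i` of degree `δ i` such that, for all `i, j`, the ring `R[(f i)⁻¹]`
contains an invertible homogeneous element (with homogeneous inverse) whose degree is a positive
multiple of `δ j`. -/
structure IsChartFamily (𝒜 : M → Submodule A R) (f : ι → R) (δ : ι → M) : Prop where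
  homogeneous (i : ι) : f i ∈ 𝒜 (δ i)
  exists_unit (i j : ι) : ∃ n : ℕ, 0 < n ∧ ∃ p ∈ awayPart 𝒜 (f i) (δ i) (n • δ j),
    ∃ q ∈ awayPart 𝒜 (f i) (δ i) (-(n • δ j)), p * q = 1

/-- Index category for the charts and their finite intersections. -/
abbrev ChartIndex (ι : Type) : Type := {S : Finset ι // S.Nonempty}

variable {𝒜 : M → Submodule A R} [SetLike.GradedMonoid 𝒜] {f : ι → R} {δ : ι → M}

namespace IsChartFamily

variable (h : IsChartFamily 𝒜 f δ)

lemma prod_mem (h : IsChartFamily 𝒜 f δ) (S : Finset ι) : ∏ i ∈ S, f i ∈ 𝒜 (∑ i ∈ S, δ i) :=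
  SetLike.prod_mem_graded 𝒜 _ _ fun i _ => h.homogeneous i

/-- The degree-`0` part of `R[(∏ i ∈ S, f i)⁻¹]`. -/
abbrev chartRing (S : Finset ι) : Subalgebra A (Localization.Away (∏ i ∈ S, f i)) :=
  degreeZeroPart 𝒜 (h.prod_mem S)

/-- The restriction map between the degree-`0` parts for `S ⊆ T`. -/
def chartMap {S T : Finset ι} (hST : S ⊆ T) : h.chartRing S →+* h.chartRing T :=
  degreeZeroMap (h.prod_mem S) (h.prod_mem (T \ S)) (h.prod_mem T)
    (by rw [mul_comm, Finset.prod_sdiff hST]) (by rw [add_comm, Finset.sum_sdiff hST])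

@[simp]
lemma coe_chartMap {S T : Finset ι} (hST : S ⊆ T) (x : h.chartRing S) :
    (h.chartMap hST x : Localization.Away (∏ i ∈ T, f i)) =
      awayMap (Finset.prod_dvd_prod_of_subset _ _ f hST) (x : Localization.Away (∏ i ∈ S, f i)) :=
  rfl

/-- The diagram of the degree-`0` parts of `R[(∏ i ∈ S, f i)⁻¹]`. -/
def chartRings : ChartIndex ι ⥤ CommRingCat.{u} where
  obj S := CommRingCat.of (h.chartRing S.1)
  map {S T} g := CommRingCat.ofHom (h.chartMap (leOfHom g))
  map_id S := by
    refine CommRingCat.hom_ext (RingHom.ext fun x => ?_)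
    exact Subtype.ext (awayMap_id dvd_rfl _)
  map_comp {S T U} g g' := by
    refine CommRingCat.hom_ext (RingHom.ext fun x => ?_)
    exact Subtype.ext (awayMap_comp (Finset.prod_dvd_prod_of_subset _ _ f (leOfHom g))
      (Finset.prod_dvd_prod_of_subset _ _ f (leOfHom g')) _).symm

/-- The diagram of the affine charts `Spec (R[(f i)⁻¹])₀` and of their finite intersections
`Spec (R[(∏ i ∈ S, f i)⁻¹])₀`. -/
def charts : (ChartIndex ι)ᵒᵖ ⥤ Scheme.{u} := h.chartRings.op ⋙ Scheme.Spec

lemma exists_chart_elt (h : IsChartFamily 𝒜 f δ) {S : Finset ι} (hS : S.Nonempty) (j : ι) :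
    ∃ y ∈ awayPart 𝒜 (∏ i ∈ S, f i) (∑ i ∈ S, δ i) (-δ j), ∀ {T : Finset ι} (hST : S ⊆ T),
      j ∈ T → ∃ z ∈ awayPart 𝒜 (∏ i ∈ T, f i) (∑ i ∈ T, δ i) (δ j),
        awayMap (Finset.prod_dvd_prod_of_subset _ _ f hST) y * z = 1 := by
  obtain ⟨i, hi⟩ := hS
  obtain ⟨n, hn, p, hp, q, hq, hpq⟩ := h.exists_unit i j
  have hiT {T : Finset ι} (hT : i ∈ T) : f i * ∏ k ∈ T.erase i, f k = ∏ k ∈ T, f k :=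
    Finset.mul_prod_erase T f hT
  have hmem {T : Finset ι} (hT : i ∈ T) {m : M} {x} (hx : x ∈ awayPart 𝒜 (f i) (δ i) m) :
      awayMap (Finset.dvd_prod_of_mem f hT) x ∈
        awayPart 𝒜 (∏ i ∈ T, f i) (∑ i ∈ T, δ i) m := by
    rw [← Finset.add_sum_erase T δ hT]
    exact awayMap_mem (h.prod_mem (T.erase i)) (hiT hT) hx
  refine ⟨awayMap (Finset.dvd_prod_of_mem f hi) q * algebraMap R _ (f j) ^ (n - 1), ?_, ?_⟩
  · have := awayPart_mul (hmem hi hq) (awayPart_pow (algebraMap_mem_awayPart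
      (f := ∏ i ∈ S, f i) (d := ∑ i ∈ S, δ i) (h.homogeneous j)) (n - 1))
    obtain ⟨n, rfl⟩ := Nat.exists_eq_add_of_lt hn
    rwa [show -((0 + n + 1) • δ j) + (0 + n + 1 - 1) • δ j = -δ j by
      simp only [zero_add, Nat.add_sub_cancel, add_smul, one_smul]; abel] at this
  · intro T hST hj
    have hu : algebraMap R (Localization.Away (∏ i ∈ T, f i)) (f j) *
        (algebraMap R _ (∏ i ∈ T.erase j, f i) * IsLocalization.Away.invSelf (∏ i ∈ T, f i)) =
          1 := by
      rw [← mul_assoc, ← map_mul, Finset.mul_prod_erase T f hj, IsLocalization.Away.mul_invSelf]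
    have hum : algebraMap R _ (∏ i ∈ T.erase j, f i) *
        IsLocalization.Away.invSelf (∏ i ∈ T, f i) ∈
          awayPart 𝒜 (∏ i ∈ T, f i) (∑ i ∈ T, δ i) (-δ j) := by
      refine ⟨1, ∏ i ∈ T.erase j, f i, ?_, ?_⟩
      · rw [one_smul, ← Finset.add_sum_erase T δ hj, neg_add_cancel_left]
        exact h.prod_mem _
      · rw [pow_one, mul_assoc, invSelf_mul, mul_one]
    refine ⟨awayMap (Finset.dvd_prod_of_mem f (hST hi)) p *
      (algebraMap R _ (∏ i ∈ T.erase j, f i) *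
        IsLocalization.Away.invSelf (∏ i ∈ T, f i)) ^ (n - 1), ?_, ?_⟩
    · have := awayPart_mul (hmem (hST hi) hp) (awayPart_pow hum (n - 1))
      obtain ⟨n, rfl⟩ := Nat.exists_eq_add_of_lt hn
      rwa [show (0 + n + 1) • δ j + (0 + n + 1 - 1) • -δ j = δ j by
        simp only [zero_add, Nat.add_sub_cancel, add_smul, one_smul, smul_neg]; abel] at this
    · rw [map_mul, map_pow, awayMap_algebraMap, awayMap_comp]
      have h1 := congr(awayMap (Finset.dvd_prod_of_mem f (hST hi)) $hpq)
      rw [map_mul, map_one] at h1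
      have h2 := congr($hu ^ (n - 1))
      rw [mul_pow, one_pow] at h2
      linear_combination (algebraMap R (Localization.Away (∏ i ∈ T, f i)) (f j) ^ (n - 1) *
        (algebraMap R _ (∏ i ∈ T.erase j, f i) *
          IsLocalization.Away.invSelf (∏ i ∈ T, f i)) ^ (n - 1)) * h1 + h2

lemma exists_isLocalization {S : Finset ι} (hS : S.Nonempty) :
    ∃ E : ι → h.chartRing S, ∀ {T : Finset ι} (hST : S ⊆ T),
      @IsLocalization.Away _ _ (∏ j ∈ T \ S, E j) (h.chartRing T) _
        (h.chartMap hST).toAlgebra := by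
  choose y hy hyz using fun j => h.exists_chart_elt hS j
  refine ⟨fun j => ⟨y j * algebraMap R _ (f j), ?_⟩, fun {T} hST => ?_⟩
  · have := awayPart_mul (hy j) (algebraMap_mem_awayPart
      (f := ∏ i ∈ S, f i) (d := ∑ i ∈ S, δ i) (h.homogeneous j))
    rwa [neg_add_cancel] at this
  · choose! z hz hz1 using fun (j : ι) (hj : j ∈ T) => hyz j hST hj
    refine isLocalization_degreeZeroMap (h.prod_mem S) (h.prod_mem (T \ S)) (h.prod_mem T) _ _
      (y := ∏ j ∈ T \ S, y j) (z := ∏ j ∈ T \ S, z j) _ ?_ ?_ ?_ ?_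
    · simp [Finset.prod_mul_distrib, map_prod]
    · rw [← Finset.sum_neg_distrib]
      exact awayPart_prod _ _ _ fun j _ => hy j
    · exact awayPart_prod _ _ _ fun j hj => hz j (Finset.mem_sdiff.1 hj).1
    · rw [map_prod, ← Finset.prod_mul_distrib]
      exact Finset.prod_eq_one fun j hj => hz1 j (Finset.mem_sdiff.1 hj).1

instance isOpenImmersion_charts_map {S T : (ChartIndex ι)ᵒᵖ} (g : S ⟶ T) :
    IsOpenImmersion (h.charts.map g) := by
  obtain ⟨E, hE⟩ := h.exists_isLocalization T.unop.2
  let _ := (h.chartMap (leOfHom g.unop)).toAlgebra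
  have := hE (leOfHom g.unop)
  exact IsOpenImmersion.of_isLocalization (∏ j ∈ S.unop.1 \ T.unop.1, E j)

instance isLocallyDirected_charts : (h.charts ⋙ Scheme.forget).IsLocallyDirected where
  cond {S T U} gS gT x y hxy := by
    obtain ⟨E, hE⟩ := h.exists_isLocalization U.unop.2
    have hr {V : ChartIndex ι} (hV : U.unop.1 ⊆ V.1) :
        Set.range (PrimeSpectrum.comap (h.chartMap hV)) =
          {P | ∀ j ∈ V.1 \ U.unop.1, E j ∉ P.asIdeal} := by
      let _ := (h.chartMap hV).toAlgebra
      have := hE hV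
      refine (PrimeSpectrum.localization_away_comap_range (h.chartRing V.1)
        (∏ j ∈ V.1 \ U.unop.1, E j)).trans ?_
      ext P
      simp [Ideal.IsPrime.prod_mem_iff]
    let V : ChartIndex ι := ⟨S.unop.1 ∪ T.unop.1, S.unop.2.mono Finset.subset_union_left⟩
    let vS : Opposite.op V ⟶ S := (homOfLE (show S.unop.1 ≤ V.1 from Finset.subset_union_left)).op
    let vT : Opposite.op V ⟶ T := (homOfLE (show T.unop.1 ≤ V.1 from Finset.subset_union_right)).op
    have hx : PrimeSpectrum.comap (h.chartMap (leOfHom gS.unop)) x ∈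
        Set.range (PrimeSpectrum.comap (h.chartMap (leOfHom (vS ≫ gS).unop))) := by
      rw [hr]
      intro j hj
      rcases Finset.mem_union.1 (Finset.mem_sdiff.1 hj).1 with hjS | hjT
      · exact (hr (leOfHom gS.unop)).le ⟨x, rfl⟩ j
          (Finset.mem_sdiff.2 ⟨hjS, (Finset.mem_sdiff.1 hj).2⟩)
      · have : PrimeSpectrum.comap (h.chartMap (leOfHom gS.unop)) x =
          PrimeSpectrum.comap (h.chartMap (leOfHom gT.unop)) y := hxy
        rw [this]
        exact (hr (leOfHom gT.unop)).le ⟨y, rfl⟩ j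
          (Finset.mem_sdiff.2 ⟨hjT, (Finset.mem_sdiff.1 hj).2⟩)
    obtain ⟨v, hv⟩ := hx
    have hv' : h.charts.map (vS ≫ gS) v = h.charts.map gS x := hv
    refine ⟨Opposite.op V, vS, vT, v, ?_, ?_⟩
    · refine (h.charts.map gS).isOpenEmbedding.injective ?_
      rw [← hv', Functor.map_comp]
      rfl
    · refine (h.charts.map gT).isOpenEmbedding.injective ?_
      refine Eq.trans ?_ (hv'.trans hxy)
      rw [Subsingleton.elim (vS ≫ gS) (vT ≫ gT), Functor.map_comp]
      rfl

/-- The scheme glued from the affine charts `Spec (R[(f i)⁻¹])₀` along their intersections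
`Spec (R[(f i * f j)⁻¹])₀`. -/
def glued : Scheme.{u} := colimit h.charts

/-- The inclusion of a chart (or of an intersection of charts) into the glued scheme. -/
def chartι (S : (ChartIndex ι)ᵒᵖ) : h.charts.obj S ⟶ h.glued := colimit.ι h.charts S

lemma map_chartι {S T : (ChartIndex ι)ᵒᵖ} (g : S ⟶ T) :
    h.charts.map g ≫ h.chartι T = h.chartι S :=
  colimit.w h.charts g

/-- The structure morphism of the glued scheme. -/
def gluedToSpec : h.glued ⟶ Spec (CommRingCat.of A) :=
  colimit.desc h.charts
    { pt := Spec (CommRingCat.of A)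
      ι :=
        { app S := Spec.map (CommRingCat.ofHom (algebraMap A (h.chartRing S.unop.1)))
          naturality S T g := by
            refine Eq.trans ?_ (Category.comp_id _).symm
            refine (Spec.map_comp _ _).symm.trans (congrArg Spec.map ?_)
            refine CommRingCat.hom_ext (RingHom.ext fun a => Subtype.ext ?_)
            change awayMap (Finset.prod_dvd_prod_of_subset _ _ f (leOfHom g.unop))
              (algebraMap A _ a) = algebraMap A _ a
            rw [IsScalarTower.algebraMap_apply A R, awayMap_algebraMap,
              ← IsScalarTower.algebraMap_apply A R] } }

end IsChartFamily

/-- The complement in `Spec R` of the closed subset defined by the `f i`. -/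
def complementOpens (f : ι → R) : (Spec (CommRingCat.of R)).Opens :=
  ⟨(PrimeSpectrum.zeroLocus (Set.range f))ᶜ,
    (PrimeSpectrum.isClosed_zeroLocus (Set.range f)).isOpen_compl⟩

lemma range_away (f : ι → R) (S : Finset ι) :
    Set.range (Spec.map (CommRingCat.ofHom
      (algebraMap R (Localization.Away (∏ i ∈ S, f i))))) =
      {P : PrimeSpectrum R | ∀ i ∈ S, f i ∉ P.asIdeal} := by
  refine (PrimeSpectrum.localization_away_comap_range _ (∏ i ∈ S, f i)).trans ?_
  ext P
  simp [Ideal.IsPrime.prod_mem_iff]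

lemma range_away_subset (f : ι → R) {S : Finset ι} (hS : S.Nonempty) :
    Set.range (Spec.map (CommRingCat.ofHom
      (algebraMap R (Localization.Away (∏ i ∈ S, f i))))) ⊆
      Set.range (complementOpens f).ι := by
  rw [range_away, Scheme.Opens.range_ι]
  intro P hP hP'
  obtain ⟨i, hi⟩ := hS
  exact hP i hi (hP' ⟨i, rfl⟩)

/-- The diagram of the rings `R[(∏ i ∈ S, f i)⁻¹]`. -/
def awayRings (f : ι → R) : ChartIndex ι ⥤ CommRingCat.{u} where
  obj S := CommRingCat.of (Localization.Away (∏ i ∈ S.1, f i))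
  map {S T} g := CommRingCat.ofHom (awayMap (Finset.prod_dvd_prod_of_subset _ _ f (leOfHom g)))
  map_id S := by
    refine CommRingCat.hom_ext (RingHom.ext fun x => ?_)
    exact awayMap_id dvd_rfl _
  map_comp {S T U} g g' := by
    refine CommRingCat.hom_ext (RingHom.ext fun x => ?_)
    exact (awayMap_comp (Finset.prod_dvd_prod_of_subset _ _ f (leOfHom g))
      (Finset.prod_dvd_prod_of_subset _ _ f (leOfHom g')) _).symm

/-- The inclusion of `Spec R[(∏ i ∈ S, f i)⁻¹]` into `complementOpens f`. -/
def complementIncl (f : ι → R) (S : (ChartIndex ι)ᵒᵖ) :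
    ((awayRings f).op ⋙ Scheme.Spec).obj S ⟶ (complementOpens f).toScheme :=
  IsOpenImmersion.lift (complementOpens f).ι (Spec.map (CommRingCat.ofHom
    (algebraMap R (Localization.Away (∏ i ∈ S.unop.1, f i))))) (range_away_subset f S.unop.2)

lemma complementIncl_ι (f : ι → R) (S : (ChartIndex ι)ᵒᵖ) :
    complementIncl f S ≫ (complementOpens f).ι = Spec.map (CommRingCat.ofHom
      (algebraMap R (Localization.Away (∏ i ∈ S.unop.1, f i)))) :=
  IsOpenImmersion.lift_fac _ _ _

instance (f : ι → R) (S : (ChartIndex ι)ᵒᵖ) : IsOpenImmersion (complementIncl f S) := by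
  have : IsOpenImmersion (complementIncl f S ≫ (complementOpens f).ι) := by
    rw [complementIncl_ι]
    exact IsOpenImmersion.of_isLocalization (∏ i ∈ S.unop.1, f i)
  exact IsOpenImmersion.of_comp _ (complementOpens f).ι

lemma map_complementIncl (f : ι → R) {S T : (ChartIndex ι)ᵒᵖ} (g : S ⟶ T) :
    ((awayRings f).op ⋙ Scheme.Spec).map g ≫ complementIncl f T = complementIncl f S := by
  rw [← cancel_mono (complementOpens f).ι, Category.assoc, complementIncl_ι, complementIncl_ι]
  refine (Spec.map_comp _ _).symm.trans (congrArg Spec.map ?_)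
  refine CommRingCat.hom_ext (RingHom.ext fun x => ?_)
  exact awayMap_algebraMap (Finset.prod_dvd_prod_of_subset _ _ f (leOfHom g.unop)) _

lemma range_complementIncl (f : ι → R) (S : (ChartIndex ι)ᵒᵖ) :
    Set.range (complementIncl f S) =
      {x | ∀ i ∈ S.unop.1, f i ∉ PrimeSpectrum.asIdeal ((complementOpens f).ι x)} := by
  have h := range_away f S.unop.1
  rw [← complementIncl_ι] at h
  ext x
  have hx := Set.ext_iff.1 h ((complementOpens f).ι x)
  refine Iff.trans ⟨?_, ?_⟩ hx
  · rintro ⟨y, rfl⟩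
    exact ⟨y, rfl⟩
  · rintro ⟨y, hy⟩
    exact ⟨y, (complementOpens f).ι.isOpenEmbedding.injective hy⟩

/-- The open cover of `complementOpens f` by the `Spec R[(f i)⁻¹]` and their finite
intersections. -/
@[simps]
def complementCover (f : ι → R) : (complementOpens f).toScheme.OpenCover where
  I₀ := (ChartIndex ι)ᵒᵖ
  X S := ((awayRings f).op ⋙ Scheme.Spec).obj S
  f S := complementIncl f S
  mem₀ := by
    rw [Scheme.presieve₀_mem_precoverage_iff]
    refine ⟨fun x => ?_, fun S => inferInstance⟩
    have hx : (complementOpens f).ι x ∈ complementOpens f := x.2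
    have : ∃ i, f i ∉ PrimeSpectrum.asIdeal ((complementOpens f).ι x) := by
      by_contra! hc
      exact hx (Set.range_subset_iff.2 hc)
    obtain ⟨i, hi⟩ := this
    refine ⟨Opposite.op ⟨{i}, Finset.singleton_nonempty i⟩, ?_⟩
    refine (range_complementIncl f (Opposite.op ⟨{i}, Finset.singleton_nonempty i⟩)).ge ?_
    intro j hj
    rwa [Finset.mem_singleton.1 hj]

instance (f : ι → R) : Category (complementCover f).I₀ :=
  inferInstanceAs (Category (ChartIndex ι)ᵒᵖ)

lemma isOpenImmersion_awayRings_map (f : ι → R) {S T : (ChartIndex ι)ᵒᵖ} (g : S ⟶ T) :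
    IsOpenImmersion (((awayRings f).op ⋙ Scheme.Spec).map g) := by
  have : IsOpenImmersion (((awayRings f).op ⋙ Scheme.Spec).map g ≫ complementIncl f T) := by
    rw [map_complementIncl]; infer_instance
  exact IsOpenImmersion.of_comp _ (complementIncl f T)

instance (f : ι → R) : (complementCover f).LocallyDirected where
  trans g := ((awayRings f).op ⋙ Scheme.Spec).map g
  trans_id S := ((awayRings f).op ⋙ Scheme.Spec).map_id S
  trans_comp g g' := ((awayRings f).op ⋙ Scheme.Spec).map_comp g g'
  w g := map_complementIncl f g
  directed {S T} x := by
    let S' : (ChartIndex ι)ᵒᵖ := S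
    let T' : (ChartIndex ι)ᵒᵖ := T
    let V : ChartIndex ι := ⟨S'.unop.1 ∪ T'.unop.1, S'.unop.2.mono Finset.subset_union_left⟩
    let vS : Opposite.op V ⟶ S' :=
      (homOfLE (show S'.unop.1 ≤ V.1 from Finset.subset_union_left)).op
    let vT : Opposite.op V ⟶ T' :=
      (homOfLE (show T'.unop.1 ≤ V.1 from Finset.subset_union_right)).op
    let p := pullback.fst (complementIncl f S') (complementIncl f T') ≫ complementIncl f S'
    have hp : p = pullback.snd (complementIncl f S') (complementIncl f T') ≫ complementIncl f T' :=
      pullback.condition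
    have hx : p x ∈ Set.range (complementIncl f (Opposite.op V)) := by
      rw [range_complementIncl]
      intro j hj
      rcases Finset.mem_union.1 hj with hjS | hjT
      · exact (range_complementIncl f S').le ⟨_, rfl⟩ j hjS
      · rw [hp]
        exact (range_complementIncl f T').le ⟨_, rfl⟩ j hjT
    obtain ⟨v, hv⟩ := hx
    refine ⟨Opposite.op V, vS, vT, v, ?_⟩
    have : IsOpenImmersion p := by
      unfold p
      infer_instance
    refine p.isOpenEmbedding.injective ?_
    refine Eq.trans ?_ hv
    have hl : pullback.lift (f := complementIncl f S') (g := complementIncl f T')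
        (((awayRings f).op ⋙ Scheme.Spec).map vS) (((awayRings f).op ⋙ Scheme.Spec).map vT)
        (by rw [map_complementIncl, map_complementIncl]) ≫ p = complementIncl f (Opposite.op V) :=
      (pullback.lift_fst_assoc _ _ _ _).trans (map_complementIncl f vS)
    exact congr($hl v)
  property_trans g := isOpenImmersion_awayRings_map f g

/-- The inclusions of the degree-`0` parts `(R[(∏ i ∈ S, f i)⁻¹])₀` into
`R[(∏ i ∈ S, f i)⁻¹]`. -/
def IsChartFamily.chartIncl (h : IsChartFamily 𝒜 f δ) : h.chartRings ⟶ awayRings f where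
  app S := CommRingCat.ofHom (h.chartRing S.1).val.toRingHom
  naturality _ _ _ := rfl

/-- The morphisms `Spec R[(∏ i ∈ S, f i)⁻¹] ⟶ Spec (R[(∏ i ∈ S, f i)⁻¹])₀`. -/
def IsChartFamily.toCharts (h : IsChartFamily 𝒜 f δ) :
    (awayRings f).op ⋙ Scheme.Spec ⟶ h.charts :=
  Functor.whiskerRight (NatTrans.op h.chartIncl) Scheme.Spec

/-- The morphism `Spec R[(∏ i ∈ S, f i)⁻¹] ⟶ Spec (R[(∏ i ∈ S, f i)⁻¹])₀` followed by the
inclusion of the chart. -/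
def IsChartFamily.localProj (h : IsChartFamily 𝒜 f δ) (S : (ChartIndex ι)ᵒᵖ) :
    ((awayRings f).op ⋙ Scheme.Spec).obj S ⟶ h.glued :=
  h.toCharts.app S ≫ h.chartι S

lemma IsChartFamily.map_localProj (h : IsChartFamily 𝒜 f δ) {S T : (ChartIndex ι)ᵒᵖ}
    (g : S ⟶ T) :
    ((awayRings f).op ⋙ Scheme.Spec).map g ≫ h.localProj T = h.localProj S := by
  rw [localProj, NatTrans.naturality_assoc, map_chartι, localProj]

/-- The morphism from `Spec R` minus the closed subset defined by the `f i` to the glued scheme,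
induced by the inclusions of the degree-`0` parts of the `R[(f i)⁻¹]`. -/
def IsChartFamily.proj (h : IsChartFamily 𝒜 f δ) :
    (complementOpens f).toScheme ⟶ h.glued :=
  (complementCover f).glueMorphismsOfLocallyDirected (fun S => h.localProj S)
    fun g => h.map_localProj g

end Gluing

section Variety

attribute [local instance] MvPolynomial.gradedAlgebra

/-- A smooth projective integral variety over a field `k`. -/
structure SmoothProjectiveVariety (k : Type u) [Field k] where
  /-- the underlying scheme -/
  X : Scheme.{u}
  /-- the structure morphism -/
  str : X ⟶ Spec (CommRingCat.of k)
  isIntegral : IsIntegral X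
  smooth : Smooth str
  /-- `X` is isomorphic over `k` to a closed subscheme of some projective space `ℙⁿ` over `k` -/
  projective : ∃ (n : ℕ) (i : X ⟶ Proj (MvPolynomial.homogeneousSubmodule (Fin (n + 1)) k)),
    IsClosedImmersion i ∧
      i ≫ Proj.toSpecZero (MvPolynomial.homogeneousSubmodule (Fin (n + 1)) k) ≫
        Spec.map (CommRingCat.ofHom
          (algebraMap k (MvPolynomial.homogeneousSubmodule (Fin (n + 1)) k 0))) = str

attribute [instance] SmoothProjectiveVariety.isIntegral SmoothProjectiveVariety.smooth

namespace SmoothProjectiveVariety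

variable {k : Type u} [Field k] (V : SmoothProjectiveVariety k)

instance : IsLocallyNoetherian V.X := LocallyOfFiniteType.isLocallyNoetherian V.str

/-- Prime divisors, given by their generic points, the points of codimension one. -/
abbrev PrimeDivisor : Type u := {x : V.X // Order.coheight x = 1}

/-- (Weil) divisors. -/
abbrev Divisor : Type u := V.PrimeDivisor →₀ ℤ

/-- The subgroup of principal divisors. -/
def principalDivisors : AddSubgroup V.Divisor where
  carrier := {E | ∃ φ : V.X.functionField, φ ≠ 0 ∧
    ∀ x : V.PrimeDivisor, E x = Scheme.ord φ x.1}
  zero_mem' := ⟨1, one_ne_zero, fun x => by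
    have := Scheme.ord_mul (x := x.1) (one_ne_zero (α := V.X.functionField)) one_ne_zero
    rw [mul_one] at this
    rw [Finsupp.zero_apply]
    linarith⟩
  add_mem' := by
    rintro E E' ⟨φ, hφ, h⟩ ⟨ψ, hψ, h'⟩
    exact ⟨φ * ψ, mul_ne_zero hφ hψ, fun x => by
      rw [Scheme.ord_mul hφ hψ, Finsupp.add_apply, h, h']⟩
  neg_mem' := by
    rintro E ⟨φ, hφ, h⟩
    refine ⟨φ⁻¹, inv_ne_zero hφ, fun x => ?_⟩
    have h1 := Scheme.ord_mul (x := x.1) (one_ne_zero (α := V.X.functionField)) one_ne_zero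
    have h2 := Scheme.ord_mul (x := x.1) hφ (inv_ne_zero hφ)
    rw [mul_inv_cancel₀ hφ] at h2
    rw [mul_one] at h1
    rw [Finsupp.neg_apply, h]
    linarith

/-- The Picard group of the smooth variety `V`, as the group of divisor classes. -/
abbrev Pic : Type u := V.Divisor ⧸ V.principalDivisors

/-- The sections over `U` of the sheaf `𝒪(E)`: the rational functions `φ` with `φ = 0` or
`div φ + E ≥ 0` on `U`. -/
def sections (E : V.Divisor) (U : V.X.Opens) : Set V.X.functionField :=
  {φ | φ = 0 ∨ ∀ x : V.PrimeDivisor, x.1 ∈ U → 0 ≤ Scheme.ord φ x.1 + E x}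

/-- The embedding of the ground field into the function field. -/
def constants : k →+* V.X.functionField :=
  ((Scheme.ΓSpecIso (CommRingCat.of k)).inv ≫ V.str.appTop ≫
    V.X.presheaf.germ ⊤ (genericPoint V.X) trivial).hom

variable {r : ℕ} (D : Fin r → V.Divisor)

/-- The Laurent polynomial ring in `r` variables over the function field. A monomial
`φ T ^ m` stands for the rational function `φ`, seen as a rational section of
`𝒪(m₁ D₁ + ⋯ + mᵣ Dᵣ)`. -/
abbrev LaurentRing (r : ℕ) : Type u := AddMonoidAlgebra V.X.functionField (Fin r → ℤ)

/-- The sections over a nonempty open `U` of the Cox sheaf `⨁_{m ∈ ℤʳ} 𝒪(m₁ D₁ + ⋯ + mᵣ Dᵣ)`, as a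
subring of the Laurent polynomial ring over the function field. As `V` is normal, the set on the
right is already a subring, and taking the subring that it generates adds nothing. -/
def coxSections (U : V.X.Opens) : Subring (V.LaurentRing r) :=
  Subring.closure {F | ∀ m : Fin r → ℤ, F.coeff m ∈ V.sections (∑ i, m i • D i) U}

lemma coxSections_anti {U U' : V.X.Opens} (h : U ≤ U') :
    V.coxSections D U' ≤ V.coxSections D U :=
  Subring.closure_mono fun _ hF m => (hF m).imp id fun hx x hxU => hx x (h hxU)

/-- The Cox ring `⨁_{m ∈ ℤʳ} H⁰(V, 𝒪(m₁ D₁ + ⋯ + mᵣ Dᵣ))`, for divisors `Dᵢ` whose classes are a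
basis of the Picard group. -/
abbrev coxRing : Subring (V.LaurentRing r) := V.coxSections D ⊤

/-- The characteristic space as a subset of the spectrum of the Cox ring: the image of the relative
spectrum of the Cox sheaf, which is covered by the spectra of the sections of the Cox sheaf over the
nonempty affine open subsets. -/
def characteristicSpace : Set (PrimeSpectrum (V.coxRing D)) :=
  {P | ∃ U : V.X.Opens, IsAffineOpen U ∧ (U : Set V.X).Nonempty ∧
    P ∈ Set.range (PrimeSpectrum.comap (Subring.inclusion (V.coxSections_anti D (le_top (a := U)))))}

/-- The `k`-algebra homomorphism from `k[η₁, …, η_N]` to the Laurent polynomial ring over the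
function field that sends the variable `η_j` to the rational function `η j` in degree `w j`. -/
def presentation {N : ℕ} (w : Fin N → Fin r → ℤ) (η : Fin N → V.X.functionField) :
    MvPolynomial (Fin N) k →+* V.LaurentRing r :=
  MvPolynomial.eval₂Hom (AddMonoidAlgebra.singleZeroRingHom.comp V.constants)
    fun j => AddMonoidAlgebra.single (w j) (η j)

end SmoothProjectiveVariety

end Variety

section Model

variable {A : Type u} [CommRing A] {N s r : ℕ}

/-- The ring `A[η₁, …, η_N] / (g₁, …, g_s)`. -/
abbrev RelRing (g : Fin s → MvPolynomial (Fin N) A) : Type u :=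
  MvPolynomial (Fin N) A ⧸ Ideal.span (Set.range g)

/-- The class of the monic monomial with exponent `e`. -/
def monomialClass (g : Fin s → MvPolynomial (Fin N) A) (e : Fin N →₀ ℕ) : RelRing g :=
  Ideal.Quotient.mk _ (MvPolynomial.monomial e 1)

/-- The degree-`d` part of `A[η₁, …, η_N] / (g₁, …, g_s)`, where `η_j` has degree `w j`. -/
def gradedPiece (g : Fin s → MvPolynomial (Fin N) A) (w : Fin N → Fin r → ℤ) (d : Fin r → ℤ) :
    Submodule A (RelRing g) :=
  (MvPolynomial.weightedHomogeneousSubmodule A w d).map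
    (Ideal.Quotient.mkₐ A (Ideal.span (Set.range g))).toLinearMap

instance (g : Fin s → MvPolynomial (Fin N) A) (w : Fin N → Fin r → ℤ) :
    SetLike.GradedMonoid (gradedPiece g w) where
  one_mem := ⟨1, MvPolynomial.isWeightedHomogeneous_one A w, rfl⟩
  mul_mem := by
    rintro d d' _ _ ⟨a, ha, rfl⟩ ⟨b, hb, rfl⟩
    exact ⟨a * b, MvPolynomial.IsWeightedHomogeneous.mul ha hb, rfl⟩

/-- An integral model of a universal torsor: a smooth projective variety over `k` whose Cox ring is
finitely generated with relations defined over `A`, together with monomials that define the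
complement of the characteristic space. -/
structure TorsorModel (A k : Type u) [CommRing A] [Field k] [Algebra A k] (r N s m : ℕ) where
  /-- the variety over `k` -/
  V : SmoothProjectiveVariety k
  /-- divisors representing a basis of the Picard group -/
  D : Fin r → V.Divisor
  linearIndependent : LinearIndependent ℤ fun i => (QuotientAddGroup.mk (D i) : V.Pic)
  span_eq_top : Submodule.span ℤ (Set.range fun i => (QuotientAddGroup.mk (D i) : V.Pic)) = ⊤
  /-- the degrees of the generators of the Cox ring -/
  w : Fin N → Fin r → ℤ
  /-- the generators of the Cox ring, as global sections of the `𝒪(w_{j1} D₁ + ⋯ + w_{jr} Dᵣ)` -/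
  η : Fin N → V.X.functionField
  η_mem : ∀ j, η j ∈ V.sections (∑ i, w j i • D i) ⊤
  /-- the relations -/
  g : Fin s → MvPolynomial (Fin N) A
  /-- the `η j` generate the Cox ring over `k` -/
  range_eq : (V.presentation w η).range = V.coxRing D
  /-- the `g i` generate the ideal of relations over `k` -/
  ker_eq : RingHom.ker (V.presentation w η) =
      Ideal.span (Set.range fun i => MvPolynomial.map (algebraMap A k) (g i))
  /-- the ideal of relations meets `A[η₁, …, η_N]` in `(g₁, …, g_s)` -/
  comap_eq : (Ideal.span (Set.range fun i => MvPolynomial.map (algebraMap A k) (g i))).comap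
    (MvPolynomial.map (algebraMap A k)) = Ideal.span (Set.range g)
  /-- the exponents of the monic monomials `f₁, …, f_m` -/
  e : Fin m → Fin N →₀ ℕ
  monomial_notMem : ∀ i, MvPolynomial.monomial (e i) 1 ∉
    Ideal.span (Set.range fun i => MvPolynomial.map (algebraMap A k) (g i))
  /-- `f₁, …, f_m` define the complement of the characteristic space -/
  compl_eq : (V.characteristicSpace D)ᶜ = PrimeSpectrum.zeroLocus
    {c : V.coxRing D | ∃ i, (c : V.LaurentRing r) =
      V.presentation w η (MvPolynomial.monomial (e i) 1)}
  /-- for all `i, j`, the ring `R[f_i⁻¹]` has a homogeneous unit whose degree is a nonzero multiple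
  of the degree of `f_j` -/
  exists_unit : ∀ i j, ∃ n : ℤ, n ≠ 0 ∧ ∃ u : (Localization.Away (monomialClass g (e i)))ˣ,
    (u : Localization.Away (monomialClass g (e i))) ∈ awayPart (gradedPiece g w)
      (monomialClass g (e i)) (Finsupp.weight w (e i)) (n • Finsupp.weight w (e j))

namespace SmoothProjectiveVariety

variable {k : Type u} [Field k] (V : SmoothProjectiveVariety k) {r N : ℕ}

lemma presentation_monomial (w : Fin N → Fin r → ℤ) (η : Fin N → V.X.functionField)
    (e : Fin N →₀ ℕ) (c : k) : V.presentation w η (MvPolynomial.monomial e c) =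
      AddMonoidAlgebra.single (Finsupp.weight w e) (V.constants c * e.prod fun j n => η j ^ n) := by
  have h (e : Fin N →₀ ℕ) : (e.prod fun j n => (AddMonoidAlgebra.single (w j) (η j) :
      V.LaurentRing r) ^ n) =
        AddMonoidAlgebra.single (Finsupp.weight w e) (e.prod fun j n => η j ^ n) := by
    induction e using Finsupp.induction_linear with
    | zero => simp [AddMonoidAlgebra.one_def]
    | add a b ha hb =>
      rw [Finsupp.prod_add_index' (by simp) (by simp [pow_add]),
        Finsupp.prod_add_index' (by simp) (by simp [pow_add]), ha, hb, map_add,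
        AddMonoidAlgebra.single_mul_single]
    | single j n => simp [AddMonoidAlgebra.single_pow, Finsupp.weight_apply]
  rw [presentation, MvPolynomial.coe_eval₂Hom, MvPolynomial.eval₂_monomial, h]
  simp [AddMonoidAlgebra.single_mul_single]

lemma presentation_component (w : Fin N → Fin r → ℤ) (η : Fin N → V.X.functionField)
    (d : Fin r → ℤ) (P : MvPolynomial (Fin N) k) :
    V.presentation w η (MvPolynomial.weightedHomogeneousComponent w d P) =
      AddMonoidAlgebra.single d ((V.presentation w η P).coeff d) := by
  induction P using MvPolynomial.induction_on' with
  | monomial e c =>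
    rw [MvPolynomial.weightedHomogeneousComponent_of_mem
      (MvPolynomial.isWeightedHomogeneous_monomial w e c rfl)]
    split_ifs with hd
    · rw [presentation_monomial, hd]
      simp
    · rw [presentation_monomial, map_zero]
      simp [Ne.symm hd]
  | add P Q hP hQ => simp [map_add, hP, hQ]

end SmoothProjectiveVariety

namespace TorsorModel

variable {A k : Type u} [CommRing A] [Field k] [Algebra A k] {r N s m : ℕ}
  (M : TorsorModel A k r N s m)

lemma component_mem {P : MvPolynomial (Fin N) A} (hP : P ∈ Ideal.span (Set.range M.g))
    (d : Fin r → ℤ) :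
    MvPolynomial.weightedHomogeneousComponent M.w d P ∈ Ideal.span (Set.range M.g) := by
  have hmap : MvPolynomial.map (algebraMap A k)
      (MvPolynomial.weightedHomogeneousComponent M.w d P) =
        MvPolynomial.weightedHomogeneousComponent M.w d (MvPolynomial.map (algebraMap A k) P) := by
    ext e
    simp only [MvPolynomial.coeff_map, MvPolynomial.coeff_weightedHomogeneousComponent]
    split_ifs <;> simp
  rw [← M.comap_eq, Ideal.mem_comap, ← M.ker_eq, RingHom.mem_ker] at hP ⊢
  rw [hmap, SmoothProjectiveVariety.presentation_component, hP]
  simp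

attribute [local instance] MvPolynomial.weightedGradedAlgebra in
/-- The inverse of a homogeneous unit of `R[f_i⁻¹]` is homogeneous. -/
lemma inv_mem_awayPart (i : Fin m) {D : Fin r → ℤ} {F : RelRing M.g}
    (hF : F = monomialClass M.g (M.e i)) {u v : Localization.Away F} (huv : u * v = 1)
    (hu : u ∈ awayPart (gradedPiece M.g M.w) F (Finsupp.weight M.w (M.e i)) D) :
    v ∈ awayPart (gradedPiece M.g M.w) F (Finsupp.weight M.w (M.e i)) (-D) := by
  set δ := Finsupp.weight M.w (M.e i) with hδ
  let f : MvPolynomial (Fin N) A := MvPolynomial.monomial (M.e i) 1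
  have hf : f ∈ MvPolynomial.weightedHomogeneousSubmodule A M.w δ :=
    MvPolynomial.isWeightedHomogeneous_monomial _ _ _ rfl
  have hfp (n : ℕ) : f ^ n ∈ MvPolynomial.weightedHomogeneousSubmodule A M.w (n • δ) :=
    SetLike.pow_mem_graded n hf
  obtain ⟨n, _, ⟨P, hP, rfl⟩, hua⟩ := hu
  obtain ⟨l, b, hvb⟩ := IsLocalization.Away.surj F v
  obtain ⟨B, rfl⟩ := Ideal.Quotient.mk_surjective (I := Ideal.span (Set.range M.g)) b
  have hua : u * algebraMap _ _ F ^ n = algebraMap (RelRing M.g) _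
      (Ideal.Quotient.mk (Ideal.span (Set.range M.g)) P) := hua
  have h1 : algebraMap (RelRing M.g) (Localization.Away F) (F ^ (n + l)) =
      algebraMap (RelRing M.g) _ (Ideal.Quotient.mk _ (P * B)) := by
    rw [map_mul, map_mul, ← hua, ← hvb, map_pow, pow_add]
    linear_combination (-(algebraMap (RelRing M.g) (Localization.Away F) F ^ n *
      algebraMap (RelRing M.g) (Localization.Away F) F ^ l)) * huv
  obtain ⟨⟨_, t, rfl⟩, ht⟩ := (IsLocalization.eq_iff_exists (Submonoid.powers F) _).1 h1
  have ht : F ^ t * F ^ (n + l) = F ^ t * Ideal.Quotient.mk _ (P * B) := ht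
  have hmem : f ^ (t + (n + l)) - f ^ t * P * B ∈ Ideal.span (Set.range M.g) := by
    rw [← Ideal.Quotient.eq, pow_add, mul_assoc]
    simpa [map_mul, map_pow, hF, monomialClass, mul_assoc] using ht
  let B' := MvPolynomial.weightedHomogeneousComponent M.w (l • δ - D) B
  have hmem' : f ^ (t + (n + l)) - f ^ t * P * B' ∈ Ideal.span (Set.range M.g) := by
    have h2 := M.component_mem hmem ((t + (n + l)) • δ)
    have h3 : MvPolynomial.weightedHomogeneousComponent M.w ((t + (n + l)) • δ)
        (f ^ (t + (n + l))) = f ^ (t + (n + l)) :=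
      MvPolynomial.weightedHomogeneousComponent_eq_self (hfp _)
    have h4 : MvPolynomial.weightedHomogeneousComponent M.w ((t + (n + l)) • δ)
        (f ^ t * P * B) = f ^ t * P * B' := by
      have hfP : f ^ t * P ∈ MvPolynomial.weightedHomogeneousSubmodule A M.w
          (t • δ + (D + n • δ)) := SetLike.mul_mem_graded (hfp t) hP
      have h5 := DirectSum.coe_decompose_mul_add_of_left_mem
        (MvPolynomial.weightedHomogeneousSubmodule A M.w) (b := B) (j := l • δ - D) hfP
      rw [show t • δ + (D + n • δ) + (l • δ - D) = (t + (n + l)) • δ by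
        simp only [add_smul]; abel] at h5
      have h6 (d Q) : (DirectSum.decompose
          (MvPolynomial.weightedHomogeneousSubmodule A M.w) Q d : MvPolynomial (Fin N) A) =
            MvPolynomial.weightedHomogeneousComponent M.w d Q :=
        MvPolynomial.weightedDecomposition.decompose'_apply A M.w Q d
      rwa [h6, h6] at h5
    rwa [map_sub, h3, h4] at h2
  refine ⟨l, Ideal.Quotient.mk _ B', ⟨B', ?_, rfl⟩, ?_⟩
  · rw [neg_add_eq_sub]
    exact MvPolynomial.weightedHomogeneousComponent_mem _ _ _
  · have h6 : F ^ (t + (n + l)) = F ^ t * Ideal.Quotient.mk _ P * Ideal.Quotient.mk _ B' := by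
      have := Ideal.Quotient.eq.2 hmem'
      simpa [map_mul, map_pow, hF, monomialClass] using this
    have h7 := congr(algebraMap _ (Localization.Away F) $h6)
    rw [map_mul, map_mul, ← hua, map_pow, map_pow] at h7
    have hFu : IsUnit (algebraMap (RelRing M.g) (Localization.Away F) F ^ (t + n)) :=
      (IsLocalization.Away.algebraMap_isUnit F).pow _
    refine hFu.mul_left_cancel ?_
    simp only [pow_add] at h7 ⊢
    linear_combination v * h7 + (algebraMap (RelRing M.g) (Localization.Away F) F ^ t *
      algebraMap (RelRing M.g) (Localization.Away F) F ^ n *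
      algebraMap (RelRing M.g) (Localization.Away F) (Ideal.Quotient.mk _ B')) * huv

lemma isChartFamily : IsChartFamily (gradedPiece M.g M.w) (fun i => monomialClass M.g (M.e i))
    (fun i => Finsupp.weight M.w (M.e i)) where
  homogeneous i := ⟨_, MvPolynomial.isWeightedHomogeneous_monomial _ _ _ rfl, rfl⟩
  exists_unit i j := by
    obtain ⟨n, hn, u, hu⟩ := M.exists_unit i j
    have hv := M.inv_mem_awayPart i rfl u.mul_inv hu
    rcases lt_or_gt_of_ne hn with h | h
    · obtain ⟨l, rfl⟩ := Int.exists_eq_neg_ofNat h.le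
      rw [neg_smul, natCast_zsmul] at hu hv
      rw [neg_neg] at hv
      exact ⟨l, by omega, _, hv, _, hu, u.inv_mul⟩
    · obtain ⟨l, rfl⟩ := Int.eq_ofNat_of_zero_le h.le
      rw [natCast_zsmul] at hu hv
      exact ⟨l, by omega, _, hu, _, hv, u.mul_inv⟩

/-- The complement in `Spec R`, `R = A[η₁, …, η_N] / (g₁, …, g_s)`, of the closed subset defined by
`f₁, …, f_m`. -/
def Y : Scheme.{u} := (complementOpens fun i => monomialClass M.g (M.e i)).toScheme

/-- The `A`-model of the variety `M.V`: the scheme glued from the spectra of the degree-`0` parts of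
the rings `R[f_i⁻¹]`. -/
def X : Scheme.{u} := M.isChartFamily.glued

/-- The structure morphism of `M.X`. -/
def toSpec : M.X ⟶ Spec (CommRingCat.of A) := M.isChartFamily.gluedToSpec

/-- The morphism induced by the inclusions of the degree-`0` parts into the rings `R[f_i⁻¹]`. -/
def π : M.Y ⟶ M.X := M.isChartFamily.proj

/-- The points of `M.Y` with values in an `A`-algebra `L` that is a field, given by their
coordinates `η₁, …, η_N`. -/
def points (L : Type u) [Field L] [Algebra A L] : Set (Fin N → L) :=
  {a | (∀ i, MvPolynomial.aeval a (M.g i) = 0) ∧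
    ∃ i, MvPolynomial.aeval a (MvPolynomial.monomial (M.e i) (1 : A)) ≠ 0}

/-- The Jacobian matrix of `g₁, …, g_s` at `a`. -/
def jacobian {L : Type u} [Field L] [Algebra A L] (a : Fin N → L) : Matrix (Fin s) (Fin N) L :=
  Matrix.of fun i j => MvPolynomial.aeval a (MvPolynomial.pderiv j (M.g i))

end TorsorModel

end Model

end

end CoxModel

/-! The scheme $X$ is covered by the spectra of the degree-0 rings `chartRing S`, so it suffices
that each of these is smooth over $A$. Smoothness is first proved upstairs, for $B_S =
R[(\prod_{i\in S} f_i)^{-1}]$, and then descended to $(B_S)_0$ (`smooth_chartRing`).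

Upstairs, the input is a Jacobian criterion in which transcendence degree over $A$ plays the role of
dimension. Since $I\cap A[\eta]=(g)$, the ring $R$ embeds in the Laurent polynomial ring over the
function field of $\overline X$, hence is a domain containing $A$. Its transcendence degree is at
least $\dim\overline X+r$ (`natCast_add_le_trdeg`): the $D_i$ generate the Picard group, so every
Laurent monomial $aT^n$ is a quotient of two sections, the Laurent ring is algebraic over the Cox
ring, and the function field has transcendence degree at least $\dim\overline X$. Now let $P$ be the
local ring of $A[\eta]$ at the image of a geometric point of $Y$; it is regular because $A$ is
Dedekind. The rank condition yields $c=N-\dim\overline X-r$ relations with independent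
differentials. They are part of a regular system of parameters, so they cut out a regular domain of
transcendence degree at most $N-c$. This domain surjects onto the local ring of $R$, a domain of
transcendence degree at least $N-c$. A noninjective surjection between such domains lowers the
transcendence degree, so the $c$ relations generate all relations locally, and smoothness follows
(`Algebra.isSmoothAt_of_linearIndependent`). Geometric points suffice because the smooth locus is
open (`Algebra.smooth_away_of_forall_geometricPoint`).

For the descent, $B_S$ is flat over $(B_S)_0$ because $\pi$ is flat, and faithfully so because
taking degree-0 components is $(B_S)_0$-linear (`faithfullyFlat_of_flat`). The ring $(B_S)_0$ is
finitely generated and torsion-free, hence flat, over $A$, so its smoothness can be tested on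
geometric fibres. There it means regularity of the local rings at closed points, and regularity
descends along flat local homomorphisms by Serre's homological characterization
(`IsRegularLocalRing.of_flat`, `Algebra.Smooth.of_faithfullyFlat`). -/

/-! ### Regular local rings: quotients by parameters, and integrality -/

namespace IsLocalRing

open Ideal

variable {R : Type*} [CommRing R] [IsLocalRing R] [IsNoetherianRing R]

/-- Elements of the maximal ideal that are linearly independent modulo its square are part of a
generating family with `dim 𝔪 / 𝔪²` elements. -/
lemma exists_span_eq_maximalIdeal_of_linearIndependent {c : ℕ} {g : Fin c → maximalIdeal R}
    (hg : LinearIndependent (ResidueField R) fun i => (maximalIdeal R).toCotangent (g i)) :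
    ∃ s : Set (maximalIdeal R), s.Finite ∧
      s.ncard + c = Module.finrank (ResidueField R) (CotangentSpace R) ∧
      maximalIdeal R = span (Set.range fun i => (g i : R)) ⊔ span ((↑) '' s) := by
  let b := Module.Basis.sumExtend hg
  let := FiniteDimensional.fintypeBasisIndex b
  have : Finite (Module.Basis.sumExtendIndex hg) :=
    Finite.of_injective (β := Fin c ⊕ Module.Basis.sumExtendIndex hg) _ Sum.inr_injective
  let := Fintype.ofFinite (Module.Basis.sumExtendIndex hg)
  choose h hh using fun j => (maximalIdeal R).toCotangent_surjective (b (Sum.inr j))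
  have hinj : Function.Injective h := fun i j hij => by
    have : b (Sum.inr i) = b (Sum.inr j) := by rw [← hh, ← hh, hij]
    simpa using b.injective this
  refine ⟨Set.range h, Set.finite_range h, ?_, ?_⟩
  · rw [Module.finrank_eq_card_basis b, ← Nat.card_eq_fintype_card, Nat.card_sum, Nat.card_fin,
      add_comm, Set.ncard_range_of_injective hinj]
  -- Nakayama: lifts of a basis of 𝔪/𝔪² generate 𝔪.
  · have hspan : Submodule.span R (Set.range g ∪ Set.range h) = ⊤ := by
      rw [← CotangentSpace.span_image_eq_top_iff, eq_top_iff, ← b.span_eq]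
      refine Submodule.span_mono ?_
      rintro _ ⟨i | j, rfl⟩
      · exact ⟨g i, Or.inl ⟨i, rfl⟩, by
          simp only [b, Module.Basis.sumExtend, Module.Basis.reindex_apply, Module.Basis.extend_apply_self]
          rfl⟩
      · exact ⟨h j, Or.inr ⟨j, rfl⟩, hh j⟩
    have := congr(Submodule.map (maximalIdeal R).subtype $hspan)
    rw [Submodule.map_span, Submodule.map_top, Submodule.range_subtype, Set.image_union] at this
    refine this.symm.trans ?_
    rw [Submodule.span_union, ← Set.range_comp]
    rfl

end IsLocalRing

namespace IsRegularLocalRing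

open IsLocalRing Ideal

variable {R : Type*} [CommRing R]

lemma finrank_cotangentSpace_eq [IsRegularLocalRing R] :
    Module.finrank (ResidueField R) (CotangentSpace R) = ringKrullDim R :=
  (iff_finrank_cotangentSpace R).1 inferInstance

/-- The quotient of a regular local ring by elements of the maximal ideal that are linearly
independent modulo its square is regular. -/
theorem quotient_span [IsRegularLocalRing R] {c : ℕ} {g : Fin c → maximalIdeal R}
    (hg : LinearIndependent (ResidueField R) fun i => (maximalIdeal R).toCotangent (g i)) :
    IsRegularLocalRing (R ⧸ span (Set.range fun i => (g i : R))) ∧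
      ringKrullDim (R ⧸ span (Set.range fun i => (g i : R))) + c = ringKrullDim R := by
  set I := span (Set.range fun i => (g i : R))
  have hI : I ≤ maximalIdeal R := span_le.2 (Set.range_subset_iff.2 fun i => (g i).2)
  have hItop : I ≠ ⊤ := fun h => (maximalIdeal.isMaximal R).ne_top (top_le_iff.1 (h ▸ hI))
  have : Nontrivial (R ⧸ I) := Ideal.Quotient.nontrivial_iff.2 hItop
  have : IsLocalRing (R ⧸ I) := .of_surjective' _ Ideal.Quotient.mk_surjective
  obtain ⟨s, hsf, hs, hm⟩ := exists_span_eq_maximalIdeal_of_linearIndependent hg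
  have hm' : maximalIdeal (R ⧸ I) = span ((Ideal.Quotient.mk I) '' ((↑) '' s)) := by
    have h1 : maximalIdeal (R ⧸ I) = (maximalIdeal R).map (Ideal.Quotient.mk I) := by
      refine (IsLocalRing.eq_maximalIdeal (Ideal.map_eq_top_or_isMaximal_of_surjective _
        Ideal.Quotient.mk_surjective (maximalIdeal.isMaximal R) |>.resolve_left fun h => ?_)).symm
      have := congr(comap (Ideal.Quotient.mk I) $h)
      rw [comap_map_of_surjective _ Ideal.Quotient.mk_surjective, ← RingHom.ker_eq_comap_bot,
        mk_ker, sup_eq_left.2 hI, comap_top] at this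
      exact (maximalIdeal.isMaximal R).ne_top this
    rw [h1]
    refine congr(Ideal.map (Ideal.Quotient.mk I) $hm).trans ?_
    rw [Ideal.map_sup, map_quotient_self, bot_sup_eq, map_span]
  -- Two opposite bounds fix the dimension of the quotient: the complementary parameters bound its
  -- embedding dimension by `s.ncard`, while killing `c` elements lowers the dimension by at most
  -- `c`, and `s.ncard + c` is the dimension of `R`.
  have hgen : (maximalIdeal (R ⧸ I)).spanFinrank ≤ s.ncard := by
    rw [hm']
    refine (Submodule.spanFinrank_span_le_ncard_of_finite ((hsf.image _).image _)).trans ?_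
    exact (Set.ncard_image_le (hsf.image _)).trans (Set.ncard_image_le hsf)
  have hdim : ringKrullDim R ≤ ringKrullDim (R ⧸ I) + c := by
    refine (ringKrullDim_le_ringKrullDim_quotient_add_spanFinrank I ?_).trans ?_
    · rwa [IsLocalRing.ringJacobson_eq_maximalIdeal]
    · gcongr
      refine (Submodule.spanFinrank_span_le_ncard_of_finite (Set.finite_range _)).trans ?_
      rw [← Set.image_univ]
      exact (Set.ncard_image_le Set.finite_univ).trans (by simp [Set.ncard_univ])
  have hd := finrank_cotangentSpace_eq (R := R)
  obtain ⟨d, hd'⟩ : ∃ d : ℕ, ringKrullDim (R ⧸ I) = d := by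
    have h1 := ringKrullDim_ne_top (R := R ⧸ I)
    have h2 := ringKrullDim_ne_bot (R := R ⧸ I)
    generalize ringKrullDim (R ⧸ I) = x at h1 h2
    induction x with
    | bot => exact absurd rfl h2
    | coe x => induction x with
      | top => exact absurd rfl h1
      | coe x => exact ⟨x, rfl⟩
  have hle := (ringKrullDim_le_spanFinrank_maximalIdeal (R ⧸ I))
  rw [hd'] at hle
  rw [hd', ← hd, ← hs] at hdim
  norm_cast at hdim hle
  have hsd : s.ncard = d := by omega
  refine ⟨of_spanFinrank_maximalIdeal_le _ (by rw [hd']; exact_mod_cast hgen.trans hsd.le), ?_⟩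
  rw [hd', ← hd, ← hs, hsd]
  norm_cast

/-- An element outside the square of the maximal ideal and outside finitely many primes different
from the maximal ideal. -/
lemma _root_.IsLocalRing.exists_mem_maximalIdeal_notMem_sq [IsLocalRing R] [IsNoetherianRing R]
    (hm : maximalIdeal R ≠ ⊥) {s : Set (Ideal R)} (hs : s.Finite)
    (hp : ∀ P ∈ s, P.IsPrime ∧ P ≠ maximalIdeal R) :
    ∃ x ∈ maximalIdeal R, x ∉ maximalIdeal R ^ 2 ∧ ∀ P ∈ s, x ∉ P := by
  by_contra! h
  have hsub : (maximalIdeal R : Set R) ⊆ ⋃ P ∈ insert (maximalIdeal R ^ 2) s, (P : Set R) := by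
    intro x hx
    by_cases hx2 : x ∈ maximalIdeal R ^ 2
    · exact Set.mem_biUnion (Set.mem_insert _ _) hx2
    · obtain ⟨P, hP, hxP⟩ := h x hx hx2
      exact Set.mem_biUnion (Set.mem_insert_of_mem _ hP) hxP
  -- Prime avoidance exempts two of the ideals from being prime; 𝔪² fills both slots. That 𝔪 is not
  -- contained in 𝔪² is Nakayama.
  obtain ⟨P, hP, hle⟩ := ((maximalIdeal R).subset_union_prime_finite (hs.insert _) (f := id)
    (maximalIdeal R ^ 2) (maximalIdeal R ^ 2) (by
      rintro P hP h1 -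
      exact (hp P (hP.resolve_left h1)).1)).1 hsub
  rcases hP with rfl | hP
  · refine hm (Submodule.eq_bot_of_le_smul_of_le_jacobson_bot (maximalIdeal R) _
      (IsNoetherian.noetherian _) ?_ (maximalIdeal_le_jacobson _))
    simpa [pow_two] using hle
  · have := (hp P hP).1
    exact (hp P hP).2 (((maximalIdeal.isMaximal R).eq_of_le this.ne_top hle).symm)

lemma quotient_span_singleton [IsRegularLocalRing R] {x : R} (hx : x ∈ maximalIdeal R)
    (hx2 : x ∉ maximalIdeal R ^ 2) :
    IsRegularLocalRing (R ⧸ span {x}) ∧ ringKrullDim (R ⧸ span {x}) + 1 = ringKrullDim R := by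
  have h := quotient_span (g := fun _ : Fin 1 => (⟨x, hx⟩ : maximalIdeal R)) (by
    rw [linearIndependent_unique_iff]
    rwa [ne_eq, toCotangent_eq_zero])
  rw [show span {x} = span (Set.range fun _ : Fin 1 => x) by rw [Set.range_const]]
  exact ⟨h.1, by simpa using h.2⟩

lemma maximalIdeal_eq_bot_of_ringKrullDim [IsRegularLocalRing R] (h : ringKrullDim R = 0) :
    maximalIdeal R = ⊥ := by
  rw [← (isRegularLocalRing_iff R).1 inferInstance] at h
  exact (Submodule.spanFinrank_eq_zero_iff_eq_bot (IsNoetherian.noetherian _)).1 (by exact_mod_cast h)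

lemma exists_natCast_eq_ringKrullDim (R : Type*) [CommRing R] [IsRegularLocalRing R] :
    ∃ n : ℕ, ringKrullDim R = n := ⟨_, finrank_cotangentSpace_eq.symm⟩

/-- Choose `x` in 𝔪, outside 𝔪² and all minimal primes. By induction `R ⧸ (x)` is a domain, so `(x)`
is prime and contains a minimal prime `P`. An element of `P` is a multiple `z x`, and `x ∉ P` forces
`z ∈ P`; thus `P = x P`, and Nakayama gives `P = 0`. -/
theorem isDomain_of_ringKrullDim_eq (n : ℕ) : ∀ (R : Type*) [CommRing R] [IsRegularLocalRing R],
    ringKrullDim R = n → IsDomain R := by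
  induction n with
  | zero =>
    intro R _ _ h
    have := isField_iff_maximalIdeal_eq.2 (maximalIdeal_eq_bot_of_ringKrullDim h)
    exact this.isDomain
  | succ n ih =>
    intro R _ _ h
    have hmin : ∀ P ∈ minimalPrimes R, P.IsPrime ∧ P ≠ maximalIdeal R := by
      refine fun P hP => ⟨hP.1.1, ?_⟩
      rintro rfl
      have h1 : (maximalIdeal R).height = 0 := by
        exact Ideal.height_eq_zero_iff.2 hP
      have h2 := maximalIdeal_height_eq_ringKrullDim (R := R)
      rw [h1, h] at h2
      exact absurd h2 (by norm_cast)
    have hm : maximalIdeal R ≠ ⊥ := by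
      intro h1
      have h2 := (isRegularLocalRing_iff R).1 inferInstance
      rw [h1, Submodule.spanFinrank_bot, h] at h2
      exact absurd h2 (by norm_cast)
    obtain ⟨x, hx, hx2, hxP⟩ := exists_mem_maximalIdeal_notMem_sq hm
      (minimalPrimes.finite_of_isNoetherianRing R) hmin
    obtain ⟨hreg, hdim⟩ := quotient_span_singleton hx hx2
    rw [h] at hdim
    have := ih (R ⧸ span {x}) (by
      obtain ⟨k, hk⟩ := exists_natCast_eq_ringKrullDim (R ⧸ span {x})
      rw [hk] at hdim ⊢
      norm_cast at hdim ⊢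
      omega)
    have hprime : (span {x}).IsPrime := (Ideal.Quotient.isDomain_iff_prime _).1 this
    obtain ⟨P, hP, hle⟩ := Ideal.exists_minimalPrimes_le (bot_le (a := span {x}))
    have := hP.1.1
    have hbot : P = ⊥ := by
      refine Submodule.eq_bot_of_le_smul_of_le_jacobson_bot (span {x}) _
        (IsNoetherian.noetherian _) (fun y hy => ?_)
        ((span_singleton_le_iff_mem _).2 (maximalIdeal_le_jacobson _ hx))
      obtain ⟨z, rfl⟩ := mem_span_singleton'.1 (hle hy)
      rw [mul_comm]
      exact Submodule.smul_mem_smul (mem_span_singleton_self x)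
        ((this.mem_or_mem hy).resolve_right (hxP P hP))
    subst hbot
    have : NoZeroDivisors R := ⟨fun {a b} h => by
      simpa using this.mem_or_mem (show a * b ∈ (⊥ : Ideal R) by simpa using h)⟩
    exact NoZeroDivisors.to_isDomain R

instance (priority := 100) isDomain [IsRegularLocalRing R] : IsDomain R :=
  have ⟨n, hn⟩ := exists_natCast_eq_ringKrullDim R
  isDomain_of_ringKrullDim_eq n R hn

end IsRegularLocalRing

/-! ### Projective dimension and Serre's characterization of regularity -/

section ProjectiveDimension

open IsLocalRing Ideal

variable {R : Type u} [CommRing R] {M N F : Type u} [AddCommGroup M] [Module R M]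
  [AddCommGroup N] [Module R N] [AddCommGroup F] [Module R F]

lemma Module.free_iff_projective_of_isLocalRing [IsLocalRing R] [Module.Finite R M] :
    Module.Free R M ↔ Module.Projective R M :=
  ⟨fun _ => inferInstance, fun _ => Module.free_of_flat_of_isLocalRing⟩

variable (R M) in
/-- The projective dimension of the module `M` is at most `n`. -/
abbrev Module.ProjDimLE (n : ℕ) : Prop := HasProjectiveDimensionLE (ModuleCat.of R M) n

namespace Module.ProjDimLE

lemma zero_iff : ProjDimLE R M 0 ↔ Module.Projective R M := by
  rw [IsProjective.iff_projective, projective_iff_hasProjectiveDimensionLE_zero]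

lemma of_equiv (e : M ≃ₗ[R] N) {n : ℕ} (h : ProjDimLE R M n) : ProjDimLE R N n :=
  hasProjectiveDimensionLT_of_iso e.toModuleIso _

lemma congr (e : M ≃ₗ[R] N) {n : ℕ} : ProjDimLE R M n ↔ ProjDimLE R N n :=
  ⟨of_equiv e, of_equiv e.symm⟩

lemma succ_iff [Module.Projective R F] {f : F →ₗ[R] M} (hf : Function.Surjective f) {n : ℕ} :
    ProjDimLE R M (n + 1) ↔ ProjDimLE R (LinearMap.ker f) n :=
  (LinearMap.shortExact_shortComplexKer hf).hasProjectiveDimensionLT_X₃_iff n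
    ((IsProjective.iff_projective (P := F)).1 inferInstance)

lemma mono {n k : ℕ} (h : ProjDimLE R M n) (hnk : n ≤ k) : ProjDimLE R M k :=
  hasProjectiveDimensionLT_of_ge _ (n + 1) (k + 1) (by omega)

lemma of_retract (i : M →ₗ[R] N) (p : N →ₗ[R] M) (h : ∀ x, p (i x) = x) {n : ℕ}
    (hN : ProjDimLE R N n) : ProjDimLE R M n := by
  have : HasProjectiveDimensionLT (ModuleCat.of R N) (n + 1) := hN
  refine Retract.hasProjectiveDimensionLT (Y := ModuleCat.of R N)
    ⟨ModuleCat.ofHom i, ModuleCat.ofHom p, ?_⟩ (n + 1)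
  ext x
  exact h x

/-- Reduction modulo an element that is regular on the ring and on the module preserves the
projective dimension. -/
lemma quotSMulTop_iff [IsLocalRing R] [IsNoetherianRing R] {x : R} (hx : x ∈ maximalIdeal R)
    (hxR : IsSMulRegular R x) (n : ℕ) : ∀ (M : Type u) [AddCommGroup M] [Module R M]
    [Module.Finite R M] (_ : IsSMulRegular M x),
    ProjDimLE (R ⧸ span {x}) (QuotSMulTop x M) n ↔ ProjDimLE R M n := by
  have hjac : x ∈ (⊥ : Ideal R).jacobson := maximalIdeal_le_jacobson _ hx
  have : Nontrivial (R ⧸ span {x}) := Ideal.Quotient.nontrivial_iff.2 fun h =>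
    (maximalIdeal.isMaximal R).ne_top (top_le_iff.1 (h ▸ (span_singleton_le_iff_mem _).2 hx))
  have : IsLocalRing (R ⧸ span {x}) := .of_surjective' _ Ideal.Quotient.mk_surjective
  have hsurj : Function.Surjective (algebraMap R (R ⧸ span {x})) := Ideal.Quotient.mk_surjective
  induction n with
  | zero =>
    intro M _ _ _ hM
    have := Module.finitePresentation_of_finite R M
    have := Module.Finite.of_restrictScalars_finite R (R ⧸ span {x}) (QuotSMulTop x M)
    have := Module.finitePresentation_of_finite (R ⧸ span {x}) (QuotSMulTop x M)
    rw [zero_iff, zero_iff, ← Module.free_iff_projective_of_isLocalRing, ← Module.free_iff_projective_of_isLocalRing]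
    exact Module.free_quotSMulTop_iff_free R M hjac hM
  | succ n ih =>
    intro M _ _ _ hM
    obtain ⟨k, f, hf⟩ := Module.Finite.exists_fin' R M
    have hF : IsSMulRegular (Fin k → R) x := fun a b hab =>
      funext fun i => hxR (congr_fun hab i)
    have hK : IsSMulRegular (LinearMap.ker f) x := fun a b hab =>
      Subtype.ext (hF congr(($hab : Fin k → R)))
    let f' := (QuotSMulTop.map x f).extendScalarsOfSurjective hsurj
    let i := (QuotSMulTop.map x (LinearMap.ker f).subtype).extendScalarsOfSurjective hsurj
    have hf' : Function.Surjective f' := QuotSMulTop.map_surjective x hf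
    -- Reduction modulo `x` keeps the syzygy sequence exact on the left: if `x z` lies in the kernel
    -- of `f`, then `x • f z = 0`, and regularity of `x` on `M` puts `z` in the kernel. So the
    -- syzygy of `M / xM` is the reduction of the syzygy of `M`.
    have hi : Function.Injective i := by
      rw [injective_iff_map_eq_zero]
      intro y hy
      obtain ⟨⟨y, hyK⟩, rfl⟩ := Submodule.Quotient.mk_surjective _ y
      have hy : (Submodule.Quotient.mk y : QuotSMulTop x (Fin k → R)) = 0 := hy
      rw [Submodule.Quotient.mk_eq_zero] at hy ⊢
      obtain ⟨z, -, rfl⟩ := (Submodule.mem_smul_pointwise_iff_exists _ _ _).1 hy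
      have hz : z ∈ LinearMap.ker f := by
        rw [LinearMap.mem_ker] at hyK ⊢
        refine hM ?_
        simpa using hyK
      exact (Submodule.mem_smul_pointwise_iff_exists _ _ _).2 ⟨⟨z, hz⟩, trivial, rfl⟩
    have hex : LinearMap.range i = LinearMap.ker f' := by
      have h1 := QuotSMulTop.map_exact x (f := (LinearMap.ker f).subtype) (g := f)
        (LinearMap.exact_subtype_ker_map f) hf
      ext y
      exact (h1 y).symm
    rw [succ_iff hf', succ_iff hf, ← ih (LinearMap.ker f) hK]
    exact (congr ((LinearEquiv.ofInjective i hi).trans (LinearEquiv.ofEq _ _ hex))).symm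

end Module.ProjDimLE

open Module

namespace IsRegularLocalRing

/-- Finitely generated modules over a regular local ring have finite projective dimension. -/
theorem exists_projDimLE_of_ringKrullDim_eq (n : ℕ) : ∀ (R : Type u) [CommRing R]
    [IsRegularLocalRing R] (_ : ringKrullDim R = n) (M : Type u) [AddCommGroup M] [Module R M]
    [Module.Finite R M], ∃ k, ProjDimLE R M k := by
  induction n with
  | zero =>
    intro R _ _ h M _ _ _
    let := (isField_iff_maximalIdeal_eq.2 (maximalIdeal_eq_bot_of_ringKrullDim h)).toField
    refine ⟨0, ProjDimLE.zero_iff.2 ?_⟩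
    have : Module.Free R M := Module.Free.of_divisionRing R M
    infer_instance
  | succ n ih =>
    intro R _ _ h M _ _ _
    have hm : maximalIdeal R ≠ ⊥ := by
      intro h1
      have h2 := (isRegularLocalRing_iff R).1 inferInstance
      rw [h1, Submodule.spanFinrank_bot, h] at h2
      exact absurd h2 (by norm_cast)
    obtain ⟨x, hx, hx2, -⟩ := exists_mem_maximalIdeal_notMem_sq hm Set.finite_empty (by simp)
    have hx0 : x ≠ 0 := by rintro rfl; exact hx2 (zero_mem _)
    have hxR : IsSMulRegular R x := fun a b hab => mul_left_cancel₀ hx0 hab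
    obtain ⟨hreg, hdim⟩ := quotient_span_singleton hx hx2
    rw [h] at hdim
    have hdim' : ringKrullDim (R ⧸ span {x}) = n := by
      obtain ⟨k, hk⟩ := exists_natCast_eq_ringKrullDim (R ⧸ span {x})
      rw [hk] at hdim ⊢
      norm_cast at hdim ⊢
      omega
    -- `M` itself may have `x`-torsion. Its first syzygy lies in a free module, so `x` is regular on
    -- it and reduction modulo `x` applies.
    obtain ⟨l, f, hf⟩ := Module.Finite.exists_fin' R M
    have hK : IsSMulRegular (LinearMap.ker f) x := fun a b hab =>
      Subtype.ext (funext fun i => hxR (congr_fun congr(($hab : Fin l → R)) i))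
    have := Module.Finite.of_restrictScalars_finite R (R ⧸ span {x})
      (QuotSMulTop x (LinearMap.ker f))
    obtain ⟨k, hk⟩ := ih (R ⧸ span {x}) hdim' (QuotSMulTop x (LinearMap.ker f))
    exact ⟨k + 1, (ProjDimLE.succ_iff hf).2
      ((ProjDimLE.quotSMulTop_iff hx hxR k _ hK).1 hk)⟩

theorem exists_projDimLE (R : Type u) [CommRing R] [IsRegularLocalRing R] (M : Type u)
    [AddCommGroup M] [Module R M] [Module.Finite R M] : ∃ k, ProjDimLE R M k :=
  have ⟨n, hn⟩ := exists_natCast_eq_ringKrullDim R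
  exists_projDimLE_of_ringKrullDim_eq n R hn M

end IsRegularLocalRing

/-- Over a local ring whose maximal ideal is killed by a nonzero element, finitely generated modules
of finite projective dimension are free. -/
lemma Module.ProjDimLE.free_of_mul_eq_zero [IsLocalRing R] [IsNoetherianRing R] {s : R}
    (hs : s ≠ 0) (hsm : ∀ y ∈ maximalIdeal R, s * y = 0) (n : ℕ) : ∀ (M : Type u)
    [AddCommGroup M] [Module R M] [Module.Finite R M] (_ : ProjDimLE R M n), Module.Free R M := by
  induction n with
  | zero =>
    intro M _ _ _ h
    have := Module.finitePresentation_of_finite R M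
    rw [zero_iff, ← Module.free_iff_projective_of_isLocalRing] at h
    exact h
  | succ n ih =>
    intro M _ _ _ h
    obtain ⟨t, ht, hspan⟩ := (Module.Finite.fg_top (R := R) (M := M)).exists_span_finset_card_eq_spanFinrank
    let f : (t → R) →ₗ[R] M := Fintype.linearCombination R (fun i : t => (i : M))
    have hf : Function.Surjective f := by
      rw [← LinearMap.range_eq_top, Fintype.range_linearCombination]
      simpa using hspan
    -- The generating set has minimal size: a relation with a unit coefficient would make one
    -- generator redundant.
    have hker : ∀ z ∈ LinearMap.ker f, ∀ i, z i ∈ maximalIdeal R := by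
      intro z hz i
      by_contra hi
      classical
      rw [mem_maximalIdeal, mem_nonunits_iff, not_not] at hi
      obtain ⟨u, hu⟩ := hi
      have hmem : (i : M) ∈ Submodule.span R ((t.erase i : Finset M) : Set M) := by
        have h1 : ∑ j : t, z j • (j : M) = 0 := by
          simpa [f, Fintype.linearCombination_apply] using hz
        rw [← Finset.add_sum_erase _ _ (Finset.mem_univ i)] at h1
        have h2 : (i : M) = -(((u⁻¹ : Rˣ) : R) • ∑ j ∈ Finset.univ.erase i, z j • (j : M)) := by
          rw [eq_neg_iff_add_eq_zero, ← smul_zero ((u⁻¹ : Rˣ) : R), ← h1, smul_add, ← hu, smul_smul,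
            Units.inv_mul, one_smul]
        refine (congrArg (· ∈ Submodule.span R ((t.erase (i : M) : Finset M) : Set M)) h2).mpr
          ?_
        refine neg_mem (Submodule.smul_mem _ _ (Submodule.sum_mem _ fun j hj =>
          Submodule.smul_mem _ _ (Submodule.subset_span ?_)))
        have := Finset.ne_of_mem_erase hj
        exact Finset.mem_coe.2 (Finset.mem_erase.2 ⟨fun h => this (Subtype.ext h), j.2⟩)
      have hspan' : Submodule.span R ((t.erase i : Finset M) : Set M) = ⊤ := by
        rw [eq_top_iff, ← hspan, Submodule.span_le]
        intro y hy
        by_cases hyi : y = i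
        · rw [hyi]; exact hmem
        · exact Submodule.subset_span (by simpa [hyi] using hy)
      have h3 := Submodule.spanFinrank_span_le_ncard_of_finite (R := R)
        (t.erase (i : M)).finite_toSet
      rw [hspan', ← ht, Set.ncard_coe_finset, Finset.card_erase_of_mem i.2] at h3
      have := Finset.card_pos.2 ⟨_, i.2⟩
      omega
    have hfree := ih _ ((succ_iff hf).1 h)
    have hzero : ∀ z ∈ LinearMap.ker f, s • z = 0 := fun z hz => funext fun i =>
      hsm _ (hker z hz i)
    -- The syzygy has all coordinates in 𝔪, so `s` kills it; being free and `s` nonzero, it has an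
    -- empty basis.
    have : IsEmpty (Module.Free.ChooseBasisIndex R (LinearMap.ker f)) := by
      refine ⟨fun i => hs ?_⟩
      have h1 : s • Module.Free.chooseBasis R (LinearMap.ker f) i = 0 :=
        Subtype.ext (hzero _ (Subtype.prop _))
      have h2 := congr((Module.Free.chooseBasis R (LinearMap.ker f)).repr $h1 i)
      simpa using h2
    have : Subsingleton (LinearMap.ker f) :=
      (Module.Free.chooseBasis R (LinearMap.ker f)).repr.toEquiv.subsingleton
    exact Module.Free.of_equiv (LinearEquiv.ofBijective f
      ⟨LinearMap.ker_eq_bot.1 ((Submodule.subsingleton_iff_eq_bot).1 this), hf⟩)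

namespace IsRegularLocalRing

/-- A Noetherian local ring whose residue field has finite projective dimension is regular. -/
theorem of_projDimLE_of_ringKrullDim_eq (n : ℕ) : ∀ (R : Type u) [CommRing R] [IsLocalRing R]
    [IsNoetherianRing R] (_ : ringKrullDim R = n) (k : ℕ)
    (_ : ProjDimLE R (R ⧸ maximalIdeal R) k), IsRegularLocalRing R := by
  induction n using Nat.strong_induction_on with
  | _ n ih =>
  intro R _ _ _ hn k hk
  by_cases hm : maximalIdeal R = ⊥
  · refine of_spanFinrank_maximalIdeal_le _ ?_
    rw [hm, Submodule.spanFinrank_bot, hn]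
    exact_mod_cast n.zero_le
  -- If 𝔪 were the annihilator of some `s`, the residue field would be free by
  -- `free_of_mul_eq_zero`; but 𝔪 kills it, contradicting 𝔪 ≠ 0. Hence `x` below can be taken to be
  -- a nonzerodivisor outside 𝔪².
  have hass : maximalIdeal R ∉ associatedPrimes R R := by
    intro h
    rw [AssociatedPrimes.mem_iff, isAssociatedPrime_iff] at h
    obtain ⟨-, s, hs⟩ := h
    have hs0 : s ≠ 0 := by
      rintro rfl
      refine (maximalIdeal.isMaximal R).ne_top (top_le_iff.1 ?_)
      rw [hs]
      intro y _
      simp [Submodule.mem_colon_singleton]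
    have hsm : ∀ y ∈ maximalIdeal R, s * y = 0 := by
      intro y hy
      rw [hs, Submodule.mem_colon_singleton] at hy
      simpa [mul_comm] using hy
    have := hk.free_of_mul_eq_zero hs0 hsm
    refine hm ((Submodule.eq_bot_iff _).2 fun y hy => ?_)
    obtain ⟨b⟩ : Nonempty (Module.Free.ChooseBasisIndex R (R ⧸ maximalIdeal R)) := by
      have : Nontrivial (R ⧸ maximalIdeal R) := Ideal.Quotient.nontrivial_iff.2 Ideal.IsPrime.ne_top'
      exact (Module.Free.chooseBasis R (R ⧸ maximalIdeal R)).index_nonempty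
    have h1 : y • Module.Free.chooseBasis R (R ⧸ maximalIdeal R) b = 0 := by
      obtain ⟨z, hz⟩ := Ideal.Quotient.mk_surjective (Module.Free.chooseBasis R (R ⧸ maximalIdeal R) b)
      rw [← hz]
      exact Ideal.Quotient.eq_zero_iff_mem.2 (Ideal.mul_mem_right z _ hy)
    simpa using congr((Module.Free.chooseBasis R (R ⧸ maximalIdeal R)).repr $h1 b)
  obtain ⟨x, hx, hx2, hxP⟩ := exists_mem_maximalIdeal_notMem_sq hm (associatedPrimes.finite R R)
    fun P hP => ⟨hP.1, fun h => hass (h ▸ hP)⟩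
  have hxR : x ∈ nonZeroDivisors R := by
    by_contra h
    have h1 : x ∈ ((nonZeroDivisors R : Set R))ᶜ := h
    rw [← biUnion_associatedPrimes_eq_compl_nonZeroDivisors, Set.mem_iUnion₂] at h1
    obtain ⟨P, hP, h2⟩ := h1
    exact hxP P hP h2
  have hxR' : IsSMulRegular R x := Module.Flat.isSMulRegular_of_nonZeroDivisors hxR
  have hdim := ringKrullDim_quotient_span_singleton_succ_eq_ringKrullDim hxR' hx
  have hnt : Nontrivial (R ⧸ span {x}) := Ideal.Quotient.nontrivial_iff.2 fun h =>
    (maximalIdeal.isMaximal R).ne_top (top_le_iff.1 (h ▸ (span_singleton_le_iff_mem _).2 hx))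
  have : IsLocalRing (R ⧸ span {x}) := .of_surjective' _ Ideal.Quotient.mk_surjective
  have hsurj : Function.Surjective (algebraMap R (R ⧸ span {x})) := Ideal.Quotient.mk_surjective
  have hloc : IsLocalHom (Ideal.Quotient.mk (span {x})) :=
    .of_surjective _ Ideal.Quotient.mk_surjective
  have hcomap : (maximalIdeal (R ⧸ span {x})).comap (Ideal.Quotient.mk (span {x})) =
      maximalIdeal R := ((IsLocalRing.local_hom_TFAE _).out 0 4).1 hloc
  have hmreg : IsSMulRegular (maximalIdeal R) x := fun a b hab => Subtype.ext (hxR' congr(($hab : R)))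
  -- Weakening the bound to `k + 1` before passing to the syzygy 𝔪 avoids a case distinction at `k =
  -- 0`.
  have hkm : ProjDimLE R (maximalIdeal R) k :=
    ((ProjDimLE.succ_iff (Submodule.mkQ_surjective _)).1 (hk.mono k.le_succ)).of_equiv
      (LinearEquiv.ofEq _ _ (Submodule.ker_mkQ _))
  rw [← ProjDimLE.quotSMulTop_iff hx hxR' k _ hmreg] at hkm
  let L := (R ⧸ span {x}) ⧸ maximalIdeal (R ⧸ span {x})
  have hL : ∀ y ∈ maximalIdeal R, algebraMap R L y = 0 := fun y hy =>
    Ideal.Quotient.eq_zero_iff_mem.2 (hcomap.ge hy)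
  -- As `x ∉ 𝔪²`, some functional on 𝔪/𝔪² takes the value 1 at `x`. It splits the map from `L`, the
  -- residue field of `R ⧸ (x)`, to 𝔪/x𝔪 sending 1 to the class of `x`. As a direct summand, `L`
  -- inherits finite projective dimension over `R ⧸ (x)`, and the induction applies.
  obtain ⟨φ, hφ⟩ : ∃ φ : CotangentSpace R →ₗ[ResidueField R] ResidueField R,
      φ ((maximalIdeal R).toCotangent ⟨x, hx⟩) = 1 := by
    exact Module.Projective.exists_dual_eq_one (ResidueField R) fun h => hx2 ((Ideal.toCotangent_eq_zero _ _).1 h)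
  let q : ResidueField R →ₗ[R] L := Submodule.liftQ (maximalIdeal R) (Algebra.linearMap R L) hL
  let p₀ : maximalIdeal R →ₗ[R] L :=
    q ∘ₗ φ.restrictScalars R ∘ₗ (maximalIdeal R).toCotangent
  have hp₀ : p₀ ⟨x, hx⟩ = 1 := by
    change q (φ ((maximalIdeal R).toCotangent ⟨x, hx⟩)) = 1
    rw [hφ]
    exact map_one (algebraMap R L)
  let p : QuotSMulTop x (maximalIdeal R) →ₗ[R] L := Submodule.liftQ _ p₀ (by
    rintro _ ⟨y, -, rfl⟩
    change p₀ (x • y) = 0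
    rw [map_smul, Algebra.smul_def, hL x hx, zero_mul])
  let i : L →ₗ[R ⧸ span {x}] QuotSMulTop x (maximalIdeal R) :=
    Submodule.liftQ _ (LinearMap.toSpanSingleton (R ⧸ span {x}) _
      (Submodule.Quotient.mk ⟨x, hx⟩)) (by
        intro y hy
        obtain ⟨y, rfl⟩ := Ideal.Quotient.mk_surjective y
        have hy : y ∈ maximalIdeal R := hcomap.le hy
        refine (Submodule.Quotient.mk_eq_zero _).2
          ((Submodule.mem_smul_pointwise_iff_exists _ _ _).2 ⟨⟨y, hy⟩, trivial, ?_⟩)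
        exact Subtype.ext (mul_comm x y))
  have hkL : ProjDimLE (R ⧸ span {x}) L k := by
    refine hkm.of_retract i (p.extendScalarsOfSurjective hsurj) fun l => ?_
    obtain ⟨l, rfl⟩ := Ideal.Quotient.mk_surjective l
    obtain ⟨r, rfl⟩ := Ideal.Quotient.mk_surjective l
    change p₀ (r • ⟨x, hx⟩) = _
    rw [map_smul, hp₀, Algebra.smul_def, mul_one]
    rfl
  rw [hn] at hdim
  obtain ⟨d, hd⟩ : ∃ d : ℕ, ringKrullDim (R ⧸ span {x}) = d := by
    have h1 := ringKrullDim_ne_top (R := R ⧸ span {x})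
    have h2 := ringKrullDim_ne_bot (R := R ⧸ span {x})
    generalize ringKrullDim (R ⧸ span {x}) = x at h1 h2
    induction x with
    | bot => exact absurd rfl h2
    | coe x => induction x with
      | top => exact absurd rfl h1
      | coe x => exact ⟨x, rfl⟩
  have hdn : d + 1 = n := by rw [hd] at hdim; exact_mod_cast hdim
  have hreg := ih d (by omega) (R ⧸ span {x}) hd k hkL
  obtain ⟨t, ht, hspan⟩ := (IsNoetherian.noetherian
    (maximalIdeal (R ⧸ span {x}))).exists_span_finset_card_eq_spanFinrank
  have htd : t.card = d := by
    have h1 := (isRegularLocalRing_iff (R ⧸ span {x})).1 inferInstance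
    rw [hd, ← ht] at h1
    exact_mod_cast h1
  -- Regularity lifts back: `x` and lifts of `d` generators of the maximal ideal of `R ⧸ (x)`
  -- generate 𝔪, so `d + 1 = n` generators suffice.
  let σ := Function.surjInv (Ideal.Quotient.mk_surjective (I := span {x}))
  have hgen : maximalIdeal R = span (insert x (σ '' t)) := by
    have h1 : (span (σ '' t)).map (Ideal.Quotient.mk (span {x})) = maximalIdeal (R ⧸ span {x}) := by
      rw [map_span, Set.image_image]
      simpa [σ, Function.surjInv_eq] using hspan
    rw [← hcomap, ← h1, comap_map_of_surjective _ Ideal.Quotient.mk_surjective,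
      ← RingHom.ker_eq_comap_bot, mk_ker, ← span_union, Set.union_singleton]
  refine of_spanFinrank_maximalIdeal_le _ ?_
  rw [hn, hgen, ← hdn]
  have h1 := Submodule.spanFinrank_span_le_ncard_of_finite (R := R)
    ((t.finite_toSet.image σ).insert x)
  have h2 := Set.ncard_insert_le x (σ '' t)
  have h3 := Set.ncard_image_le (f := σ) t.finite_toSet
  rw [Set.ncard_coe_finset, htd] at h3
  exact_mod_cast h1.trans (h2.trans (by omega))

end IsRegularLocalRing

/-- Flat base change carries syzygies to syzygies, which reduces to dimension 0. There faithful
flatness descends flatness, and a finitely presented flat module is projective. -/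
lemma Module.ProjDimLE.of_baseChange (S : Type u) [CommRing S] [Algebra R S]
    [Module.FaithfullyFlat R S] [IsNoetherianRing R] (n : ℕ) : ∀ (M : Type u) [AddCommGroup M]
    [Module R M] [Module.Finite R M] (_ : ProjDimLE S (TensorProduct R S M) n),
    ProjDimLE R M n := by
  induction n with
  | zero =>
    intro M _ _ _ h
    rw [zero_iff] at h ⊢
    have := Module.Flat.of_flat_tensorProduct R M S
    have := Module.finitePresentation_of_finite R M
    exact Module.Flat.projective_of_finitePresentation
  | succ n ih =>
    intro M _ _ _ h
    obtain ⟨k, f, hf⟩ := Module.Finite.exists_fin' R M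
    have hf' : Function.Surjective (f.baseChange S) := LinearMap.lTensor_surjective S hf
    let i := (LinearMap.ker f).subtype.baseChange S
    have hi : Function.Injective i :=
      Module.Flat.lTensor_preserves_injective_linearMap _ (LinearMap.ker f).injective_subtype
    have hex : LinearMap.range i = LinearMap.ker (f.baseChange S) := by
      have h1 := lTensor_exact S (LinearMap.exact_subtype_ker_map f) hf
      ext y
      exact (h1 y).symm
    rw [succ_iff hf'] at h
    rw [succ_iff hf]
    exact ih _ (h.of_equiv ((LinearEquiv.ofInjective i hi).trans (LinearEquiv.ofEq _ _ hex)).symm)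

/-- Regularity descends along flat local homomorphisms. -/
theorem IsRegularLocalRing.of_flat (R S : Type u) [CommRing R] [CommRing S] [IsLocalRing R]
    [IsNoetherianRing R] [IsRegularLocalRing S] [Algebra R S] [Module.Flat R S]
    [IsLocalHom (algebraMap R S)] : IsRegularLocalRing R := by
  have : Module.FaithfullyFlat R S := Module.FaithfullyFlat.of_flat_of_isLocalHom
  -- Both directions of Serre's theorem meet here: over the regular ring `S`, the base change of the
  -- residue field of `R` has finite projective dimension; this descends to `R` and forces `R` to be
  -- regular.
  obtain ⟨k, hk⟩ := exists_projDimLE S (TensorProduct R S (R ⧸ maximalIdeal R))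
  have h1 := ringKrullDim_ne_top (R := R)
  have h2 := ringKrullDim_ne_bot (R := R)
  generalize h : ringKrullDim R = x at h1 h2
  induction x with
  | bot => exact absurd rfl h2
  | coe x => induction x with
    | top => exact absurd rfl h1
    | coe x => exact of_projDimLE_of_ringKrullDim_eq x R h k (ProjDimLE.of_baseChange S k _ hk)

end ProjectiveDimension

/-! ### The Jacobian criterion at a local ring; smooth versus regular -/

section JacobianLocal

open IsLocalRing TensorProduct KaehlerDifferential

/-- The elements `1 ⊗ x` of `κ ⊗ I` that vanish, for an ideal `I` of a local ring with residue
field `κ`. -/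
lemma IsLocalRing.one_tmul_eq_zero_iff {P : Type*} [CommRing P] [IsLocalRing P] {I : Ideal P}
    (x : I) : (1 ⊗ₜ x : ResidueField P ⊗[P] I) = 0 ↔ (x : P) ∈ maximalIdeal P * I := by
  have h := LinearMap.ker_tensorProductMk (Q := I) (I := maximalIdeal P)
  have h' : (1 ⊗ₜ x : ResidueField P ⊗[P] I) = 0 ↔ x ∈ maximalIdeal P • (⊤ : Submodule P I) := by
    rw [← h]
    exact Iff.rfl
  rw [h', ← smul_eq_mul]
  rw [show maximalIdeal P • I = (maximalIdeal P • (⊤ : Submodule P I)).map I.subtype by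
    rw [Submodule.map_smul'', Submodule.map_top, Submodule.range_subtype]]
  refine ⟨fun hx => ⟨x, hx, rfl⟩, ?_⟩
  rintro ⟨y, hy, hxy⟩
  rwa [← Subtype.ext hxy]

/-- The Jacobian criterion for a quotient `S` of a formally smooth local algebra `P`: `S` is
formally smooth if and only if every relation with vanishing differential at the closed point lies
in `𝔪 I`, where `I` is the ideal of relations. -/
theorem Algebra.FormallySmooth.iff_forall_mem_maximalIdeal_mul_ker {R P S : Type*} [CommRing R]
    [CommRing P] [CommRing S] [IsLocalRing P] [Nontrivial S] [Algebra R P] [Algebra R S]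
    [Algebra P S] [IsScalarTower R P S] [FormallySmooth R P] [Module.Free P Ω[P⁄R]]
    [Module.Finite P Ω[P⁄R]] (hs : Function.Surjective (algebraMap P S))
    (hfg : (RingHom.ker (algebraMap P S)).FG) :
    FormallySmooth R S ↔ ∀ x ∈ RingHom.ker (algebraMap P S),
      (1 ⊗ₜ[P] D R P x : ResidueField P ⊗[P] Ω[P⁄R]) = 0 →
        x ∈ maximalIdeal P * RingHom.ker (algebraMap P S) := by
  have : IsLocalRing S := .of_surjective' _ hs
  have hle : RingHom.ker (algebraMap P S) ≤ maximalIdeal P :=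
    le_maximalIdeal (RingHom.ker_ne_top _)
  let f : S →ₐ[P] ResidueField P :=
    AlgHom.liftOfSurjective (Algebra.ofId P S) hs (Algebra.ofId P (ResidueField P)) (by
      intro x hx
      exact (residue_eq_zero_iff x).2 (hle hx))
  let := f.toAlgebra
  have : IsScalarTower P S (ResidueField P) := .of_algebraMap_eq' f.comp_algebraMap.symm
  have hS : maximalIdeal S ≤ RingHom.ker (algebraMap S (ResidueField P)) := by
    have hsurj : Function.Surjective (algebraMap S (ResidueField P)) := fun y => by
      obtain ⟨x, rfl⟩ := residue_surjective y
      exact ⟨algebraMap P S x, (IsScalarTower.algebraMap_apply P S (ResidueField P) x).symm⟩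
    exact (eq_maximalIdeal (RingHom.ker_isMaximal_of_surjective _ hsurj)).ge
  rw [iff_injective_cotangentComplexBaseChange P (ResidueField P) hs hfg hS]
  set I := RingHom.ker (algebraMap P S)
  have hval (x : I) : cotangentComplexBaseChange R S P (ResidueField P) (1 ⊗ₜ x) =
      1 ⊗ₜ D R P (x : P) := by
    rw [cotangentComplexBaseChange_tmul, one_smul, kerToTensor_apply]
  rw [injective_iff_map_eq_zero]
  refine ⟨fun h x hx h0 => ?_, fun h t ht => ?_⟩
  · exact (one_tmul_eq_zero_iff ⟨x, hx⟩).1 (h _ ((hval _).trans h0))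
  -- Since `P` surjects onto its residue field, every element of `κ ⊗ I` has the form `1 ⊗ x`;
  -- injectivity can thus be tested on elements of `I`.
  · obtain ⟨x, rfl⟩ := TensorProduct.mk_surjective P I _ residue_surjective t
    exact (one_tmul_eq_zero_iff x).2 (h x x.2 ((hval x).symm.trans ht))

/-- In a regular local ring, if the relations in `𝔪²` lie in `𝔪 I`, then the quotient by `I` is
regular. -/
theorem IsRegularLocalRing.quotient_of_inf_sq_le {P : Type*} [CommRing P] [IsRegularLocalRing P]
    {I : Ideal P} (hI : I ≤ maximalIdeal P)
    (h : ∀ x ∈ I, x ∈ maximalIdeal P ^ 2 → x ∈ maximalIdeal P * I) :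
    IsRegularLocalRing (P ⧸ I) := by
  -- A basis of `κ ⊗ I` lifts to minimal generators of `I`. The hypothesis makes I/𝔪I → 𝔪/𝔪²
  -- injective, so these generators are part of a regular system of parameters.
  let b := Module.finBasis (ResidueField P) (ResidueField P ⊗[P] I)
  choose g hg using fun i => TensorProduct.mk_surjective P I _ residue_surjective (b i)
  let g' (i) : maximalIdeal P := Submodule.inclusion hI (g i)
  have hli : LinearIndependent (ResidueField P) fun i => (maximalIdeal P).toCotangent (g' i) := by
    rw [Fintype.linearIndependent_iff]
    intro a ha i
    choose a' ha' using fun i => residue_surjective (a i)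
    have h1 : (maximalIdeal P).toCotangent (∑ i, a' i • g' i) = 0 := by
      rw [map_sum, ← ha]
      refine Finset.sum_congr rfl fun i _ => ?_
      rw [map_smul, ← ha']
      exact (algebraMap_smul (ResidueField P) (a' i) _).symm
    rw [Ideal.toCotangent_eq_zero] at h1
    have h2 : (((∑ i, a' i • g i : I) : P)) ∈ maximalIdeal P * I :=
      h _ (Subtype.prop _) (by simpa [g'] using h1)
    rw [← one_tmul_eq_zero_iff, TensorProduct.tmul_sum] at h2
    refine Fintype.linearIndependent_iff.1 b.linearIndependent a (.trans ?_ h2) i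
    refine Finset.sum_congr rfl fun i _ => ?_
    rw [TensorProduct.tmul_smul, ← ha', ← hg]
    exact algebraMap_smul (ResidueField P) (a' i) _
  have hspan : Submodule.span P (Set.range g) = ⊤ := span_eq_top_of_tmul_eq_basis g b hg
  have hspan' : Ideal.span (Set.range fun i => (g' i : P)) = I := by
    have := congr(($hspan).map I.subtype)
    rw [Submodule.map_span, ← Set.range_comp, Submodule.map_top, Submodule.range_subtype] at this
    exact this
  have := (quotient_span hli).1
  rwa [hspan'] at this

/-- In a regular local ring, if the quotient by `I` is regular, then the elements of `I ∩ 𝔪²` lie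
in `𝔪 I`. -/
theorem IsRegularLocalRing.mem_maximalIdeal_mul {P : Type*} [CommRing P] [IsRegularLocalRing P]
    {I : Ideal P} [IsRegularLocalRing (P ⧸ I)] {x : P} (hxI : x ∈ I)
    (hx : x ∈ maximalIdeal P ^ 2) : x ∈ maximalIdeal P * I := by
  have hItop : I ≠ ⊤ := Ideal.Quotient.nontrivial_iff.1 inferInstance
  have hI : I ≤ maximalIdeal P := le_maximalIdeal hItop
  have hloc : IsLocalHom (Ideal.Quotient.mk I) := .of_surjective _ Ideal.Quotient.mk_surjective
  have hcomap : (maximalIdeal (P ⧸ I)).comap (Ideal.Quotient.mk I) = maximalIdeal P :=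
    ((IsLocalRing.local_hom_TFAE _).out 0 4).1 hloc
  -- The elements `g` of `I` are chosen to represent a basis of the image of `I` in 𝔪/𝔪². They
  -- generate an ideal `J ≤ I` with regular quotient, and the aim is `J = I`.
  let v (y : I) : CotangentSpace P := (maximalIdeal P).toCotangent (Submodule.inclusion hI y)
  obtain ⟨t, htsub, htspan, htli⟩ := exists_linearIndependent (ResidueField P) (Set.range v)
  have htfin : t.Finite := htli.setFinite
  let _ : Fintype t := htfin.fintype
  let et := Fintype.equivFin t
  choose g hg using fun i => htsub (et.symm i).2
  let g' (i) : maximalIdeal P := Submodule.inclusion hI (g i)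
  have hli : LinearIndependent (ResidueField P) fun i => (maximalIdeal P).toCotangent (g' i) := by
    have := htli.comp et.symm et.symm.injective
    convert this using 2 with i
    exact hg i
  obtain ⟨hreg, hdim⟩ := quotient_span hli
  set J := Ideal.span (Set.range fun i => (g' i : P))
  have hJI : J ≤ I := Ideal.span_le.2 (Set.range_subset_iff.2 fun i => (g i).2)
  have hrange : Submodule.span (ResidueField P) (Set.range v) =
      Submodule.span (ResidueField P)
        (Set.range fun i => (maximalIdeal P).toCotangent (g' i)) := by
    rw [← htspan]
    congr 1
    ext y
    refine ⟨fun hy => ⟨et ⟨y, hy⟩, ?_⟩, ?_⟩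
    · exact (hg _).trans (by simp)
    · rintro ⟨i, rfl⟩
      exact (hg i).symm.subst (motive := (· ∈ t)) (et.symm i).2
  have hdimle : ringKrullDim (P ⧸ J) ≤ ringKrullDim (P ⧸ I) := by
    obtain ⟨s, hs, hsspan⟩ :=
      (IsNoetherian.noetherian (maximalIdeal (P ⧸ I))).exists_span_finset_card_eq_spanFinrank
    obtain ⟨d, hd⟩ := exists_natCast_eq_ringKrullDim (P ⧸ J)
    have hsm (y : s) : ∃ z : maximalIdeal P, Ideal.Quotient.mk I z = y := by
      obtain ⟨z, hz⟩ := Ideal.Quotient.mk_surjective (y : P ⧸ I)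
      refine ⟨⟨z, ?_⟩, hz⟩
      rw [← hcomap, Ideal.mem_comap, hz, ← hsspan]
      exact Submodule.subset_span y.2
    choose l hl using hsm
    -- The `g'` together with lifts of `dim (P ⧸ I)` generators of the maximal ideal of `P ⧸ I` span
    -- 𝔪/𝔪²: two elements of 𝔪 congruent modulo `I` differ by an element whose class is a
    -- combination of the `g'`.
    have htop : Submodule.span (ResidueField P)
        ((Set.range fun i => (maximalIdeal P).toCotangent (g' i)) ∪
          Set.range fun y => (maximalIdeal P).toCotangent (l y)) = ⊤ := by
      rw [Submodule.span_union, ← hrange, eq_top_iff]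
      intro y _
      obtain ⟨z, rfl⟩ := Ideal.toCotangent_surjective _ y
      have hz : Ideal.Quotient.mk I z ∈ Ideal.span (s : Set (P ⧸ I)) := by
        have := hcomap.ge z.2
        rw [Ideal.mem_comap, ← hsspan] at this
        exact this
      have hz2 : ∃ z' ∈ Submodule.span P (Set.range l), Ideal.Quotient.mk I z' =
          Ideal.Quotient.mk I z := by
        have hs' : (s : Set (P ⧸ I)) = (Ideal.Quotient.mkₐ P I).toLinearMap.comp
            (maximalIdeal P).subtype '' Set.range l := by
          rw [← Set.range_comp, ← Subtype.range_coe (s := (s : Set (P ⧸ I)))]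
          exact congrArg Set.range (funext fun y => (hl y).symm)
        rw [← Ideal.Quotient.mkₐ_eq_mk P, ← Submodule.restrictScalars_mem P]  at hz
        rw [Ideal.span, Submodule.restrictScalars_span P (P ⧸ I) Ideal.Quotient.mk_surjective, hs',
          ← Submodule.map_span] at hz
        obtain ⟨z', hz', h⟩ := hz
        exact ⟨z', hz', h⟩
      obtain ⟨z', hz', h⟩ := hz2
      have hsub : ((z - z' : maximalIdeal P) : P) ∈ I := by
        exact Ideal.Quotient.eq.1 h.symm
      rw [show z = (z - z') + z' by abel, map_add]
      refine Submodule.add_mem_sup (Submodule.subset_span ⟨⟨_, hsub⟩, rfl⟩) ?_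
      have h5 := Submodule.mem_map_of_mem (f := (maximalIdeal P).toCotangent) hz'
      rw [Submodule.map_span, ← Set.range_comp] at h5
      exact Submodule.span_subset_span P (ResidueField P) _ h5
    have hle : Module.finrank (ResidueField P) (CotangentSpace P) ≤ Fintype.card t + s.card := by
      rw [← finrank_top, ← htop, ← Set.Sum.elim_range]
      refine (finrank_range_le_card _).trans ?_
      simp
    have h1 : ringKrullDim (P ⧸ I) = (s.card : ℕ) := by
      rw [← (isRegularLocalRing_iff (P ⧸ I)).1 inferInstance, hs]
    rw [h1, hd]
    rw [hd, ← finrank_cotangentSpace_eq] at hdim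
    norm_cast at hdim ⊢
    omega
  -- `P ⧸ J` is regular, hence a domain, and killing a nonzero element of a domain lowers the
  -- dimension, which `hdimle` forbids.
  have hJ : J = I := by
    refine le_antisymm hJI fun y hy => ?_
    by_contra hyJ
    obtain ⟨d, hd⟩ := exists_natCast_eq_ringKrullDim (P ⧸ I)
    have := ringKrullDim_succ_le_of_surjective (Ideal.Quotient.factor hJI)
      (Ideal.Quotient.factor_surjective hJI) (r := Ideal.Quotient.mk J y)
      (mem_nonZeroDivisors_of_ne_zero (by rwa [ne_eq, Ideal.Quotient.eq_zero_iff_mem]))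
      (by rwa [Ideal.Quotient.factor_mk, Ideal.Quotient.eq_zero_iff_mem])
    have := this.trans hdimle
    rw [hd] at this
    norm_cast at this
    omega
  obtain ⟨a, ha⟩ := (Ideal.mem_span_range_iff_exists_fun).1 (hJ ▸ hxI : x ∈ J)
  have h0 : ∑ i, residue P (a i) • (maximalIdeal P).toCotangent (g' i) = 0 := by
    rw [show (0 : CotangentSpace P) = (maximalIdeal P).toCotangent (∑ i, a i • g' i) by
      rw [eq_comm, Ideal.toCotangent_eq_zero]
      convert hx
      simp [← ha], map_sum]
    refine Finset.sum_congr rfl fun i _ => ?_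
    rw [map_smul]
    exact algebraMap_smul (ResidueField P) (a i) _
  rw [← ha]
  refine sum_mem fun i _ => Ideal.mul_mem_mul ?_ (g i).2
  exact (residue_eq_zero_iff _).1 (Fintype.linearIndependent_iff.1 hli _ h0 i)

/-- Let `P` be a regular local ring that is formally smooth over a field `k` with residue field
`k`. A quotient of `P` is formally smooth over `k` if and only if it is regular. -/
theorem Algebra.FormallySmooth.iff_isRegularLocalRing {k P S : Type*} [Field k] [CommRing P]
    [CommRing S] [IsRegularLocalRing P] [Nontrivial S] [Algebra k P] [Algebra k S]
    [Algebra P S] [IsScalarTower k P S] [FormallySmooth k P] [Module.Free P Ω[P⁄k]]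
    [Module.Finite P Ω[P⁄k]] (hs : Function.Surjective (algebraMap P S))
    (hk : Function.Bijective (algebraMap k (ResidueField P))) :
    FormallySmooth k S ↔ IsRegularLocalRing S := by
  -- The criterion applied to the residue field itself says that an element of 𝔪 whose differential
  -- vanishes at the closed point lies in 𝔪². Together with the converse `hsq`, the criterion for
  -- `S` becomes `I ∩ 𝔪² ⊆ 𝔪 I`.
  have hκ : FormallySmooth k (ResidueField P) :=
    .of_equiv (AlgEquiv.ofBijective (Algebra.ofId k (ResidueField P)) hk)
  have hker : RingHom.ker (algebraMap P (ResidueField P)) = maximalIdeal P := ker_residue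
  rw [iff_forall_mem_maximalIdeal_mul_ker (P := P) residue_surjective (IsNoetherian.noetherian _),
    hker, ← sq] at hκ
  rw [iff_forall_mem_maximalIdeal_mul_ker hs (IsNoetherian.noetherian _)]
  set I := RingHom.ker (algebraMap P S) with hIdef
  have hI : I ≤ maximalIdeal P := le_maximalIdeal (RingHom.ker_ne_top _)
  have hsq {x : P} (hx : x ∈ maximalIdeal P ^ 2) :
      (1 ⊗ₜ[P] D k P x : ResidueField P ⊗[P] Ω[P⁄k]) = 0 := by
    rw [sq] at hx
    induction hx using Submodule.mul_induction_on' with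
    | mem_mul_mem a ha b hb =>
      have h0 {a : P} (ha : a ∈ maximalIdeal P) (b : P) :
          (1 ⊗ₜ[P] (a • D k P b) : ResidueField P ⊗[P] Ω[P⁄k]) = 0 := by
        rw [← TensorProduct.smul_tmul, Algebra.smul_def, mul_one]
        rw [show algebraMap P (ResidueField P) a = 0 from (residue_eq_zero_iff a).2 ha, zero_tmul]
      rw [Derivation.leibniz, TensorProduct.tmul_add, h0 ha, h0 hb, add_zero]
    | add a _ b _ ha hb => rw [map_add, TensorProduct.tmul_add, ha, hb, add_zero]
  let e : (P ⧸ I) ≃+* S := RingHom.quotientKerEquivOfSurjective hs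
  refine ⟨fun h => ?_, fun h x hx h0 => ?_⟩
  · have := IsRegularLocalRing.quotient_of_inf_sq_le hI fun x hx hx2 => h x hx (hsq hx2)
    exact .of_ringEquiv e
  · have : IsRegularLocalRing (P ⧸ I) := .of_ringEquiv e.symm
    exact IsRegularLocalRing.mem_maximalIdeal_mul hx (hκ x (hI hx) h0)

end JacobianLocal

/-! ### Descent of smoothness along faithfully flat maps -/

section SmoothDescent

open IsLocalRing TensorProduct KaehlerDifferential

namespace MvPolynomial

variable {R : Type u} [CommRing R] {n : ℕ} (q : Ideal (MvPolynomial (Fin n) R)) [q.IsPrime]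

instance formallyEtale_localization_atPrime :
    Algebra.FormallyEtale (MvPolynomial (Fin n) R) (Localization.AtPrime q) :=
  .of_isLocalization q.primeCompl

instance formallySmooth_localization_atPrime :
    Algebra.FormallySmooth R (Localization.AtPrime q) :=
  .comp _ (MvPolynomial (Fin n) R) _

instance free_kaehlerDifferential_localization_atPrime :
    Module.Free (Localization.AtPrime q) Ω[Localization.AtPrime q⁄R] :=
  .of_equiv (tensorKaehlerEquivOfFormallyEtale R (MvPolynomial (Fin n) R) _)

instance finite_kaehlerDifferential_localization_atPrime :
    Module.Finite (Localization.AtPrime q) Ω[Localization.AtPrime q⁄R] :=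
  .of_surjective (tensorKaehlerEquivOfFormallyEtale R (MvPolynomial (Fin n) R)
    (Localization.AtPrime q)).toLinearMap (LinearEquiv.surjective _)

end MvPolynomial

/-- Nullstellensatz; it supplies the hypothesis on residue fields under which smooth and regular
agree. -/
lemma bijective_algebraMap_residueField_localization {k D : Type u} [Field k] [IsAlgClosed k]
    [CommRing D] [Algebra k D] [Algebra.FiniteType k D] (n : Ideal D) [n.IsMaximal] :
    Function.Bijective (algebraMap k (ResidueField (Localization.AtPrime n))) := by
  have h1 : Function.Bijective (algebraMap k (D ⧸ n)) := by
    let _ := Ideal.Quotient.field n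
    have := finite_of_finite_type_of_isJacobsonRing k (D ⧸ n)
    exact IsAlgClosed.algebraMap_bijective_of_isIntegral
  have h2 : Function.Bijective (algebraMap (D ⧸ n) n.ResidueField) :=
    Ideal.bijective_algebraMap_quotient_residueField n
  have h3 := h2.comp h1
  rw [← RingHom.coe_comp, ← IsScalarTower.algebraMap_eq] at h3
  exact h3

/-- Over an algebraically closed field, a finitely generated algebra is smooth at a maximal ideal if
and only if its localization there is regular. -/
theorem Algebra.isSmoothAt_iff_isRegularLocalRing {k D : Type u} [Field k] [IsAlgClosed k]
    [CommRing D] [Algebra k D] [Algebra.FiniteType k D] (n : Ideal D) [n.IsMaximal] :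
    IsSmoothAt k n ↔ IsRegularLocalRing (Localization.AtPrime n) := by
  obtain ⟨l, f, hf⟩ := Algebra.FiniteType.iff_quotient_mvPolynomial''.mp
    (inferInstance : Algebra.FiniteType k D)
  let q := n.comap f.toRingHom
  have : q.IsMaximal := Ideal.comap_isMaximal_of_surjective _ hf
  let P := Localization.AtPrime q
  let F : P →ₐ[k] Localization.AtPrime n := Localization.localAlgHom q n f rfl
  algebraize [F.toRingHom]
  exact FormallySmooth.iff_isRegularLocalRing (P := P)
    (RingHom.surjective_localRingHom_of_surjective f.toRingHom hf n)
    (bijective_algebraMap_residueField_localization q)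

/-- Over an algebraically closed field, smoothness descends along faithfully flat morphisms. -/
theorem Algebra.Smooth.of_faithfullyFlat_of_isAlgClosed {k D E : Type u} [Field k] [IsAlgClosed k]
    [CommRing D] [CommRing E] [Algebra k D] [Algebra k E] [Algebra D E] [IsScalarTower k D E]
    [Algebra.FiniteType k D] [Module.FaithfullyFlat D E] [Smooth k E] : Smooth k D := by
  have : IsNoetherianRing D := Algebra.FiniteType.isNoetherianRing k D
  have : FinitePresentation k D := Algebra.FinitePresentation.of_finiteType.1 inferInstance
  have hmax (n : Ideal D) [hn : n.IsMaximal] : IsSmoothAt k n := by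
    rw [isSmoothAt_iff_isRegularLocalRing]
    obtain ⟨Q, hQ⟩ := PrimeSpectrum.comap_surjective_of_faithfullyFlat (A := D) (B := E)
      ⟨n, inferInstance⟩
    -- The prime over `n` is enlarged to a maximal ideal, since the comparison of smooth with
    -- regular is available only there. The maximal ideal still lies over `n`, because `n` is
    -- maximal.
    obtain ⟨N, hN, hQN⟩ := Q.asIdeal.exists_le_maximal Q.2.ne_top
    have hcomap : N.comap (algebraMap D E) = n := by
      refine (hn.eq_of_le (Ideal.comap_ne_top _ hN.ne_top) ?_).symm
      rw [show n = Q.asIdeal.comap (algebraMap D E) from congrArg PrimeSpectrum.asIdeal hQ.symm]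
      exact Ideal.comap_mono hQN
    have hreg : IsRegularLocalRing (Localization.AtPrime N) := by
      rw [← isSmoothAt_iff_isRegularLocalRing (k := k)]
      have : (⟨N, inferInstance⟩ : PrimeSpectrum E) ∈ smoothLocus k E := by
        rw [smoothLocus_eq_univ]; trivial
      exact this
    have : N.LiesOver n := ⟨hcomap.symm⟩
    let := Localization.AtPrime.algebraOfLiesOver n N
    have : IsLocalHom (algebraMap (Localization.AtPrime n) (Localization.AtPrime N)) :=
      Localization.isLocalHom_localRingHom n N (algebraMap D E) hcomap.symm
    have : Module.Flat (Localization.AtPrime n) (Localization.AtPrime N) :=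
      RingHom.Flat.localRingHom (RingHom.flat_algebraMap_iff.2 inferInstance) N n hcomap.symm
    exact IsRegularLocalRing.of_flat _ (Localization.AtPrime N)
  -- Every prime generalizes a maximal ideal, and the open smooth locus is stable under
  -- generalization.
  refine ⟨smoothLocus_eq_univ_iff.1 (Set.eq_univ_iff_forall.2 fun p => ?_), inferInstance⟩
  obtain ⟨n, hn, hpn⟩ := p.asIdeal.exists_le_maximal p.2.ne_top
  have : (⟨n, hn.isPrime⟩ : PrimeSpectrum D) ∈ smoothLocus k D := hmax n
  refine (isOpen_smoothLocus.stableUnderGeneralization) ?_ this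
  rwa [← PrimeSpectrum.le_iff_specializes]

/-- Smoothness descends along faithfully flat morphisms from flat algebras of finite
presentation. -/
theorem Algebra.Smooth.of_faithfullyFlat {A D E : Type u} [CommRing A]
    [CommRing D] [CommRing E] [Algebra A D] [Algebra A E] [Algebra D E] [IsScalarTower A D E]
    [Module.Flat A D] [Algebra.FinitePresentation A D] [Module.FaithfullyFlat D E] [Smooth A E] :
    Smooth A D := by
  -- By flatness and finite presentation over `A`, smoothness may be checked on fibres, and on each
  -- fibre after extension to an algebraic closure `L`.
  refine .of_formallySmooth_fiber fun I _ => ?_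
  let κ := I.ResidueField
  let L := AlgebraicClosure κ
  suffices Smooth κ (I.Fiber D) from this.1
  suffices Smooth L (L ⊗[κ] (κ ⊗[A] D)) from
    .of_smooth_tensorProduct_of_faithfullyFlat (T := L) (R := κ) (S := κ ⊗[A] D)
  suffices Smooth L (L ⊗[A] D) from
    .of_equiv (TensorProduct.cancelBaseChange A κ L L D).symm
  let _ : Algebra D (L ⊗[A] D) := TensorProduct.rightAlgebra
  -- `E'` is `L ⊗ E` written as a base change of `D → E`, which exhibits it as faithfully flat over
  -- `L ⊗ D`; the isomorphism transports smoothness over `L`.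
  let E' := (L ⊗[A] D) ⊗[D] E
  let e₁ : L ⊗[A] D ≃ₐ[D] D ⊗[A] L :=
    { __ := TensorProduct.comm _ _ _, commutes' _ := rfl }
  let e : E' ≃+* L ⊗[A] E :=
    (TensorProduct.comm D (L ⊗[A] D) E).toRingEquiv.trans <|
    (TensorProduct.congr (.refl (R := D)) e₁).toRingEquiv.trans <|
    (TensorProduct.cancelBaseChange A D D E L).toRingEquiv.trans
    (TensorProduct.comm A E L).toRingEquiv
  let e' : E' ≃ₐ[L] L ⊗[A] E := .ofRingEquiv (f := e) fun l => by
    have h1 : TensorProduct.comm D (L ⊗[A] D) E ((l ⊗ₜ 1) ⊗ₜ 1) = 1 ⊗ₜ (l ⊗ₜ 1) := rfl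
    have h2 : TensorProduct.cancelBaseChange A D D E L (1 ⊗ₜ (1 ⊗ₜ l)) = 1 ⊗ₜ l := by
      rw [TensorProduct.cancelBaseChange_tmul, one_smul]
    exact congrArg (TensorProduct.comm A E L) h2
  have : Smooth L E' := .of_equiv e'.symm
  exact .of_faithfullyFlat_of_isAlgClosed (E := E')

end SmoothDescent

/-! ### The Jacobian criterion through transcendence degree -/

section JacobianCriterion

open IsLocalRing TensorProduct KaehlerDifferential

/-- The transcendence degree drops along a non-injective surjection of domains. -/
theorem Algebra.trdeg_add_one_le_of_surjective {A D D' : Type u} [CommRing A] [CommRing D]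
    [CommRing D'] [IsDomain D] [IsDomain D'] [Algebra A D] [Algebra A D'] [FaithfulSMul A D']
    (f : D →ₐ[A] D') (hf : Function.Surjective f) (hf' : ¬ Function.Injective f) :
    trdeg A D' + 1 ≤ trdeg A D := by
  have hinj : Function.Injective (algebraMap A D') := FaithfulSMul.algebraMap_injective A D'
  have : IsDomain A := hinj.isDomain
  have : FaithfulSMul A D := (faithfulSMul_iff_algebraMap_injective A D).2 (by
    rw [← f.comp_algebraMap] at hinj
    exact .of_comp hinj)
  obtain ⟨s, hs⟩ := exists_isTranscendenceBasis A D'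
  choose x hx using fun i : s => hf i
  have hxs : (f ∘ x) = ((↑) : s → D') := funext hx
  have hind : AlgebraicIndependent A x := .of_comp f (by rw [hxs]; exact hs.1)
  obtain ⟨d, hd, hd0⟩ : ∃ d, f d = 0 ∧ d ≠ 0 := by
    rw [injective_iff_map_eq_zero] at hf'
    push Not at hf'
    exact hf'
  -- Lifts of a transcendence basis of `D'` gain one more independent element, any nonzero `d` in
  -- the kernel: if `d` were algebraic over the lifts, it would divide a nonzero polynomial in them,
  -- whose image in `D'` would be a relation in the basis.
  have htr : Transcendental (Algebra.adjoin A (Set.range x)) d := by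
    intro halg
    obtain ⟨r, hr, hrd⟩ := halg.exists_nonzero_dvd (mem_nonZeroDivisors_of_ne_zero hd0)
    obtain ⟨p, hp⟩ := hind.aevalEquiv.surjective r
    refine hr ?_
    rw [← hp]
    have h0 : MvPolynomial.aeval ((↑) : s → D') p = 0 := by
      have h1 : f (algebraMap _ D r) = 0 := by
        obtain ⟨c, hc⟩ := hrd
        rw [hc, map_mul, hd, zero_mul]
      rw [← hp, hind.algebraMap_aevalEquiv] at h1
      rw [← hxs, ← h1]
      exact (MvPolynomial.comp_aeval_apply x f p).symm
    have := (injective_iff_map_eq_zero _).1 hs.1 p h0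
    rw [this, map_zero]
  have h2 := ((hind.option_iff_transcendental d).2 htr).cardinalMk_le_trdeg
  rwa [Cardinal.mk_option, hs.cardinalMk_eq_trdeg] at h2

/-- The transcendence degree of the quotient of a regular local ring by part of a regular system of
parameters. -/
theorem IsRegularLocalRing.trdeg_quotient_span_add_le {A P : Type u} [CommRing A] [CommRing P]
    [IsRegularLocalRing P] [Algebra A P] {c : ℕ} {g : Fin c → maximalIdeal P}
    (hg : LinearIndependent (ResidueField P) fun i => (maximalIdeal P).toCotangent (g i))
    (hA : Function.Injective (algebraMap A (P ⧸ Ideal.span (Set.range fun i => (g i : P))))) :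
    Algebra.trdeg A (P ⧸ Ideal.span (Set.range fun i => (g i : P))) + c ≤ Algebra.trdeg A P := by
  induction c with
  | zero =>
    rw [Nat.cast_zero, add_zero]
    have : FaithfulSMul A (P ⧸ Ideal.span (Set.range fun i => (g i : P))) :=
      (faithfulSMul_iff_algebraMap_injective _ _).2 hA
    exact trdeg_le_of_surjective (Ideal.Quotient.mkₐ A _) Ideal.Quotient.mk_surjective
  | succ c ih =>
    have hli := hg.comp _ (Fin.castSucc_injective c)
    set J := Ideal.span (Set.range fun i => (g i : P))
    let g' := g ∘ Fin.castSucc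
    obtain ⟨h1, h1d⟩ := quotient_span hg
    obtain ⟨h2, h2d⟩ := quotient_span (g := g') hli
    set J' := Ideal.span (Set.range fun i => (g' i : P)) with hJ'
    have hle : J' ≤ J := Ideal.span_mono (Set.range_subset_iff.2 fun i => ⟨i.castSucc, rfl⟩)
    have : FaithfulSMul A (P ⧸ J) := (faithfulSMul_iff_algebraMap_injective _ _).2 hA
    have hA' : Function.Injective (algebraMap A (P ⧸ J')) := by
      rw [← (Ideal.Quotient.factorₐ A hle).comp_algebraMap, RingHom.coe_comp] at hA
      exact .of_comp hA
    -- Both quotients are regular, hence domains, and their dimensions differ by one; so adding the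
    -- last parameter is a noninjective surjection and costs one in transcendence degree.
    have h3 := Algebra.trdeg_add_one_le_of_surjective (Ideal.Quotient.factorₐ A hle)
      (Ideal.Quotient.factor_surjective hle) (by
        intro hinj
        have hJ : J = J' := by
          refine le_antisymm (fun x hx => ?_) hle
          rw [← Ideal.Quotient.eq_zero_iff_mem]
          refine hinj ?_
          rw [map_zero]
          exact Ideal.Quotient.eq_zero_iff_mem.2 hx
        change ringKrullDim (P ⧸ J) + _ = _ at h1d
        rw [hJ] at h1d
        obtain ⟨d, hd⟩ := exists_natCast_eq_ringKrullDim (P ⧸ J')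
        rw [← h2d, hd] at h1d
        norm_cast at h1d
        omega)
    refine le_trans ?_ (ih (g := g') hli hA')
    push_cast
    rw [add_comm (c : Cardinal), ← add_assoc]
    gcongr

section

variable {A P L V : Type*} [CommRing A] [CommRing P] [IsLocalRing P] [Algebra A P] [Field L]
  [Algebra P L] [AddCommGroup V] [Module P V] [Module L V] [IsScalarTower P L V]

lemma KaehlerDifferential.smul_eq_zero_of_mem_maximalIdeal
    (hL : ∀ x ∈ maximalIdeal P, algebraMap P L x = 0)
    {a : P} (ha : a ∈ maximalIdeal P)
    (v : V) : a • v = 0 := by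
  rw [← algebraMap_smul L a v, hL a ha, zero_smul]

/-- The Leibniz terms in which `g i` multiplies the differential of `a i` vanish, as 𝔪 acts by zero
on `V`. The field `L` may be larger than the residue field, so that it can carry a geometric point.
-/
lemma KaehlerDifferential.apply_D_sum_smul
    (hL : ∀ x ∈ maximalIdeal P, algebraMap P L x = 0)
    (θ : Ω[P⁄A] →ₗ[P] V) {c : ℕ} {g : Fin c → P}
    (hg : ∀ i, g i ∈ maximalIdeal P) (a : Fin c → P) :
    θ (D A P (∑ i, a i * g i)) = ∑ i, algebraMap P L (a i) • θ (D A P (g i)) := by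
  simp only [map_sum, Derivation.leibniz, map_add, map_smul,
    smul_eq_zero_of_mem_maximalIdeal hL (hg _), add_zero, algebraMap_smul]

lemma KaehlerDifferential.mem_maximalIdeal_of_apply_D_sum_eq_zero
    (hL : ∀ x ∈ maximalIdeal P, algebraMap P L x = 0)
    (θ : Ω[P⁄A] →ₗ[P] V) {c : ℕ} {g : Fin c → P}
    (hg : ∀ i, g i ∈ maximalIdeal P) (hli : LinearIndependent L fun i => θ (D A P (g i)))
    {a : Fin c → P} (h : θ (D A P (∑ i, a i * g i)) = 0) (i : Fin c) :
    a i ∈ maximalIdeal P := by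
  rw [apply_D_sum_smul hL θ hg] at h
  have := Fintype.linearIndependent_iff.1 hli _ h i
  rw [mem_maximalIdeal, mem_nonunits_iff]
  intro hu
  exact (hu.map (algebraMap P L)).ne_zero this

/-- Differentials that are linearly independent at the closed point detect elements that are
linearly independent modulo `𝔪 ^ 2`. -/
theorem IsLocalRing.linearIndependent_toCotangent
    (hL : ∀ x ∈ maximalIdeal P, algebraMap P L x = 0)
    (θ : Ω[P⁄A] →ₗ[P] V) {c : ℕ}
    {g : Fin c → maximalIdeal P} (hg : LinearIndependent L fun i => θ (D A P (g i))) :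
    LinearIndependent (ResidueField P) fun i => (maximalIdeal P).toCotangent (g i) := by
  rw [Fintype.linearIndependent_iff]
  intro a ha i
  choose a' ha' using fun i => residue_surjective (a i)
  have h1 : (maximalIdeal P).toCotangent (∑ i, a' i • g i) = 0 := by
    rw [map_sum, ← ha]
    refine Finset.sum_congr rfl fun i _ => ?_
    rw [map_smul, ← ha']
    exact (algebraMap_smul (ResidueField P) (a' i) _).symm
  rw [Ideal.toCotangent_eq_zero] at h1
  -- By Leibniz, `θ ∘ D` kills 𝔪², so a dependence modulo 𝔪² becomes one between the differentials.
  have h2 {x : P} (hx : x ∈ maximalIdeal P ^ 2) : θ (D A P x) = 0 := by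
    rw [sq] at hx
    induction hx using Submodule.mul_induction_on' with
    | mem_mul_mem a ha b hb =>
      rw [Derivation.leibniz, map_add, map_smul, map_smul, smul_eq_zero_of_mem_maximalIdeal hL ha,
        smul_eq_zero_of_mem_maximalIdeal hL hb, add_zero]
    | add a _ b _ ha hb => rw [map_add, map_add, ha, hb, add_zero]
  have h3 := h2 h1
  simp only [AddSubmonoidClass.coe_finsetSum, Submodule.coe_smul, smul_eq_mul] at h3
  rw [← ha', residue_eq_zero_iff]
  exact mem_maximalIdeal_of_apply_D_sum_eq_zero hL θ (fun i => (g i).2) hg h3 i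

end

/-- A quotient `S` of a regular local ring `P`, formally smooth over `A`, is formally smooth over
`A` if the transcendence degree of `S` is as small as the number of linearly independent
differentials of relations permits. -/
theorem Algebra.FormallySmooth.of_linearIndependent {A P S L V : Type u} [CommRing A]
    [CommRing P] [CommRing S] [IsRegularLocalRing P] [IsDomain S] [Algebra A P] [Algebra A S]
    [Algebra P S] [IsScalarTower A P S] [FormallySmooth A P] [Module.Free P Ω[P⁄A]]
    [Module.Finite P Ω[P⁄A]] (hs : Function.Surjective (algebraMap P S)) [FaithfulSMul A S]
    [Field L] [Algebra P L] [AddCommGroup V]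
    [Module P V] [Module L V] [IsScalarTower P L V]
    (hL : ∀ x ∈ maximalIdeal P, algebraMap P L x = 0) (θ : Ω[P⁄A] →ₗ[P] V) {c n : ℕ}
    (g : Fin c → P) (hgS : ∀ i, algebraMap P S (g i) = 0)
    (hg : LinearIndependent L fun i => θ (D A P (g i)))
    (hP : trdeg A P = n) (hS : n ≤ trdeg A S + c) :
    FormallySmooth A S := by
  have hle : RingHom.ker (algebraMap P S) ≤ maximalIdeal P :=
    le_maximalIdeal (RingHom.ker_ne_top _)
  have hgm (i) : g i ∈ maximalIdeal P := hle (hgS i)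
  let g' (i) : maximalIdeal P := ⟨g i, hgm i⟩
  have hli := IsLocalRing.linearIndependent_toCotangent hL θ (g := g') hg
  obtain ⟨hreg, -⟩ := IsRegularLocalRing.quotient_span hli
  set J := Ideal.span (Set.range fun i => (g' i : P)) with hJdef
  have hJ : J ≤ RingHom.ker (algebraMap P S) := Ideal.span_le.2 (Set.range_subset_iff.2 hgS)
  let F : P ⧸ J →ₐ[A] S := Ideal.Quotient.liftₐ J (IsScalarTower.toAlgHom A P S) hJ
  have hF (x : P) : F (Ideal.Quotient.mk J x) = algebraMap P S x := rfl
  have hFs : Function.Surjective F := fun y => by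
    obtain ⟨x, rfl⟩ := hs y
    exact ⟨Ideal.Quotient.mk J x, rfl⟩
  have hinj : Function.Injective (algebraMap A (P ⧸ J)) := by
    have := FaithfulSMul.algebraMap_injective A S
    rw [← F.comp_algebraMap, RingHom.coe_comp] at this
    exact .of_comp this
  have htr := IsRegularLocalRing.trdeg_quotient_span_add_le hli hinj
  -- Were `F` not injective, then `trdeg S + 1 ≤ trdeg (P ⧸ J) ≤ n - c`, against the bound on `trdeg
  -- S`. Hence the chosen relations generate the whole kernel.
  have hFi : Function.Injective F := by
    by_contra h
    have h1 := Algebra.trdeg_add_one_le_of_surjective F hFs h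
    change trdeg A (P ⧸ J) + _ ≤ _ at htr
    have h2 : (n : Cardinal) + 1 ≤ n := by
      calc (n : Cardinal) + 1 ≤ trdeg A S + c + 1 := by gcongr
        _ = trdeg A S + 1 + c := by ring
        _ ≤ trdeg A (P ⧸ J) + c := by gcongr
        _ ≤ n := htr.trans hP.le
    norm_cast at h2
    omega
  have hIJ {x : P} (hx : x ∈ RingHom.ker (algebraMap P S)) : x ∈ J := by
    rw [← Ideal.Quotient.eq_zero_iff_mem]
    exact hFi (by rw [hF, map_zero, hx])
  rw [iff_forall_mem_maximalIdeal_mul_ker hs (IsNoetherian.noetherian _)]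
  intro x hx h0
  obtain ⟨a, rfl⟩ := Ideal.mem_span_range_iff_exists_fun.1 (hIJ hx)
  have h1 : θ (D A P (∑ i, a i * g i)) = 0 := by
    -- `h0` says that the differential lies in 𝔪Ω, which `θ` kills; independence of the
    -- differentials then puts every `a i` in 𝔪.
    have h2 : D A P (∑ i, a i * g i) ∈ maximalIdeal P • (⊤ : Submodule P Ω[P⁄A]) := by
      rw [← LinearMap.ker_tensorProductMk]
      exact h0
    refine Submodule.smul_induction_on h2 (fun a ha z _ => ?_) fun y z hy hz => ?_
    · rw [map_smul, smul_eq_zero_of_mem_maximalIdeal hL ha]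
    · rw [map_add, hy, hz, add_zero]
  exact sum_mem fun i _ => Ideal.mul_mem_mul
    (mem_maximalIdeal_of_apply_D_sum_eq_zero hL θ hgm hg h1 i) (hgS i)

/-- The Jacobian criterion: a quotient `R` of a polynomial ring over `A` is smooth at a point where
the Jacobian matrix of some relations has as large a rank as the transcendence degree of `R`
permits. -/
theorem Algebra.isSmoothAt_of_linearIndependent {A R L : Type u} [CommRing A] [IsDomain A]
    [IsRegularRing A] [CommRing R] [IsDomain R] [Algebra A R] [FaithfulSMul A R] [Field L]
    [Algebra A L] {N c : ℕ} (f : MvPolynomial (Fin N) A →ₐ[A] R) (hf : Function.Surjective f)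
    (φ : R →ₐ[A] L) (g : Fin c → MvPolynomial (Fin N) A) (hg : ∀ i, f (g i) = 0)
    (hli : LinearIndependent L fun i j => φ (f (MvPolynomial.pderiv j (g i))))
    (htr : N ≤ trdeg A R + c) (y : Ideal R) [y.IsPrime] (hy : RingHom.ker φ = y) :
    IsSmoothAt A y := by
  let q := y.comap f.toRingHom
  let P := Localization.AtPrime q
  let F : P →ₐ[A] Localization.AtPrime y := Localization.localAlgHom q y f rfl
  have hFs : Function.Surjective F :=
    RingHom.surjective_localRingHom_of_surjective f.toRingHom hf y
  have hFf (p) : F (algebraMap _ P p) = algebraMap R _ (f p) :=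
    Localization.localRingHom_to_map q y f.toRingHom rfl p
  let ψ : MvPolynomial (Fin N) A →ₐ[A] L := φ.comp f
  have hψ {p} : p ∈ q ↔ ψ p = 0 := by
    rw [Ideal.mem_comap, ← hy]
    exact Iff.rfl
  let G : P →+* L := IsLocalization.lift (M := q.primeCompl) (g := ψ.toRingHom) fun s =>
    (Ne.isUnit fun h => s.2 (hψ.2 h))
  have hG (p) : G (algebraMap _ P p) = ψ p := IsLocalization.lift_eq _ p
  let _ := F.toRingHom.toAlgebra
  have : IsScalarTower A P (Localization.AtPrime y) := .of_algebraMap_eq' F.comp_algebraMap.symm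
  let _ := G.toAlgebra
  let _ := ψ.toRingHom.toAlgebra
  have : IsScalarTower (MvPolynomial (Fin N) A) P L := .of_algebraMap_eq fun p => (hG p).symm
  have : IsScalarTower A (MvPolynomial (Fin N) A) L := .of_algebraMap_eq' ψ.comp_algebraMap.symm
  have : FaithfulSMul A (Localization.AtPrime y) := by
    rw [faithfulSMul_iff_algebraMap_injective, IsScalarTower.algebraMap_eq A R, RingHom.coe_comp]
    exact (IsLocalization.injective _ y.primeCompl_le_nonZeroDivisors).comp
      (FaithfulSMul.algebraMap_injective A R)
  -- `θ` evaluates the partial derivatives at the geometric point, so the images of the relations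
  -- are rows of the Jacobian matrix.
  let θj (j : Fin N) : Ω[P⁄A] →ₗ[P] L :=
    ((((Algebra.linearMap (MvPolynomial (Fin N) A) L).compDer
      (MvPolynomial.pderiv (R := A) j)).liftKaehlerDifferential).liftBaseChange P).comp
        (tensorKaehlerEquivOfFormallyEtale A (MvPolynomial (Fin N) A) P).symm.toLinearMap
  let θ : Ω[P⁄A] →ₗ[P] (Fin N → L) := LinearMap.pi θj
  have hθ (p) : θ (D A P (algebraMap _ P p)) = fun j => ψ (MvPolynomial.pderiv j p) := by
    ext j
    change ((((Algebra.linearMap (MvPolynomial (Fin N) A) L).compDer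
      (MvPolynomial.pderiv (R := A) j)).liftKaehlerDifferential).liftBaseChange P)
        ((tensorKaehlerEquivOfFormallyEtale A (MvPolynomial (Fin N) A) P).symm _) = _
    rw [tensorKaehlerEquivOfFormallyEtale_symm_D_algebraMap]
    simp
    rfl
  refine FormallySmooth.of_linearIndependent (P := P) (L := L) (n := N) hFs (fun x hx => ?_) θ
    (fun i => algebraMap _ P (g i)) (fun i => ?_) ?_ ?_ ?_
  · obtain ⟨p, s, rfl⟩ := IsLocalization.exists_mk'_eq q.primeCompl x
    change G _ = 0
    rw [IsLocalization.lift_mk'_spec, mul_zero]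
    refine hψ.1 ?_
    by_contra hp
    exact hx ((IsLocalization.AtPrime.isUnit_mk'_iff P q p s).2 hp)
  · exact (hFf _).trans (by rw [hg, map_zero])
  · simp only [hθ]
    exact hli
  -- Localization is an algebraic extension, so `P` has the transcendence degree `N` of the
  -- polynomial ring.
  · have h1 := _root_.trdeg_add_eq A (MvPolynomial (Fin N) A) (A := P)
    have : FaithfulSMul (MvPolynomial (Fin N) A) P :=
      (faithfulSMul_iff_algebraMap_injective _ _).2
        (IsLocalization.injective _ q.primeCompl_le_nonZeroDivisors)
    have : Algebra.IsAlgebraic (MvPolynomial (Fin N) A) P :=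
      IsLocalization.isAlgebraic _ q.primeCompl
    rw [← h1, _root_.trdeg_eq_zero (R := MvPolynomial (Fin N) A), MvPolynomial.trdeg_of_isDomain]
    simp
  · refine htr.trans ?_
    gcongr
    exact trdeg_le_of_injective (IsScalarTower.toAlgHom A R (Localization.AtPrime y))
      (IsLocalization.injective _ y.primeCompl_le_nonZeroDivisors)

end JacobianCriterion

/-! ### Reduction to geometric points -/

section SmoothAway

open TensorProduct

lemma Algebra.exists_algHom_algebraicClosure {κ B : Type*} [Field κ] [CommRing B] [Algebra κ B]
    [Algebra.FiniteType κ B] {I : Ideal B} (hI : I ≠ ⊤) :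
    ∃ φ : B →ₐ[κ] AlgebraicClosure κ, ∀ x ∈ I, φ x = 0 := by
  obtain ⟨n, hn, hIn⟩ := I.exists_le_maximal hI
  let _ := Ideal.Quotient.field n
  have : Module.Finite κ (B ⧸ n) := finite_of_finite_type_of_isJacobsonRing κ _
  let φ : B ⧸ n →ₐ[κ] AlgebraicClosure κ := IsAlgClosed.lift
  exact ⟨φ.comp (Ideal.Quotient.mkₐ κ n), fun x hx => (congrArg φ
    (Ideal.Quotient.eq_zero_iff_mem.2 (hIn hx))).trans (map_zero φ)⟩

/-- A finitely presented algebra is smooth on a basic open set if it is smooth at all its geometric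
points. -/
theorem Algebra.smooth_away_of_forall_geometricPoint {A R : Type u} [CommRing A] [CommRing R]
    [Algebra A R] [Algebra.FinitePresentation A R] (F : R)
    (h : ∀ (p : PrimeSpectrum A) (φ : R →ₐ[A] AlgebraicClosure p.asIdeal.ResidueField), φ F ≠ 0 →
      (⟨RingHom.ker φ, RingHom.ker_isPrime φ⟩ : PrimeSpectrum R) ∈ smoothLocus A R) :
    Smooth A (Localization.Away F) := by
  rw [← basicOpen_subset_smoothLocus_iff_smooth]
  intro y hy
  let p : PrimeSpectrum A := ⟨y.asIdeal.under A, inferInstance⟩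
  have : y.asIdeal.LiesOver p.asIdeal := ⟨rfl⟩
  let κ := p.asIdeal.ResidueField
  let _ : Algebra κ y.asIdeal.ResidueField :=
    (Ideal.ResidueField.mapₐ p.asIdeal y.asIdeal (Algebra.ofId A R) rfl).toRingHom.toAlgebra
  have : IsScalarTower A κ y.asIdeal.ResidueField :=
    .of_algebraMap_eq' (Ideal.ResidueField.mapₐ p.asIdeal y.asIdeal _ rfl).comp_algebraMap.symm
  have hF : algebraMap R y.asIdeal.ResidueField F ≠ 0 := by
    rwa [ne_eq, Ideal.algebraMap_residueField_eq_zero]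
  let G₀ : Localization.Away F →ₐ[A] y.asIdeal.ResidueField :=
    IsLocalization.liftAlgHom (M := Submonoid.powers F)
      (f := IsScalarTower.toAlgHom A R y.asIdeal.ResidueField) (by
        rintro ⟨_, n, rfl⟩
        simpa using (Ne.isUnit hF).pow n)
  have hG₀ (x : R) : G₀ (algebraMap R _ x) = algebraMap R _ x := IsLocalization.lift_eq _ x
  -- The residue field at `y` is in general transcendental over `κ`, so `y` itself need not be the
  -- kernel of a point with values in the algebraic closure. The Nullstellensatz applied to the
  -- kernel of `G` produces such a point in the closure of `y`, in the same fibre over `A` and with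
  -- `F` still invertible.
  let G : κ ⊗[A] Localization.Away F →ₐ[κ] y.asIdeal.ResidueField :=
    Algebra.TensorProduct.lift (Algebra.ofId _ _) G₀ fun _ _ => .all _ _
  have : FiniteType A (Localization.Away F) := .trans (S := R) inferInstance
    (IsLocalization.finiteType_of_monoid_fg (.powers F) _)
  obtain ⟨φ₁, hφ₁⟩ := exists_algHom_algebraicClosure (κ := κ) (RingHom.ker_ne_top G)
  let φ₂ : R →ₐ[A] κ ⊗[A] Localization.Away F :=
    Algebra.TensorProduct.includeRight.comp (IsScalarTower.toAlgHom A R _)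
  let φ : R →ₐ[A] AlgebraicClosure κ :=
    (φ₁.restrictScalars A).comp φ₂
  have hφ := h p φ (by
    have : IsUnit (algebraMap R (Localization.Away F) F) :=
      IsLocalization.Away.algebraMap_isUnit F
    exact ((this.map Algebra.TensorProduct.includeRight).map φ₁).ne_zero)
  refine isOpen_smoothLocus.stableUnderGeneralization ?_ hφ
  rw [← PrimeSpectrum.le_iff_specializes]
  intro x hx
  refine hφ₁ _ ?_
  change G (1 ⊗ₜ algebraMap R _ x) = 0
  simp only [G, Algebra.TensorProduct.lift_tmul, hG₀, map_one, one_mul]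
  rwa [Ideal.algebraMap_residueField_eq_zero]

end SmoothAway

/-! ### Smoothness of `R` away from the zeros of the monomials -/

namespace CoxModel.TorsorModel

variable {A k : Type u} [CommRing A] [Field k] [Algebra A k] {r N s m : ℕ}
  (M : TorsorModel A k r N s m)

/-- The embedding of `R` in the Laurent polynomial ring over the function field. -/
noncomputable def toLaurent : RelRing M.g →+* M.V.LaurentRing r :=
  Ideal.Quotient.lift _ ((M.V.presentation M.w M.η).comp (MvPolynomial.map (algebraMap A k)))
    fun P hP => by
      rw [← M.comap_eq, Ideal.mem_comap, ← M.ker_eq] at hP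
      exact hP

lemma toLaurent_mk (P : MvPolynomial (Fin N) A) : M.toLaurent (Ideal.Quotient.mk _ P) =
    M.V.presentation M.w M.η (MvPolynomial.map (algebraMap A k) P) := rfl

/-- This is the force of $I\cap A[\eta]=(g)$. It makes `R` a domain and lets its grading be read off
from Laurent exponents. -/
lemma toLaurent_injective : Function.Injective M.toLaurent := by
  rw [injective_iff_map_eq_zero]
  intro x hx
  obtain ⟨P, rfl⟩ := Ideal.Quotient.mk_surjective x
  rw [Ideal.Quotient.eq_zero_iff_mem, ← M.comap_eq, Ideal.mem_comap, ← M.ker_eq]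
  exact hx

lemma toLaurent_algebraMap (a : A) : M.toLaurent (algebraMap A _ a) =
    AddMonoidAlgebra.single 0 (M.V.constants (algebraMap A k a)) := by
  have : (algebraMap A (RelRing M.g) a) = Ideal.Quotient.mk _ (MvPolynomial.C a) := rfl
  rw [this, toLaurent_mk, MvPolynomial.map_C]
  simp [SmoothProjectiveVariety.presentation]

instance : IsDomain (RelRing M.g) := M.toLaurent_injective.isDomain

lemma algebraMap_injective [FaithfulSMul A k] :
    Function.Injective (algebraMap A (RelRing M.g)) := by
  rw [injective_iff_map_eq_zero]
  intro a ha
  have h := M.toLaurent_algebraMap a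
  rw [ha, map_zero, eq_comm, AddMonoidAlgebra.single_eq_zero] at h
  rw [map_eq_zero] at h
  exact (map_eq_zero_iff _ (FaithfulSMul.algebraMap_injective A k)).1 h

lemma exists_linearIndependent_rows {L : Type u} [Field L] [Algebra A L] (a : Fin N → L) :
    ∃ i : Fin (M.jacobian a).rank → Fin s, LinearIndependent L fun k => M.jacobian a (i k) := by
  obtain ⟨f, hf, -, hli⟩ := Submodule.exists_fun_fin_finrank_span_eq L (Set.range (M.jacobian a).row)
  rw [Matrix.rank_eq_finrank_span_row]
  choose i hi using hf
  refine ⟨i, ?_⟩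
  rwa [← show (fun k => M.jacobian a (i k)) = f from funext hi] at hli

/-- The ring `R` is smooth over `A` away from the zeros of the `f i`. -/
theorem smooth_away [IsDedekindDomain A] [FaithfulSMul A k]
    (hJ : ∀ p : PrimeSpectrum A, ∀ a ∈ M.points (AlgebraicClosure p.asIdeal.ResidueField),
      ((M.jacobian a).rank : WithBot ℕ∞) + topologicalKrullDim M.V.X + (r : WithBot ℕ∞) =
        (N : WithBot ℕ∞))
    (htr : ∀ d : ℕ, (d : WithBot ℕ∞) ≤ topologicalKrullDim M.V.X →
      (d + r : Cardinal) ≤ Algebra.trdeg A (RelRing M.g))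
    {F : RelRing M.g} (i : Fin m) (hF : monomialClass M.g (M.e i) ∣ F) :
    Algebra.Smooth A (Localization.Away F) := by
  have := (faithfulSMul_iff_algebraMap_injective A (RelRing M.g)).2 M.algebraMap_injective
  have : Algebra.FinitePresentation A (RelRing M.g) :=
    .quotient (R := A) (A := MvPolynomial (Fin N) A) (Submodule.fg_span (Set.finite_range _))
  refine Algebra.smooth_away_of_forall_geometricPoint F fun p φ hφ => ?_
  let f : MvPolynomial (Fin N) A →ₐ[A] RelRing M.g := Ideal.Quotient.mkₐ A _
  let a (j : Fin N) := φ (f (.X j))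
  have ha (P : MvPolynomial (Fin N) A) : MvPolynomial.aeval a P = φ (f P) := by
    have : MvPolynomial.aeval a = φ.comp f := MvPolynomial.algHom_ext fun j => by simp [a]
    exact congr($this P)
  have hg (l) : f (M.g l) = 0 := Ideal.Quotient.eq_zero_iff_mem.2 (Ideal.subset_span ⟨l, rfl⟩)
  have hap : a ∈ M.points (AlgebraicClosure p.asIdeal.ResidueField) := by
    refine ⟨fun l => by rw [ha, hg, map_zero], i, ?_⟩
    rw [ha]
    intro h0
    obtain ⟨c, rfl⟩ := hF
    exact hφ (by rw [map_mul]; exact mul_eq_zero_of_left h0 _)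
  obtain ⟨l, hl⟩ := M.exists_linearIndependent_rows a
  have := RingHom.ker_isPrime φ
  refine Algebra.isSmoothAt_of_linearIndependent f Ideal.Quotient.mk_surjective φ
    (fun k => M.g (l k)) (fun k => hg _) ?_ ?_ (RingHom.ker φ) rfl
  · simp only [← ha]
    exact hl
  · have h := hJ p a hap
    -- The dimension is a priori in `WithBot ℕ∞`; the rank equation with finite right side `N`
    -- excludes `⊥` and `⊤`.
    generalize topologicalKrullDim M.V.X = D at h htr
    induction D with
    | bot => simp at h
    | coe D =>
      induction D with
      | top =>
        have : ((M.jacobian a).rank + ⊤ + r : ℕ∞) = N := by exact_mod_cast h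
        simp at this
      | coe d =>
        have hd := htr d le_rfl
        have : (M.jacobian a).rank + d + r = N := by exact_mod_cast h
        have hN : (N : Cardinal) = (M.jacobian a).rank + d + r := by exact_mod_cast this.symm
        rw [hN]
        calc _ = (d + r : Cardinal) + (M.jacobian a).rank := by ring
          _ ≤ _ := by gcongr

end CoxModel.TorsorModel

/-! ### Krull dimension and transcendence degree -/

section DimensionTrdeg

/-- The transcendence degree of a domain over a field is at least the length of every chain of prime
ideals. -/
theorem Algebra.natCast_le_trdeg_quotient_of_strictMono {k D : Type u} [Field k] [CommRing D]
    [Algebra k D] {n : ℕ} (f : Fin (n + 1) → PrimeSpectrum D) (hf : StrictMono f) :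
    (n : Cardinal) ≤ trdeg k (D ⧸ (f 0).asIdeal) := by
  induction n with
  | zero => simp
  | succ n ih =>
    have h1 := ih (f ∘ Fin.succ) (hf.comp (Fin.strictMono_succ))
    have hlt : f 0 < f 1 := hf (by simp)
    have hle : (f 0).asIdeal ≤ (f 1).asIdeal := hlt.le
    have := trdeg_add_one_le_of_surjective (Ideal.Quotient.factorₐ k hle)
      (Ideal.Quotient.factor_surjective hle) (by
        intro hinj
        refine hlt.not_ge fun x hx => ?_
        rw [← Ideal.Quotient.eq_zero_iff_mem]
        refine hinj ?_
        rw [map_zero]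
        exact Ideal.Quotient.eq_zero_iff_mem.2 hx)
    refine le_trans ?_ this
    push_cast
    gcongr
    exact h1

theorem Algebra.natCast_le_trdeg_of_le_ringKrullDim {k D : Type u} [Field k] [CommRing D]
    [Algebra k D] [IsDomain D] {n : ℕ} (h : n ≤ ringKrullDim D) : (n : Cardinal) ≤ trdeg k D := by
  obtain ⟨l, rfl⟩ := Order.le_krullDim_iff.1 h
  exact (natCast_le_trdeg_quotient_of_strictMono l l.strictMono).trans
    (trdeg_le_of_surjective (Ideal.Quotient.mkₐ k _) Ideal.Quotient.mk_surjective)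

end DimensionTrdeg

/-! ### Function field, poles and sections of the variety -/

namespace CoxModel.SmoothProjectiveVariety

variable {k : Type u} [Field k] (V : SmoothProjectiveVariety k)

-- Projective space is quasi-compact over the field, and so is a closed subscheme. Together with
-- local Noetherianity this makes the space Noetherian, on which the finiteness of the set of poles
-- rests.
attribute [local instance] MvPolynomial.gradedAlgebra in
instance : CompactSpace V.X := by
  obtain ⟨n, i, hi, h⟩ := V.projective
  have : IsScalarTower k (MvPolynomial.homogeneousSubmodule (Fin (n + 1)) k 0)
      (MvPolynomial (Fin (n + 1)) k) :=
    ⟨fun a b c => smul_mul_assoc a (b : MvPolynomial (Fin (n + 1)) k) c⟩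
  have : Algebra.FiniteType (MvPolynomial.homogeneousSubmodule (Fin (n + 1)) k 0)
      (MvPolynomial (Fin (n + 1)) k) := .of_restrictScalars_finiteType k _ _
  have : QuasiCompact V.str := by
    rw [← h]
    infer_instance
  exact QuasiCompact.compactSpace_of_compactSpace V.str

instance : IsNoetherian V.X where

/-- The ring homomorphism from the ground field to the stalk at a point. -/
noncomputable def constantsStalk (x : V.X) : k →+* V.X.presheaf.stalk x :=
  ((Scheme.ΓSpecIso (CommRingCat.of k)).inv ≫ V.str.appTop ≫
    V.X.presheaf.germ ⊤ x trivial).hom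

lemma algebraMap_constantsStalk (x : V.X) (c : k) :
    algebraMap (V.X.presheaf.stalk x) V.X.functionField (V.constantsStalk x c) =
      V.constants c := by
  have : Nonempty (⊤ : V.X.Opens) := ⟨⟨x, trivial⟩⟩
  exact Scheme.algebraMap_germ_eq_germToFunctionField (X := V.X) (U := ⊤) (x := x)
    (hx := trivial) _

/-- The function field as an algebra over the ground field. -/
noncomputable abbrev algebraFunctionField : Algebra k V.X.functionField := V.constants.toAlgebra

attribute [local instance] algebraFunctionField

theorem natCast_le_trdeg_functionField {d : ℕ} (hd : d ≤ topologicalKrullDim V.X) :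
    (d : Cardinal) ≤ Algebra.trdeg k V.X.functionField := by
  obtain ⟨l, rfl⟩ := Order.le_krullDim_iff.1 hd
  -- A chain of irreducible closed sets is a chain of generic points. Its head is the most special
  -- one, so the stalk there is a domain of dimension at least the length of the chain whose
  -- fraction field is the function field.
  let l' : LTSeries V.X := l.map _ (irreducibleSetEquivPoints (α := V.X)).strictMono
  let x : V.X := l'.head
  have hx : (l.length : WithBot ℕ∞) ≤ ringKrullDim (V.X.presheaf.stalk x) := by
    rw [ringKrullDim_stalk_eq_coheight]
    exact_mod_cast Order.length_le_coheight (p := l') le_rfl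
  let _ : Algebra k (V.X.presheaf.stalk x) := (V.constantsStalk x).toAlgebra
  refine (Algebra.natCast_le_trdeg_of_le_ringKrullDim (k := k) hx).trans ?_
  let f : V.X.presheaf.stalk x →ₐ[k] V.X.functionField :=
    { algebraMap (V.X.presheaf.stalk x) V.X.functionField with
      commutes' c := V.algebraMap_constantsStalk x c }
  exact trdeg_le_of_injective f
    (IsFractionRing.injective (V.X.presheaf.stalk x) V.X.functionField)

/-- The complement of `U` is a finite union of irreducible closed sets. A codimension-one point in
it must be the generic point of one of them: otherwise that generic point would lie strictly between
it and the generic point of `V.X`, giving codimension at least two. -/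
lemma finite_primeDivisor_notMem (U : V.X.Opens) (hU : genericPoint V.X ∈ U) :
    {x : V.PrimeDivisor | x.1 ∉ U}.Finite := by
  obtain ⟨S, hS, hSc, hSi, hSU⟩ :=
    TopologicalSpace.NoetherianSpace.exists_finite_set_isClosed_irreducible U.isOpen.isClosed_compl
  have : Finite S := hS
  let γ (T : S) : V.X := (hSi T T.2).genericPoint
  refine Set.Finite.of_finite_image (f := Subtype.val) ((Set.finite_range γ).subset ?_)
    Subtype.val_injective.injOn
  rintro _ ⟨x, hx, rfl⟩
  have hx' : x.1 ∈ ⋃₀ S := hSU ▸ hx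
  obtain ⟨T, hT, hxT⟩ := hx'
  refine ⟨⟨T, hT⟩, ?_⟩
  have hgen := (hSi T hT).isGenericPoint_genericPoint (hSc T hT)
  have hle : x.1 ≤ γ ⟨T, hT⟩ := hgen.specializes hxT
  by_contra hne
  have hlt : x.1 < γ ⟨T, hT⟩ := lt_of_le_not_ge hle fun h =>
    hne (Specializes.antisymm hle h).eq
  have hmem : γ ⟨T, hT⟩ ∉ U := by
    have : γ ⟨T, hT⟩ ∈ ⋃₀ S := ⟨T, hT, hgen.mem⟩
    rwa [← hSU] at this
  have hle2 : γ ⟨T, hT⟩ ≤ genericPoint V.X := genericPoint_specializes _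
  have hlt2 : γ ⟨T, hT⟩ < genericPoint V.X := lt_of_le_not_ge hle2 fun h =>
    hmem ((Specializes.antisymm hle2 h).eq ▸ hU)
  have h1 := Order.coheight_add_one_le hlt2
  have h2 := Order.coheight_add_one_le hlt
  rw [x.2] at h2
  have h3 : (1 : ℕ∞) + 1 ≤ 1 := le_trans (by gcongr; exact le_trans (by simp) h1) h2
  norm_num at h3

/-- A rational function is regular on some nonempty open set, so its poles lie in the complement. -/
lemma finite_ord_neg (a : V.X.functionField) :
    {x : V.PrimeDivisor | Scheme.ord a x.1 < 0}.Finite := by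
  by_cases ha : a = 0
  · simp [ha]
  obtain ⟨U, hU, b, rfl⟩ := V.X.presheaf.exists_germ_eq a
  refine (V.finite_primeDivisor_notMem U hU).subset fun x hx hxU => ?_
  have : Nonempty U := ⟨⟨_, hU⟩⟩
  have hb : b ≠ 0 := by
    rintro rfl
    exact ha (map_zero _)
  have h1 := Scheme.ord_le_smul hxU hb 1
  have h2 := Scheme.ord_mul (x := x.1) (one_ne_zero (α := V.X.functionField)) one_ne_zero
  rw [mul_one] at h2
  rw [Algebra.smul_def, mul_one] at h1
  have h3 : Scheme.ord (V.X.presheaf.germ U (genericPoint V.X) hU b) x.1 < 0 := hx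
  have h4 : Scheme.ord (V.X.presheaf.germ U (genericPoint V.X) hU b) x.1 =
    Scheme.ord (algebraMap Γ(V.X, U) V.X.functionField b) x.1 := rfl
  linarith

/-- Clearing denominators: an effective divisor `E` large enough to absorb the poles of `a` as a
section in degree `n` is linearly equivalent to some `∑ i, m i • D i`, because the classes of the `D
i` generate the Picard group. -/
lemma exists_section {r : ℕ} {D : Fin r → V.Divisor}
    (hD : Submodule.span ℤ (Set.range fun i => (QuotientAddGroup.mk (D i) : V.Pic)) = ⊤)
    {a : V.X.functionField} (ha : a ≠ 0) (n : Fin r → ℤ) :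
    ∃ (m : Fin r → ℤ) (c : V.X.functionField), c ≠ 0 ∧ c ∈ V.sections (∑ i, m i • D i) ⊤ ∧
      c * a ∈ V.sections (∑ i, (m + n) i • D i) ⊤ := by
  let Dn := ∑ i, n i • D i
  have hfin : (Function.support fun x : V.PrimeDivisor =>
      max 0 (-(Scheme.ord a x.1 + Dn x))).Finite := by
    refine ((V.finite_ord_neg a).union Dn.support.finite_toSet).subset fun x hx => ?_
    by_contra hx'
    simp only [Set.mem_union, Set.mem_ofPred_eq, Finset.mem_coe, Finsupp.mem_support_iff,
      not_or, not_lt, not_not] at hx'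
    refine hx ?_
    simp only [hx'.2]
    exact max_eq_left (by linarith [hx'.1])
  let E : V.Divisor := Finsupp.ofSupportFinite _ hfin
  have hE (x) : E x = max 0 (-(Scheme.ord a x.1 + Dn x)) := rfl
  obtain ⟨m, hm⟩ := (Submodule.mem_span_range_iff_exists_fun ℤ).1
    (hD ▸ Submodule.mem_top : (QuotientAddGroup.mk E : V.Pic) ∈ _)
  have hm' : (QuotientAddGroup.mk (∑ i, m i • D i) : V.Pic) = QuotientAddGroup.mk E := by
    rw [← hm]
    exact map_sum (QuotientAddGroup.mk' V.principalDivisors) _ _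
  -- The sign convention gives `div c = E - ∑ i, m i • D i`, so as a section in degree `m` the
  -- function `c` has divisor `E`.
  obtain ⟨c, hc, hcx⟩ := QuotientAddGroup.eq.1 hm'
  simp only [Finsupp.add_apply, Finsupp.neg_apply, hE] at hcx
  refine ⟨m, c, hc, .inr fun x _ => ?_, .inr fun x _ => ?_⟩
  · rw [← hcx]
    simp
  · rw [Scheme.ord_mul hc ha, ← hcx]
    simp only [Pi.add_apply, add_smul, Finset.sum_add_distrib, Finsupp.add_apply]
    have := le_max_right 0 (-(Scheme.ord a x.1 + Dn x))
    linarith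

lemma single_mem_coxRing {r : ℕ} (D : Fin r → V.Divisor) {m : Fin r → ℤ} {c : V.X.functionField}
    (hc : c ∈ V.sections (∑ i, m i • D i) ⊤) :
    (AddMonoidAlgebra.single m c : V.LaurentRing r) ∈ V.coxRing D := by
  refine Subring.subset_closure fun m' => ?_
  by_cases h : m = m'
  · subst h
    simpa using hc
  · left
    simp [h]

end CoxModel.SmoothProjectiveVariety

/-! ### Transcendence degree of the Laurent ring, the Cox ring and `R` -/

section Laurent

/-- Evaluation at these monomials is the map of monoid algebras induced by the injection of
exponents from ℕʳ to ℤʳ. -/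
theorem AddMonoidAlgebra.algebraicIndependent_single (K : Type u) [Field K] (r : ℕ) :
    AlgebraicIndependent K fun i : Fin r =>
      (single (Pi.single i 1) 1 : AddMonoidAlgebra K (Fin r → ℤ)) := by
  let g : (Fin r →₀ ℕ) →+ (Fin r → ℤ) :=
    { toFun e i := e i
      map_zero' := by ext; simp
      map_add' := by intros; ext; simp }
  have hg : Function.Injective g := fun a b h => Finsupp.ext fun i => by
    have : (a i : ℤ) = b i := congrFun h i
    exact_mod_cast this
  let φ : MvPolynomial (Fin r) K →ₐ[K] AddMonoidAlgebra K (Fin r → ℤ) :=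
    mapDomainAlgHom K K g
  have h : MvPolynomial.aeval (fun i : Fin r =>
      (single (Pi.single i 1) 1 : AddMonoidAlgebra K (Fin r → ℤ))) = φ := by
    refine MvPolynomial.algHom_ext fun i => ?_
    rw [MvPolynomial.aeval_X]
    have : φ (.X i) = single (g (Finsupp.single i 1)) 1 :=
      mapDomain_single
    rw [this]
    congr 1
    ext j
    simp [g, Pi.single_apply, Finsupp.single_apply, eq_comm]
  rw [AlgebraicIndependent, h]
  exact mapDomain_injective hg

end Laurent

namespace CoxModel

namespace SmoothProjectiveVariety

variable {k : Type u} [Field k] (V : SmoothProjectiveVariety k)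

attribute [local instance] algebraFunctionField

theorem natCast_add_le_trdeg_laurentRing {d : ℕ} (hd : d ≤ topologicalKrullDim V.X) (r : ℕ) :
    (d + r : Cardinal) ≤ Algebra.trdeg k (V.LaurentRing r) := by
  have h1 := V.natCast_le_trdeg_functionField hd
  have h2 := (AddMonoidAlgebra.algebraicIndependent_single
    V.X.functionField r).lift_cardinalMk_le_trdeg
  simp only [Cardinal.mk_fin, Cardinal.lift_natCast] at h2
  calc (d + r : Cardinal) ≤ Algebra.trdeg k V.X.functionField +
        Algebra.trdeg V.X.functionField (V.LaurentRing r) := add_le_add h1 (by simpa using h2)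
    _ ≤ _ := trdeg_add_le

/-- The Laurent polynomial ring over the function field is algebraic over the Cox ring. -/
theorem isAlgebraic_laurentRing {r : ℕ} {D : Fin r → V.Divisor}
    (hD : Submodule.span ℤ (Set.range fun i => (QuotientAddGroup.mk (D i) : V.Pic)) = ⊤)
    {S : Subalgebra k (V.LaurentRing r)} (hS : ∀ x ∈ V.coxRing D, x ∈ S) :
    Algebra.IsAlgebraic S (V.LaurentRing r) := by
  have hsingle (n : Fin r → ℤ) (a : V.X.functionField) :
      IsAlgebraic S (AddMonoidAlgebra.single n a : V.LaurentRing r) := by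
    by_cases ha : a = 0
    · rw [ha, AddMonoidAlgebra.single_zero]
      exact isAlgebraic_zero
    obtain ⟨m, c, hc0, hc, hca⟩ := V.exists_section hD ha n
    -- With numerator `y` and denominator `x` in the Cox ring, the monomial is a root of the linear
    -- polynomial `x X - y`.
    let x : S := ⟨_, hS _ (V.single_mem_coxRing D hc)⟩
    let y : S := ⟨_, hS _ (V.single_mem_coxRing D hca)⟩
    have hx : x ≠ 0 := fun h => hc0 <| by
      have : (AddMonoidAlgebra.single m c : V.LaurentRing r) = 0 := congrArg Subtype.val h
      exact AddMonoidAlgebra.single_eq_zero.1 this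
    refine ⟨.C x * .X - .C y, fun h => hx ?_, ?_⟩
    · simpa using congr(Polynomial.coeff $h 1)
    · have : (x : V.LaurentRing r) * AddMonoidAlgebra.single n a = y :=
        AddMonoidAlgebra.single_mul_single ..
      simp only [map_sub, map_mul, Polynomial.aeval_C, Polynomial.aeval_X]
      exact sub_eq_zero.2 this
  refine ⟨fun x => ?_⟩
  induction x using AddMonoidAlgebra.induction_linear with
  | zero => exact isAlgebraic_zero
  | add x y hx hy => exact hx.add hy
  | single n a => exact hsingle n a

end SmoothProjectiveVariety

namespace TorsorModel

variable {A k : Type u} [CommRing A] [Field k] [Algebra A k] {r N s m : ℕ}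
  (M : TorsorModel A k r N s m)

attribute [local instance] SmoothProjectiveVariety.algebraFunctionField

lemma presentation_eq_aeval (P : MvPolynomial (Fin N) k) : M.V.presentation M.w M.η P =
    MvPolynomial.aeval (fun j => (AddMonoidAlgebra.single (M.w j) (M.η j) : M.V.LaurentRing r)) P :=
  rfl

/-- The Laurent ring is algebraic over the subalgebra generated by the Cox generators, so a
transcendence basis over the field can be chosen among them. These are images of variables of `R`,
and independence over the field implies independence over `A`. -/
theorem natCast_add_le_trdeg [FaithfulSMul A k] {d : ℕ}
    (hd : d ≤ topologicalKrullDim M.V.X) :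
    (d + r : Cardinal) ≤ Algebra.trdeg A (RelRing M.g) := by
  let E (j : Fin N) : M.V.LaurentRing r := AddMonoidAlgebra.single (M.w j) (M.η j)
  have : Algebra.IsAlgebraic (Algebra.adjoin k (Set.range E)) (M.V.LaurentRing r) := by
    refine M.V.isAlgebraic_laurentRing M.span_eq_top fun x hx => ?_
    rw [← M.range_eq] at hx
    obtain ⟨P, rfl⟩ := hx
    rw [Algebra.adjoin_range_eq_range_aeval]
    exact ⟨P, rfl⟩
  obtain ⟨t, htE, ht⟩ := exists_isTranscendenceBasis_subset (R := k) (Set.range E)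
  have hle := M.V.natCast_add_le_trdeg_laurentRing hd r
  rw [← ht.cardinalMk_eq_trdeg] at hle
  choose j hj using fun x : t => htE x.2
  let _ : Algebra A (M.V.LaurentRing r) :=
    ((algebraMap k (M.V.LaurentRing r)).comp (algebraMap A k)).toAlgebra
  have : IsScalarTower A k (M.V.LaurentRing r) := .of_algebraMap_eq fun _ => rfl
  have hind := ht.1.restrictScalars (FaithfulSMul.algebraMap_injective A k)
  let φ : RelRing M.g →ₐ[A] M.V.LaurentRing r :=
    { M.toLaurent with commutes' a := M.toLaurent_algebraMap a }
  have hind' : AlgebraicIndependent A fun x : t =>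
      (Ideal.Quotient.mk _ (MvPolynomial.X (j x)) : RelRing M.g) := by
    refine .of_comp φ ?_
    convert hind using 1
    ext1 x
    refine (M.toLaurent_mk _).trans (Eq.trans ?_ (hj x))
    rw [MvPolynomial.map_X, presentation_eq_aeval, MvPolynomial.aeval_X]
  have : Nontrivial A := (algebraMap A k).domain_nontrivial
  exact hle.trans hind'.cardinalMk_le_trdeg

end TorsorModel

end CoxModel

/-! ### Finite generation of the degree-0 parts -/

namespace CoxModel

section FiniteType

variable {A : Type*} [CommRing A] {N s r : ℕ}

lemma monomialClass_add (g : Fin s → MvPolynomial (Fin N) A) (e e' : Fin N →₀ ℕ) :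
    monomialClass g (e + e') = monomialClass g e * monomialClass g e' := by
  simp [monomialClass, ← map_mul, MvPolynomial.monomial_mul]

lemma monomialClass_zero (g : Fin s → MvPolynomial (Fin N) A) : monomialClass g 0 = 1 := by
  simp only [monomialClass, MvPolynomial.monomial_zero', map_one]

/-- The degree-`0` part of the localization at a homogeneous element is finitely generated. -/
theorem fg_degreeZeroPart (g : Fin s → MvPolynomial (Fin N) A) (w : Fin N → Fin r → ℤ)
    {F : RelRing g} {d : Fin r → ℤ} (hF : F ∈ gradedPiece g w d) :
    (degreeZeroPart (gradedPiece g w) hF).FG := by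
  classical
  let f₁ : (Fin N →₀ ℕ) × ℕ →+ (Fin r → ℤ) := (Finsupp.weight w).comp (AddMonoidHom.fst _ _)
  let f₂ : (Fin N →₀ ℕ) × ℕ →+ (Fin r → ℤ) :=
    ((smulAddHom ℕ (Fin r → ℤ)).flip d).comp (AddMonoidHom.snd _ _)
  let θ (x : (Fin N →₀ ℕ) × ℕ) : Localization.Away F :=
    algebraMap (RelRing g) _ (monomialClass g x.1) * IsLocalization.Away.invSelf F ^ x.2
  have hθ0 : θ 0 = 1 := by simp [θ, monomialClass_zero]
  have hθadd (x y) : θ (x + y) = θ x * θ y := by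
    simp only [θ, Prod.fst_add, Prod.snd_add, monomialClass_add, map_mul, pow_add]
    ring
  -- The pairs `(α, n)` for which the monomial with exponent `α` divided by `F ^ n` has degree 0
  -- form an equalizer submonoid of ℕᴺ × ℕ. It is finitely generated by Gordan's lemma, and `θ`
  -- turns its generators into algebra generators.
  obtain ⟨T, hT⟩ := AddSubmonoid.fg_eqLocusM f₁ f₂
  have hinv (n : ℕ) : IsLocalization.Away.invSelf (S := Localization.Away F) F ^ n *
      algebraMap (RelRing g) _ F ^ n = 1 := by rw [← mul_pow, invSelf_mul, one_pow]
  refine ⟨T.image θ, le_antisymm (Algebra.adjoin_le ?_) ?_⟩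
  · intro y hy
    obtain ⟨x, hx, rfl⟩ := Finset.mem_image.1 (Finset.mem_coe.1 hy)
    have hxT : x ∈ f₁.eqLocusM f₂ := hT ▸ AddSubmonoid.subset_closure (Finset.mem_coe.2 hx)
    refine ⟨x.2, monomialClass g x.1, ?_, ?_⟩
    · have h : Finsupp.weight w x.1 = x.2 • d := hxT
      rw [zero_add, ← h]
      exact ⟨_, MvPolynomial.isWeightedHomogeneous_monomial _ _ _ rfl, rfl⟩
    · rw [mul_assoc, hinv, mul_one]
  · rintro x ⟨n, _, ⟨P, hP, rfl⟩, hx⟩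
    rw [zero_add] at hP
    have hmem {y} (hy : y ∈ f₁.eqLocusM f₂) : θ y ∈ Algebra.adjoin A (T.image θ : Set _) := by
      rw [← hT] at hy
      induction hy using AddSubmonoid.closure_induction with
      | mem y hy => exact Algebra.subset_adjoin (Finset.mem_coe.2 (Finset.mem_image_of_mem θ hy))
      | zero => rw [hθ0]; exact one_mem _
      | add y z _ _ hy hz => rw [hθadd]; exact mul_mem hy hz
    have hx' : x = ∑ α ∈ P.support, P.coeff α • θ (α, n) := by
      have h1 : x = algebraMap (RelRing g) _ (Ideal.Quotient.mk _ P) *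
          IsLocalization.Away.invSelf F ^ n := by
        have h2 : x * algebraMap (RelRing g) _ F ^ n =
          algebraMap (RelRing g) _ (Ideal.Quotient.mk _ P) := hx
        rw [← h2, mul_assoc, mul_comm (_ ^ n), hinv, mul_one]
      have h3 : algebraMap (RelRing g) (Localization.Away F) (Ideal.Quotient.mk _ P) =
          ∑ α ∈ P.support, P.coeff α • algebraMap (RelRing g) _ (monomialClass g α) := by
        let φ : MvPolynomial (Fin N) A →ₐ[A] Localization.Away F :=
          (IsScalarTower.toAlgHom A (RelRing g) _).comp (Ideal.Quotient.mkₐ A _)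
        change φ P = _
        conv_lhs => rw [P.as_sum]
        rw [map_sum]
        refine Finset.sum_congr rfl fun α _ => ?_
        rw [← mul_one (P.coeff α), ← smul_eq_mul, ← MvPolynomial.smul_monomial, map_smul]
        simp only [smul_eq_mul, mul_one]
        rfl
      rw [h1, h3, Finset.sum_mul]
      simp only [θ, smul_mul_assoc]
    rw [hx']
    refine sum_mem fun α hα => Subalgebra.smul_mem _ (hmem ?_) _
    exact hP (MvPolynomial.mem_support_iff.1 hα)

end FiniteType

/-! ### The charts: Laurent embedding, faithful flatness and smoothness -/

namespace TorsorModel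

variable {A k : Type u} [CommRing A] [Field k] [Algebra A k] {r N s m : ℕ}
  (M : TorsorModel A k r N s m)

/-- The coefficient is nonzero because the monomial is not in `I`. As a single term over a field,
the image is a unit, so the localizations of `R` at products of the monomials also embed in the
Laurent ring. -/
lemma toLaurent_monomialClass (i : Fin m) : ∃ a ≠ 0, M.toLaurent (monomialClass M.g (M.e i)) =
    AddMonoidAlgebra.single (Finsupp.weight M.w (M.e i)) a := by
  have h : M.toLaurent (monomialClass M.g (M.e i)) =
      M.V.presentation M.w M.η (MvPolynomial.monomial (M.e i) 1) := by
    rw [monomialClass, toLaurent_mk, MvPolynomial.map_monomial, map_one]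
  refine ⟨_, fun h0 => M.monomial_notMem i ?_, h.trans (M.V.presentation_monomial ..)⟩
  rw [← M.ker_eq, RingHom.mem_ker, M.V.presentation_monomial, h0, AddMonoidAlgebra.single_zero]

lemma toLaurent_prod (S : Finset (Fin m)) : ∃ a ≠ 0,
    M.toLaurent (∏ i ∈ S, monomialClass M.g (M.e i)) =
      AddMonoidAlgebra.single (∑ i ∈ S, Finsupp.weight M.w (M.e i)) a := by
  induction S using Finset.induction_on with
  | empty => exact ⟨1, one_ne_zero, by simp [AddMonoidAlgebra.one_def]⟩
  | insert i S hi ih =>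
    obtain ⟨a, ha, h⟩ := ih
    obtain ⟨b, hb, h'⟩ := M.toLaurent_monomialClass i
    refine ⟨b * a, mul_ne_zero hb ha, ?_⟩
    rw [Finset.prod_insert hi, Finset.sum_insert hi, map_mul, h, h',
      AddMonoidAlgebra.single_mul_single]

/-- The presentation intertwines weighted components of polynomials with coefficients of Laurent
polynomials, so the image of `R` is closed under taking homogeneous components. -/
lemma toLaurent_mem_gradedPiece {d : Fin r → ℤ} (x : RelRing M.g) :
    ∃ y ∈ gradedPiece M.g M.w d,
      M.toLaurent y = AddMonoidAlgebra.single d ((M.toLaurent x).coeff d) := by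
  obtain ⟨P, rfl⟩ := Ideal.Quotient.mk_surjective x
  refine ⟨Ideal.Quotient.mk _ (MvPolynomial.weightedHomogeneousComponent M.w d P),
    ⟨_, MvPolynomial.weightedHomogeneousComponent_mem _ _ _, rfl⟩, ?_⟩
  rw [toLaurent_mk, toLaurent_mk, ← SmoothProjectiveVariety.presentation_component]
  congr 1
  ext e
  simp only [MvPolynomial.coeff_map, MvPolynomial.coeff_weightedHomogeneousComponent]
  split_ifs <;> simp

lemma toLaurent_of_mem_gradedPiece {d : Fin r → ℤ} {x : RelRing M.g}
    (hx : x ∈ gradedPiece M.g M.w d) : ∃ a, M.toLaurent x = AddMonoidAlgebra.single d a := by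
  obtain ⟨P, hP, rfl⟩ := hx
  have hP' : MvPolynomial.weightedHomogeneousComponent M.w d P = P :=
    MvPolynomial.weightedHomogeneousComponent_eq_self hP
  have : MvPolynomial.map (algebraMap A k) P = MvPolynomial.weightedHomogeneousComponent M.w d
      (MvPolynomial.map (algebraMap A k) P) := by
    conv_lhs => rw [← hP']
    ext e
    simp only [MvPolynomial.coeff_map, MvPolynomial.coeff_weightedHomogeneousComponent]
    split_ifs <;> simp
  refine ⟨(M.V.presentation M.w M.η (MvPolynomial.map (algebraMap A k) P)).coeff d,
    (M.toLaurent_mk P).trans ?_⟩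
  rw [← SmoothProjectiveVariety.presentation_component, ← this]

section Localization

variable (S : Finset (Fin m))

lemma isUnit_toLaurent_prod : IsUnit (M.toLaurent (∏ i ∈ S, monomialClass M.g (M.e i))) := by
  obtain ⟨a, ha, h⟩ := M.toLaurent_prod S
  rw [h]
  refine .of_mul_eq_one (AddMonoidAlgebra.single (-∑ i ∈ S, Finsupp.weight M.w (M.e i)) a⁻¹) ?_
  rw [AddMonoidAlgebra.single_mul_single, add_neg_cancel, mul_inv_cancel₀ ha,
    AddMonoidAlgebra.one_def]

/-- The embedding of a localization of `R` in the Laurent polynomial ring over the function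
field. -/
noncomputable def awayToLaurent :
    Localization.Away (∏ i ∈ S, monomialClass M.g (M.e i)) →+* M.V.LaurentRing r :=
  IsLocalization.Away.lift (∏ i ∈ S, monomialClass M.g (M.e i)) (M.isUnit_toLaurent_prod S)

lemma awayToLaurent_algebraMap (x : RelRing M.g) :
    M.awayToLaurent S (algebraMap _ _ x) = M.toLaurent x :=
  IsLocalization.Away.lift_eq _ _ x

lemma awayToLaurent_injective : Function.Injective (M.awayToLaurent S) := by
  rw [injective_iff_map_eq_zero]
  intro x hx
  obtain ⟨n, a, ha⟩ := IsLocalization.Away.surj (∏ i ∈ S, monomialClass M.g (M.e i)) x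
  have h := congr(M.awayToLaurent S $ha)
  rw [map_mul, hx, zero_mul, awayToLaurent_algebraMap, eq_comm,
    map_eq_zero_iff _ M.toLaurent_injective] at h
  rw [h, map_zero] at ha
  exact ((IsLocalization.Away.algebraMap_isUnit _).pow n).mul_left_eq_zero.1 ha

lemma exists_awayToLaurent_eq_single (x : M.isChartFamily.chartRing S) :
    ∃ a, M.awayToLaurent S x = AddMonoidAlgebra.single 0 a := by
  obtain ⟨x, n, y, hy, hxy⟩ := x
  obtain ⟨b, hb⟩ := M.toLaurent_of_mem_gradedPiece hy
  obtain ⟨a, ha, h⟩ := M.toLaurent_prod S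
  refine ⟨b * (a ^ n)⁻¹, ?_⟩
  have h1 := congr(M.awayToLaurent S $hxy)
  rw [map_mul, map_pow, awayToLaurent_algebraMap, awayToLaurent_algebraMap, hb, h,
    AddMonoidAlgebra.single_pow] at h1
  refine ((M.isUnit_toLaurent_prod S).pow n).mul_right_cancel ?_
  rw [h, AddMonoidAlgebra.single_pow, h1, AddMonoidAlgebra.single_mul_single,
    inv_mul_cancel_right₀ (pow_ne_zero n ha)]

/-- The degree-`0` component of an element of `R[f⁻¹]` lies in the degree-`0` part. -/
lemma exists_degreeZero (x : Localization.Away (∏ i ∈ S, monomialClass M.g (M.e i))) :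
    ∃ y : M.isChartFamily.chartRing S, M.awayToLaurent S y =
      AddMonoidAlgebra.single 0 ((M.awayToLaurent S x).coeff 0) := by
  obtain ⟨n, z, hz⟩ := IsLocalization.Away.surj (∏ i ∈ S, monomialClass M.g (M.e i)) x
  obtain ⟨a, ha, h⟩ := M.toLaurent_prod S
  -- The degree-0 component of a fraction is obtained from the component of its numerator in the
  -- degree of its denominator.
  obtain ⟨z₀, hz₀, h₀⟩ := M.toLaurent_mem_gradedPiece
    (d := 0 + n • ∑ i ∈ S, Finsupp.weight M.w (M.e i)) z
  have hinv : IsLocalization.Away.invSelf (S := Localization.Away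
      (∏ i ∈ S, monomialClass M.g (M.e i))) (∏ i ∈ S, monomialClass M.g (M.e i)) ^ n *
      algebraMap (RelRing M.g) _ (∏ i ∈ S, monomialClass M.g (M.e i)) ^ n = 1 := by
    rw [← mul_pow, invSelf_mul, one_pow]
  obtain ⟨y, hy⟩ : ∃ y : Localization.Away (∏ i ∈ S, monomialClass M.g (M.e i)),
      y * algebraMap _ _ (∏ i ∈ S, monomialClass M.g (M.e i)) ^ n =
        algebraMap (RelRing M.g) _ z₀ :=
    ⟨algebraMap _ _ z₀ * IsLocalization.Away.invSelf _ ^ n, by rw [mul_assoc, hinv, mul_one]⟩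
  refine ⟨⟨y, n, z₀, hz₀, hy⟩, ?_⟩
  · have h1 := congr(M.awayToLaurent S $hz)
    rw [map_mul, map_pow, awayToLaurent_algebraMap, awayToLaurent_algebraMap, h,
      AddMonoidAlgebra.single_pow] at h1
    refine ((M.isUnit_toLaurent_prod S).pow n).mul_right_cancel ?_
    have h2 := congr(M.awayToLaurent S $hy)
    rw [map_mul, map_pow, awayToLaurent_algebraMap, awayToLaurent_algebraMap] at h2
    refine h2.trans ?_
    rw [h₀, h, AddMonoidAlgebra.single_pow,
      AddMonoidAlgebra.single_mul_single, ← h1]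
    exact congrArg _ (AddMonoidAlgebra.coeff_mul_single_eq_coeff_mul 0 fun _ _ => by simp)

/-- If `R[f⁻¹]` is flat over its degree-`0` part, then it is faithfully flat. -/
theorem faithfullyFlat_of_flat [Module.Flat (M.isChartFamily.chartRing S)
      (Localization.Away (∏ i ∈ S, monomialClass M.g (M.e i)))] :
    Module.FaithfullyFlat (M.isChartFamily.chartRing S)
      (Localization.Away (∏ i ∈ S, monomialClass M.g (M.e i))) where
  submodule_ne_top I hI htop := by
    -- Taking degree-0 components is linear over the degree-0 ring, so it sends the extension of `I`
    -- into `I`. If the extended ideal were everything, applying this to 1 would give `1 ∈ I`.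
    have key (z) (hz : z ∈ I • (⊤ : Submodule (M.isChartFamily.chartRing S)
        (Localization.Away (∏ i ∈ S, monomialClass M.g (M.e i))))) :
        ∃ y ∈ I, M.awayToLaurent S y =
          AddMonoidAlgebra.single 0 ((M.awayToLaurent S z).coeff 0) := by
      induction hz using Submodule.smul_induction_on' with
      | smul x hx b _ =>
        obtain ⟨b₀, hb₀⟩ := M.exists_degreeZero S b
        obtain ⟨a, ha⟩ := M.exists_awayToLaurent_eq_single S x
        refine ⟨x * b₀, I.mul_mem_right _ hx, ?_⟩
        rw [Algebra.smul_def, map_mul]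
        change _ = AddMonoidAlgebra.single 0 ((M.awayToLaurent S x * _).coeff 0)
        rw [Subalgebra.coe_mul, map_mul, hb₀, ha, AddMonoidAlgebra.single_mul_single]
        simp
      | add z _ z' _ h h' =>
        obtain ⟨y, hy, h⟩ := h
        obtain ⟨y', hy', h'⟩ := h'
        refine ⟨y + y', add_mem hy hy', ?_⟩
        rw [Subalgebra.coe_add, map_add, map_add, h, h', AddMonoidAlgebra.coeff_add,
          ← AddMonoidAlgebra.single_add, Finsupp.add_apply]
    obtain ⟨y, hy, h⟩ := key 1 (by rw [htop]; trivial)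
    refine hI.ne_top ((Ideal.eq_top_iff_one _).2 ?_)
    convert hy
    refine Subtype.ext (M.awayToLaurent_injective S ?_)
    rw [h, map_one, Subalgebra.coe_one, map_one]
    simp [AddMonoidAlgebra.one_def]

variable {S}

/-- On the open piece indexed by `S`, `π` factors through the inclusion of the chart. This inclusion
is an open immersion, hence a monomorphism, and flatness cancels against monomorphisms on the target
side. -/
lemma flat_chartRing (hπ : Flat M.π) (hS : S.Nonempty) :
    Module.Flat (M.isChartFamily.chartRing S)
      (Localization.Away (∏ i ∈ S, monomialClass M.g (M.e i))) := by
  let S' : (ChartIndex (Fin m))ᵒᵖ := .op ⟨S, hS⟩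
  let h := M.isChartFamily
  have hι : IsOpenImmersion (h.chartι S') :=
    inferInstanceAs (IsOpenImmersion (colimit.ι h.charts S'))
  have h1 : complementIncl (fun i => monomialClass M.g (M.e i)) S' ≫ M.π =
      h.toCharts.app S' ≫ h.chartι S' :=
    (complementCover fun i => monomialClass M.g (M.e i)).map_glueMorphismsOfLocallyDirected
      (fun S => h.localProj S) (fun g => h.map_localProj g) S'
  have h2 : Flat (h.toCharts.app S' ≫ h.chartι S') := by
    rw [← h1]
    exact MorphismProperty.comp_mem @Flat _ _ inferInstance hπ
  have := MorphismProperty.IsStableUnderBaseChange.hasOfPostcompProperty_monomorphisms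
    (P := @Flat.{u})
  have h3 : Flat (h.toCharts.app S') :=
    MorphismProperty.of_postcomp (W := @Flat.{u}) (W' := MorphismProperty.monomorphisms Scheme.{u})
      _ (h.chartι S') (inferInstanceAs (Mono (h.chartι S'))) h2
  exact Flat.SpecMap_iff.1 h3

/-- The charts of `X` are smooth over `A`. -/
theorem smooth_chartRing [IsDedekindDomain A] [FaithfulSMul A k] (hπ : Flat M.π)
    (hJ : ∀ p : PrimeSpectrum A, ∀ a ∈ M.points (AlgebraicClosure p.asIdeal.ResidueField),
      ((M.jacobian a).rank : WithBot ℕ∞) + topologicalKrullDim M.V.X + (r : WithBot ℕ∞) =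
        (N : WithBot ℕ∞)) (hS : S.Nonempty) :
    Algebra.Smooth A (M.isChartFamily.chartRing S) := by
  obtain ⟨i, hi⟩ := hS
  have := M.smooth_away hJ (fun _ hd => M.natCast_add_le_trdeg hd) i
    (Finset.dvd_prod_of_mem (fun i => monomialClass M.g (M.e i)) hi)
  have := M.flat_chartRing hπ ⟨i, hi⟩
  have := M.faithfullyFlat_of_flat S
  have : Algebra.FiniteType A (M.isChartFamily.chartRing S) := by
    rw [← Subalgebra.fg_iff_finiteType]
    exact fg_degreeZeroPart M.g M.w _
  have : Algebra.FinitePresentation A (M.isChartFamily.chartRing S) :=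
    Algebra.FinitePresentation.of_finiteType.1 this
  -- The chart ring is a domain, so injectivity makes it torsion-free, hence flat over the Dedekind
  -- domain `A`, as the descent of smoothness requires.
  have hinj : Function.Injective (algebraMap A (M.isChartFamily.chartRing S)) := by
    refine Function.Injective.of_comp (f := Subtype.val) ?_
    have h : Function.Injective (algebraMap (RelRing M.g) (Localization.Away
        (∏ i ∈ S, monomialClass M.g (M.e i)))) := by
      refine Function.Injective.of_comp (f := M.awayToLaurent S) ?_
      rw [show M.awayToLaurent S ∘ _ = M.toLaurent from
        funext (M.awayToLaurent_algebraMap S)]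
      exact M.toLaurent_injective
    exact h.comp M.algebraMap_injective
  have := (faithfulSMul_iff_algebraMap_injective A (M.isChartFamily.chartRing S)).2 hinj
  exact Algebra.Smooth.of_faithfullyFlat (E := Localization.Away
    (∏ i ∈ S, monomialClass M.g (M.e i)))

end Localization

theorem smooth_toSpec [IsDedekindDomain A] [FaithfulSMul A k] (hπ : Flat M.π)
    (hJ : ∀ p : PrimeSpectrum A, ∀ a ∈ M.points (AlgebraicClosure p.asIdeal.ResidueField),
      ((M.jacobian a).rank : WithBot ℕ∞) + topologicalKrullDim M.V.X + (r : WithBot ℕ∞) =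
        (N : WithBot ℕ∞)) : Smooth M.toSpec := by
  let h := M.isChartFamily
  have := HasRingHomProperty.instIsZariskiLocalAtSource (P := @Smooth.{u}) (Q := @RingHom.Smooth)
  refine (IsZariskiLocalAtSource.iff_of_openCover (P := @Smooth.{u})
    (Scheme.IsLocallyDirected.openCover h.charts)).2 fun S => ?_
  have h1 : (Scheme.IsLocallyDirected.openCover h.charts).f S ≫ M.toSpec =
      Spec.map (CommRingCat.ofHom (algebraMap A (h.chartRing S.unop.1))) :=
    colimit.ι_desc _ _
  rw [h1]
  exact (HasRingHomProperty.Spec_iff (P := @Smooth.{u})).2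
    (RingHom.smooth_algebraMap.2 (M.smooth_chartRing hπ hJ (Opposite.unop S).2))

end TorsorModel

end CoxModel

theorem proposition3p6 {A : Type u} [CommRing A] [IsDedekindDomain A]
    (K : Type u) [Field K] [CharZero K] [Algebra A K] [IsFractionRing A K]
    (Kbar : Type u) [Field Kbar] [Algebra K Kbar] [IsAlgClosure K Kbar]
    [Algebra A Kbar] [IsScalarTower A K Kbar]
    {r N s m : ℕ} (M : CoxModel.TorsorModel A Kbar r N s m)
    (hR : GeometricallyIntegral
      (Spec.map (CommRingCat.ofHom (algebraMap A (CoxModel.RelRing M.g)))))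
    (hπ : Flat M.π)
    (hJ : ∀ p : PrimeSpectrum A, ∀ a ∈ M.points (AlgebraicClosure p.asIdeal.ResidueField),
      ((M.jacobian a).rank : WithBot ℕ∞) + topologicalKrullDim M.V.X + (r : WithBot ℕ∞) =
        (N : WithBot ℕ∞)) :
    Smooth M.toSpec := by
  have : FaithfulSMul A Kbar := by
    rw [faithfulSMul_iff_algebraMap_injective, IsScalarTower.algebraMap_eq A K Kbar]
    exact (algebraMap K Kbar).injective.comp (IsFractionRing.injective A K)
  exact M.smooth_toSpec hπ hJ
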